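/- Let $M$ be a compact orientable smooth ($C^\infty$) surface without boundary. A *two-dimensional almost-Riemannian structure* (2-ARS) on $M$ is a triple $\mathcal S=(E,\mathfrak f,\langle\cdot,\cdot\rangle)$, where $E$ is a smooth real vector bundle of rank $2$ over $M$, $\langle\cdot,\cdot\rangle$ is a smooth Euclidean structure on $E$, and $\mathfrak f:E\to TM$ is a smooth bundle morphism covering the identity of $M$ and linear on fibers, such that $\blacktriangle=\{\mathfrak f\circ\sigma : \sigma \text{ a smooth section of } E\}\subset \mathrm{Vec}(M)$ is bracket generating: for every $q\in M$, the values at $q$ of the elements of the Lie algebra generated by $\blacktriangle$ fill $T_qM$. Put $\blacktriangle_1=\blacktriangle$ and $\blacktriangle_{k+1}=\blacktriangle_k+[\blacktriangle,\blacktriangle_k]$, and write $\blacktriangle_k(q)=\{V(q):V\in\blacktriangle_k\}\subseteq T_qM$, $\blacktriangle(q)=\blacktriangle_1(q)$. The *singular set* is $\mathcal Z=\{q\in M:\dim\blacktriangle(q)<2\}$. The structure satisfies (H0) if (i) $\mathcal Z$ is an embedded one-dimensional submanifold of $M$; (ii) the points $q$ at which $\blacktriangle_2(q)$ is one-dimensional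 are isolated; (iii) $\blacktriangle_3(q)=T_qM$ for every $q\in M$. A *tangency point* is a point $q$ at which $\blacktriangle(q)=\blacktriangle_2(q)$ has dimension one and $\blacktriangle_3(q)=T_qM$. An *orthonormal frame* of the 2-ARS on an open set $U\subseteq M$ is a pair $(X_1,X_2)=(\mathfrak f\circ\sigma_1,\mathfrak f\circ\sigma_2)$, where $(\sigma_1,\sigma_2)$ is a smooth orthonormal frame of $E$ over $U$. **Proposition.** Consider a 2-ARS on a compact orientable smooth surface $M$ satisfying (H0), and let $W$ be a connected component of its singular set $\mathcal Z$ that contains no tangency point. Then there exist $\varepsilon>0$, an open (tubular) neighborhood $U$ of $W$, a smooth diffeomorphism $\Phi:(-\varepsilon,\varepsilon)\times S^1\to U$ with $W=\Phi(\{0\}\times S^1)$, an orthonormal frame $(X_1,X_2)$ of the 2-ARS on $U$, and a smooth function $\phi:(-\varepsilon,\varepsilon)\times S^1\to\mathbb R$ such that, in the coordinates $(x,y)\in(-\varepsilon,\varepsilon)\times S^1$ on $U$ given by $\Phi$ (with $y$ the angular coordinate on $S^1=\mathbb R/2\pi\mathbb Z$), $$X_1(x,y)=\frac{\partial}{\partial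 x},\qquad X_2(x,y)=x\,e^{\phi(x,y)}\,\frac{\partial}{\partial y}.$$ -/

import Mathlib

open Set Filter Topology Manifold Bundle ContDiff

noncomputable section

namespace AlmostRiemannian

/-- The Euclidean plane, on which surfaces are modelled. -/
abbrev Plane : Type := EuclideanSpace ℝ (Fin 2)

section Surface

variable (M : Type*) [TopologicalSpace M] [ChartedSpace Plane M] [IsManifold (𝓡 2) ∞ M]

/-- `Vec(M)`: the smooth vector fields on the surface `M`. -/
abbrev Vec : Type _ := ContMDiffSection (𝓡 2) Plane ∞ (fun q : M => TangentSpace (𝓡 2) q)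

variable {M}

theorem natCast_le_smooth (n : ℕ) : minSmoothness ℝ n ≤ (∞ : ℕ∞ω) := by
  rw [minSmoothness_of_isRCLikeNormedField]
  exact_mod_cast (le_top : (n : ℕ∞) ≤ ⊤)

theorem isManifold_minSmoothness (n : ℕ) : IsManifold (𝓡 2) (minSmoothness ℝ n) M :=
  IsManifold.of_le (natCast_le_smooth n)

/-- The Lie bracket of smooth vector fields. -/
instance : Bracket (Vec M) (Vec M) where
  bracket V W :=
    { toFun := VectorField.mlieBracket (𝓡 2) V W
      contMDiff_toFun := by
        have : IsManifold (𝓡 2) (minSmoothness ℝ 2) M := isManifold_minSmoothness 2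
        have : IsManifold (𝓡 2) (minSmoothness ℝ 3) M := isManifold_minSmoothness 3
        have : IsManifold (𝓡 2) (((⊤ : ℕ∞) : ℕ∞ω) + 1) M := inferInstanceAs (IsManifold (𝓡 2) ∞ M)
        exact ContDiff.mlieBracket_vectorField (n := ⊤) (m := ⊤) V.contMDiff W.contMDiff
          (by simp [minSmoothness_of_isRCLikeNormedField]) }

theorem bracket_apply (V W : Vec M) (q : M) :
    (⁅V, W⁆ : Vec M) q = VectorField.mlieBracket (𝓡 2) V W q := rfl

theorem Vec.mdifferentiableAt (V : Vec M) (q : M) :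
    MDifferentiableAt (𝓡 2) ((𝓡 2).prod 𝓘(ℝ, Plane))
      (fun p => (⟨p, V p⟩ : TotalSpace Plane (fun p : M => TangentSpace (𝓡 2) p))) q :=
  (V.contMDiff q).mdifferentiableAt (by simp)

instance : LieRing (Vec M) where
  add_lie U V W := by
    ext q
    exact VectorField.mlieBracket_add_left (U.mdifferentiableAt q) (V.mdifferentiableAt q)
  lie_add U V W := by
    ext q
    exact VectorField.mlieBracket_add_right (V.mdifferentiableAt q) (W.mdifferentiableAt q)
  lie_self V := by
    ext q
    simp [bracket_apply]
  leibniz_lie U V W := by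
    have : IsManifold (𝓡 2) (minSmoothness ℝ 3) M := isManifold_minSmoothness 3
    have h2 : minSmoothness ℝ 2 ≤ (∞ : ℕ∞ω) := natCast_le_smooth 2
    ext q
    exact VectorField.leibniz_identity_mlieBracket_apply (U.contMDiff.of_le h2 q)
      (V.contMDiff.of_le h2 q) (W.contMDiff.of_le h2 q)

instance : LieAlgebra ℝ (Vec M) where
  lie_smul c V W := by
    ext q
    exact VectorField.mlieBracket_const_smul_right (W.mdifferentiableAt q)

/-- Evaluation of vector fields at the point `q`. -/
def evalAt (q : M) : Vec M →ₗ[ℝ] TangentSpace (𝓡 2) q where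
  toFun V := V q
  map_add' _ _ := rfl
  map_smul' _ _ := rfl

variable (M) in
/-- `M` is orientable: it has an atlas of smooth charts whose transition maps have positive
Jacobian determinant. -/
def IsOrientable : Prop :=
  ∃ A : Set (OpenPartialHomeomorph M Plane), A ⊆ IsManifold.maximalAtlas (𝓡 2) ∞ M ∧
    (∀ q : M, ∃ e ∈ A, q ∈ e.source) ∧
    ∀ e ∈ A, ∀ e' ∈ A, ∀ x ∈ (e.symm.trans e').source,
      0 < (fderiv ℝ (e.symm.trans e') x).det

/-- `N` is an embedded one-dimensional submanifold (without boundary) of `M`: near each of its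
points there is a smooth chart of `M` in which `N` is the line on which the second coordinate
vanishes. -/
def IsEmbeddedCurve (N : Set M) : Prop :=
  ∀ q ∈ N, ∃ e ∈ IsManifold.maximalAtlas (𝓡 2) ∞ M, q ∈ e.source ∧
    ∀ p ∈ e.source, p ∈ N ↔ (e p) 1 = 0

end Surface

section ARS

variable {M : Type*} [TopologicalSpace M] [ChartedSpace Plane M] [IsManifold (𝓡 2) ∞ M]
  {F : Type*} [NormedAddCommGroup F] [NormedSpace ℝ F]
  {E : M → Type*} [TopologicalSpace (TotalSpace F E)]
  [∀ q, TopologicalSpace (E q)] [∀ q, AddCommGroup (E q)] [∀ q, Module ℝ (E q)]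
  [∀ q, IsTopologicalAddGroup (E q)] [∀ q, ContinuousConstSMul ℝ (E q)]
  [FiberBundle F E] [VectorBundle ℝ F E]

/-- The vector field `𝔣 ∘ σ` associated with a section `σ` and a smooth bundle morphism `𝔣`. -/
def pushSection (𝔣 : ∀ q, E q →ₗ[ℝ] TangentSpace (𝓡 2) q)
    (h𝔣 : ContMDiff ((𝓡 2).prod 𝓘(ℝ, F)) ((𝓡 2).prod 𝓘(ℝ, Plane)) ∞
      (fun v : TotalSpace F E =>
        (⟨v.proj, 𝔣 v.proj v.2⟩ : TotalSpace Plane (fun q : M => TangentSpace (𝓡 2) q)))) :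
    ContMDiffSection (𝓡 2) F ∞ E →ₗ[ℝ] Vec M where
  toFun σ := ⟨fun q => 𝔣 q (σ q), h𝔣.comp σ.contMDiff⟩
  map_add' σ τ := by ext q; exact (𝔣 q).map_add _ _
  map_smul' c σ := by ext q; exact (𝔣 q).map_smul c _

end ARS

/-- A two-dimensional almost-Riemannian structure on the surface `M`, with underlying smooth
vector bundle `E` (with typical fiber `F`). -/
structure TwoARS (M : Type*) [TopologicalSpace M] [ChartedSpace Plane M]
    [IsManifold (𝓡 2) ∞ M]
    (F : Type*) [NormedAddCommGroup F] [NormedSpace ℝ F]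
    (E : M → Type*) [TopologicalSpace (TotalSpace F E)]
    [∀ q, TopologicalSpace (E q)] [∀ q, AddCommGroup (E q)] [∀ q, Module ℝ (E q)]
    [∀ q, IsTopologicalAddGroup (E q)] [∀ q, ContinuousConstSMul ℝ (E q)]
    [FiberBundle F E] [VectorBundle ℝ F E] [ContMDiffVectorBundle ∞ F E (𝓡 2)] where
  /-- `E` has rank two. -/
  rank_two : Module.finrank ℝ F = 2
  /-- The Euclidean structure on `E`. -/
  metric : ContMDiffRiemannianMetric (𝓡 2) ∞ F E
  /-- The bundle morphism `𝔣 : E → TM`, linear on fibers. -/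
  morphism : ∀ q, E q →ₗ[ℝ] TangentSpace (𝓡 2) q
  smooth_morphism : ContMDiff ((𝓡 2).prod 𝓘(ℝ, F)) ((𝓡 2).prod 𝓘(ℝ, Plane)) ∞
    (fun v : TotalSpace F E =>
      (⟨v.proj, morphism v.proj v.2⟩ : TotalSpace Plane (fun q : M => TangentSpace (𝓡 2) q)))
  /-- The module `▲ = 𝔣_*(Γ(E))` is bracket generating. -/
  bracket_generating : ∀ q : M,
    (LieSubalgebra.lieSpan ℝ (Vec M)
      (range (pushSection morphism smooth_morphism))).toSubmodule.map (evalAt q) = ⊤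

namespace TwoARS

variable {M : Type*} [TopologicalSpace M] [ChartedSpace Plane M] [IsManifold (𝓡 2) ∞ M]
  {F : Type*} [NormedAddCommGroup F] [NormedSpace ℝ F]
  {E : M → Type*} [TopologicalSpace (TotalSpace F E)]
  [∀ q, TopologicalSpace (E q)] [∀ q, AddCommGroup (E q)] [∀ q, Module ℝ (E q)]
  [∀ q, IsTopologicalAddGroup (E q)] [∀ q, ContinuousConstSMul ℝ (E q)]
  [FiberBundle F E] [VectorBundle ℝ F E] [ContMDiffVectorBundle ∞ F E (𝓡 2)]

/-- `▲ = 𝔣_*(Γ(E))`. -/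
def distribution (S : TwoARS M F E) : Submodule ℝ (Vec M) :=
  LinearMap.range (pushSection S.morphism S.smooth_morphism)

/-- The flag `▲₁ = ▲`, `▲ₖ₊₁ = ▲ₖ + [▲, ▲ₖ]`, where `[▲, ▲ₖ]` is the linear span of the brackets
(and `▲₀ = 0`). -/
def flag (S : TwoARS M F E) : ℕ → Submodule ℝ (Vec M)
  | 0 => ⊥
  | 1 => S.distribution
  | k + 2 => S.flag (k + 1) ⊔
      Submodule.span ℝ {X | ∃ V ∈ S.distribution, ∃ W ∈ S.flag (k + 1), X = ⁅V, W⁆}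

/-- `▲ₖ(q)`: the values at `q` of the elements of `▲ₖ`. -/
def flagAt (S : TwoARS M F E) (k : ℕ) (q : M) : Submodule ℝ (TangentSpace (𝓡 2) q) :=
  (S.flag k).map (evalAt q)

/-- The singular set `𝓩`: the points `q` with `dim ▲(q) < 2`. -/
def singularSet (S : TwoARS M F E) : Set M :=
  {q | Module.finrank ℝ (S.flagAt 1 q) < 2}

/-- Condition (H0). -/
structure H0 (S : TwoARS M F E) : Prop where
  embedded : IsEmbeddedCurve S.singularSet
  isolated : ∀ q, Module.finrank ℝ (S.flagAt 2 q) = 1 →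
    ∀ᶠ p in 𝓝[≠] q, Module.finrank ℝ (S.flagAt 2 p) ≠ 1
  step_three : ∀ q, S.flagAt 3 q = ⊤

/-- Tangency points. -/
def IsTangencyPoint (S : TwoARS M F E) (q : M) : Prop :=
  S.flagAt 1 q = S.flagAt 2 q ∧ Module.finrank ℝ (S.flagAt 2 q) = 1 ∧ S.flagAt 3 q = ⊤

/-- `(X₁, X₂)` is an orthonormal frame of the structure on `U`: `Xᵢ = 𝔣 ∘ σᵢ` on `U` for a smooth
orthonormal frame `(σ₁, σ₂)` of `E` over `U`. -/
def IsOrthonormalFrameOn (S : TwoARS M F E) (U : Set M)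
    (X₁ X₂ : ∀ q : M, TangentSpace (𝓡 2) q) : Prop :=
  ∃ σ₁ σ₂ : ∀ q : M, E q,
    ContMDiffOn (𝓡 2) ((𝓡 2).prod 𝓘(ℝ, F)) ∞ (fun q => (⟨q, σ₁ q⟩ : TotalSpace F E)) U ∧
    ContMDiffOn (𝓡 2) ((𝓡 2).prod 𝓘(ℝ, F)) ∞ (fun q => (⟨q, σ₂ q⟩ : TotalSpace F E)) U ∧
    ∀ q ∈ U,
      S.metric.inner q (σ₁ q) (σ₁ q) = 1 ∧ S.metric.inner q (σ₂ q) (σ₂ q) = 1 ∧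
      S.metric.inner q (σ₁ q) (σ₂ q) = 0 ∧
      X₁ q = S.morphism q (σ₁ q) ∧ X₂ q = S.morphism q (σ₂ q)

end TwoARS

section Coordinates

variable {M : Type*} [TopologicalSpace M] [ChartedSpace Plane M]

/-- The coordinate vector `∂/∂x` at the point `Φ (x, exp (iθ))`, for a parametrization `Φ` by
`ℝ × S¹`: the velocity at `x` of the coordinate line `s ↦ Φ (s, exp (iθ))`. -/
def partialX (Φ : ℝ × Circle → M) (x θ : ℝ) :
    TangentSpace (𝓡 2) (Φ (x, Circle.exp θ)) :=
  mfderiv 𝓘(ℝ, ℝ) (𝓡 2) (fun s : ℝ => Φ (s, Circle.exp θ)) x (1 : ℝ)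

/-- The coordinate vector `∂/∂y` at the point `Φ (x, exp (iθ))`, `y` being the angle on `S¹`:
the velocity at `θ` of the coordinate line `t ↦ Φ (x, exp (it))`. -/
def partialY (Φ : ℝ × Circle → M) (x θ : ℝ) :
    TangentSpace (𝓡 2) (Φ (x, Circle.exp θ)) :=
  mfderiv 𝓘(ℝ, ℝ) (𝓡 2) (fun t : ℝ => Φ (x, Circle.exp t)) θ (1 : ℝ)

end Coordinates

end AlmostRiemannian

end

/-! Near a singular point that is not a tangency point, some orthonormal frame `(Y₁, Y₂)` has `Y₂ =
0` at the point and `[Y₁, Y₂]` transversal to `Y₁` there; otherwise step three would fail or the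
point would be a tangency point (`exists_adapted_frame`). In a chart, the determinant `D` of `(Y₁,
Y₂)` then has a simple zero along the singular curve. From this curve issue the unit-speed normal
geodesics, that is, the solutions of Hamilton's equations with conormal initial covectors. Energy is
conserved, and by the Gauss lemma (`conormal_of_mem`) the covector keeps annihilating `∂/∂y`, where
`x` is the time along the geodesic and `y` its initial point. Hence `∂/∂x` is one field of an
orthonormal frame and the other is `h ∂/∂y`, with `h` vanishing on `x = 0` to first order. Hadamard
division writes `h = x exp φ` (`exists_normalForm_plane`).

The parameter `y` on the singular curve is still free, and it is chosen so that `φ = 0` on the axis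
`x = 0`. With this normalization normal charts are rigid: where two of them meet on the axis, they
differ by `(x, y) ↦ (± x, ± y + c)` (`eq_affine_of_transition`, `rigidity`). The modulus of `x` is
intrinsic, since the first coordinate of one chart is 1-Lipschitz along the `x`-lines of the other,
in both directions; and the normalization fixes the speed in `y`. Normal parametrizations therefore
continue uniquely along the singular set (`eventuallyEq_of_isPreconnected`).

As `W` is compact, normal arcs of a uniform length exist at all its points, so the axis can be
prolonged as far as desired (`exists_extension`), and a pigeonhole argument makes it return to a
point already visited (`exists_axis_eq`). The germs at the two visits are related by one of the four
types of affine map. Reversing `y` is impossible because the reflection would fix a midpoint;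
reversing `x` alone is impossible because `M` is orientable (`eventuallyEq_translate`). What remains
is a translation. The least return time `T` yields a parametrization that is `T`-periodic in `y` and
injective on the axis modulo `T` (`exists_periodic_normal`).

Wrapping `y` around the circle gives a local diffeomorphism near `{0} × S¹`, injective on a thin
tube by compactness (`exists_tube`), whose core is open and closed in the component, hence equal to
`W` (`image_wrap_axis`). The germ of a normal chart determines its frame and its `φ`, so these patch
together over the tube (`exists_tube_frame`); replacing `y` by the angle only subtracts a constant
from `φ`. -/

/-! ### Smoothness of superposition operators on spaces of continuous maps -/

section Nemytskii

universe u

variable {K : Type*} [TopologicalSpace K] [CompactSpace K]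
  {V V' : Type u} [NormedAddCommGroup V] [NormedSpace ℝ V]
  [NormedAddCommGroup V'] [NormedSpace ℝ V']

/-- Pointwise application of a bilinear map to continuous maps. -/
noncomputable def ContinuousMap.bilin {W : Type*} [NormedAddCommGroup W] [NormedSpace ℝ W]
    (B : W →L[ℝ] V →L[ℝ] V') : C(K, W) →L[ℝ] C(K, V) →L[ℝ] C(K, V') :=
  LinearMap.mkContinuous₂
    (LinearMap.mk₂ ℝ (fun (A : C(K, W)) (v : C(K, V)) =>
        (⟨fun k => B (A k) (v k), by fun_prop⟩ : C(K, V')))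
      (fun _ _ _ => by ext; simp) (fun _ _ _ => by ext; simp)
      (fun _ _ _ => by ext; simp) (fun _ _ _ => by ext; simp)) ‖B‖
    (fun A v => by
      rw [ContinuousMap.norm_le _ (by positivity)]
      intro k
      refine (B.le_opNorm₂ _ _).trans ?_
      gcongr
      · exact A.norm_coe_le_norm k
      · exact v.norm_coe_le_norm k)

/-- The superposition operator `u ↦ f ∘ u` on continuous functions. -/
def ContinuousMap.superpose {K V V' : Type*} [TopologicalSpace K]
    [TopologicalSpace V] [TopologicalSpace V'] (f : V → V') (hf : Continuous f) (u : C(K, V)) : C(K, V') :=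
  ⟨fun k => f (u k), hf.comp u.continuous⟩

theorem ContinuousMap.continuous_superpose {K V V' : Type*} [TopologicalSpace K]
    [TopologicalSpace V] [TopologicalSpace V'] (f : V → V') (hf : Continuous f) :
    Continuous (ContinuousMap.superpose (K := K) f hf) :=
  ContinuousMap.continuous_postcomp (⟨f, hf⟩ : C(V, V'))

/-- Postcomposition is continuous for the compact-open topology, which here is that of the sup norm.
This gives the uniformity near the compact image of `u` without a covering argument. -/
theorem ContinuousMap.exists_forall_norm_sub_lt {V W : Type*} [NormedAddCommGroup V]
    [NormedAddCommGroup W] (g : V → W)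
    (hg : Continuous g) (u : C(K, V)) {ε : ℝ} (hε : 0 < ε) :
    ∃ δ > 0, ∀ h : C(K, V), ‖h‖ < δ → ∀ k, ‖g (u k + h k) - g (u k)‖ ≤ ε := by
  have hc := (ContinuousMap.continuous_superpose (K := K) g hg).continuousAt (x := u)
  obtain ⟨δ, hδ, hd⟩ := Metric.continuousAt_iff.1 hc ε hε
  refine ⟨δ, hδ, fun h hh k => ?_⟩
  have := (ContinuousMap.dist_apply_le_dist k).trans
    (hd (x := u + h) (by rwa [dist_eq_norm, add_sub_cancel_left])).le
  rwa [dist_eq_norm] at this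

/-- The mean value inequality on the segment from `u k` to `u k + h k` bounds the remainder by `ε
‖h‖`, uniformly in `k`, because `fderiv ℝ f` varies by at most `ε` near the image of `u`. -/
theorem ContinuousMap.hasFDerivAt_superpose (f : V → V') (hf : ContDiff ℝ 1 f) (u : C(K, V)) :
    HasFDerivAt (ContinuousMap.superpose (K := K) f hf.continuous)
      (ContinuousMap.bilin (ContinuousLinearMap.id ℝ (V →L[ℝ] V'))
        (ContinuousMap.superpose (fderiv ℝ f) (hf.continuous_fderiv one_ne_zero) u)) u := by
  rw [hasFDerivAt_iff_isLittleO_nhds_zero, Asymptotics.isLittleO_iff]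
  intro ε hε
  obtain ⟨δ, hδ, hd⟩ := ContinuousMap.exists_forall_norm_sub_lt (fderiv ℝ f)
    (hf.continuous_fderiv one_ne_zero) u hε
  filter_upwards [Metric.ball_mem_nhds (0 : C(K, V)) hδ] with h hh
  rw [ContinuousMap.norm_le _ (by positivity)]
  intro k
  have key : ∀ x ∈ segment ℝ (u k) (u k + h k),
      ‖fderiv ℝ f x - fderiv ℝ f (u k)‖ ≤ ε := by
    intro x hx
    rw [segment_eq_image'] at hx
    obtain ⟨θ, hθ, rfl⟩ := hx
    have : ‖θ • h‖ < δ := by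
      rw [norm_smul]
      rw [mem_ball_zero_iff] at hh
      refine lt_of_le_of_lt ?_ hh
      rw [Real.norm_of_nonneg hθ.1]
      exact mul_le_of_le_one_left (norm_nonneg _) hθ.2
    simpa using hd _ this k
  have := (convex_segment (𝕜 := ℝ) (u k) (u k + h k)).norm_image_sub_le_of_norm_fderiv_le'
    (𝕜 := ℝ) (fun x _ => (hf.differentiable (by simp)) x) key
    (left_mem_segment ℝ _ _) (right_mem_segment ℝ _ _)
  rw [add_sub_cancel_left] at this
  refine this.trans ?_
  gcongr
  exact h.norm_coe_le_norm k

theorem ContinuousMap.contDiff_bilin_superpose {W : Type*} [NormedAddCommGroup W]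
    [NormedSpace ℝ W] (B : W →L[ℝ] V →L[ℝ] V') {n : ℕ∞ω} (g : V → W) (hg : Continuous g)
    (h : ContDiff ℝ n (ContinuousMap.superpose (K := K) g hg)) :
    ContDiff ℝ n fun u : C(K, V) =>
      ContinuousMap.bilin B (ContinuousMap.superpose g hg u) :=
  (ContinuousMap.bilin (K := K) B).contDiff.comp h

/-- The derivative of superposition by `f` is superposition by `fderiv ℝ f`, followed by a bounded
bilinear map. The induction thus passes from `V'` to `V →L[ℝ] V'`, so the spaces are quantified
inside the statement and live in one universe. -/
theorem ContinuousMap.contDiff_superpose_nat (n : ℕ) :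
    ∀ {V V' : Type u} [NormedAddCommGroup V] [NormedSpace ℝ V]
      [NormedAddCommGroup V'] [NormedSpace ℝ V'] (f : V → V') (hf : ContDiff ℝ n f),
    ContDiff ℝ n (ContinuousMap.superpose (K := K) f hf.continuous) := by
  induction n with
  | zero =>
    intro V V' _ _ _ _ f hf
    exact contDiff_zero.2 (ContinuousMap.continuous_superpose f _)
  | succ n ih =>
    intro V V' _ _ _ _ f hf
    have h1 : ContDiff ℝ 1 f := hf.of_le (by norm_cast; omega)
    have h2 : ContDiff ℝ n (fderiv ℝ f) := hf.fderiv_right (by norm_cast)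
    refine contDiff_succ_iff_hasFDerivAt.2 ⟨fun u =>
      ContinuousMap.bilin (ContinuousLinearMap.id ℝ (V →L[ℝ] V'))
        (ContinuousMap.superpose (fderiv ℝ f) h2.continuous u), ContinuousMap.contDiff_bilin_superpose (ContinuousLinearMap.id ℝ (V →L[ℝ] V')) _ _ (ih _ h2),
      fun u => ContinuousMap.hasFDerivAt_superpose f h1 u⟩

theorem ContinuousMap.contDiff_superpose (f : V → V') (hf : ContDiff ℝ ∞ f) :
    ContDiff ℝ ∞ (ContinuousMap.superpose (K := K) f hf.continuous) :=
  contDiff_infty.2 fun n => ContinuousMap.contDiff_superpose_nat n f (contDiff_infty.1 hf n)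

end Nemytskii

/-! ### Smooth flows from the inverse function theorem applied to the Picard equation -/

section Integral

variable {V : Type*} [NormedAddCommGroup V] [NormedSpace ℝ V]

/-- The integral of a continuous function on the unit interval, up to a variable bound. -/
noncomputable def unitPrimitive : C(unitInterval, V) →L[ℝ] C(unitInterval, V) :=
  LinearMap.mkContinuous
    { toFun := fun g => ⟨fun s => ∫ r in (0 : ℝ)..s, g (projIcc 0 1 zero_le_one r), by
        have : Continuous fun s : ℝ => ∫ r in (0 : ℝ)..s, g (projIcc 0 1 zero_le_one r) :=
          intervalIntegral.continuous_primitive (fun a b =>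
            (g.continuous.comp continuous_projIcc).intervalIntegrable a b) 0
        exact this.comp continuous_subtype_val⟩
      map_add' := fun g h => by
        ext s
        exact intervalIntegral.integral_add
          ((g.continuous.comp continuous_projIcc).intervalIntegrable _ _)
          ((h.continuous.comp continuous_projIcc).intervalIntegrable _ _)
      map_smul' := fun c g => by
        ext s
        exact intervalIntegral.integral_smul c _ } 1
    (fun g => by
      rw [one_mul, ContinuousMap.norm_le _ (norm_nonneg _)]
      intro s
      refine (intervalIntegral.norm_integral_le_of_norm_le_const
        (C := ‖g‖) fun r _ => g.norm_coe_le_norm _).trans ?_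
      rw [sub_zero, abs_of_nonneg s.2.1]
      exact mul_le_of_le_one_right (norm_nonneg _) s.2.2)

theorem unitPrimitive_apply (g : C(unitInterval, V)) (s : unitInterval) :
    unitPrimitive g s = ∫ r in (0 : ℝ)..s, g (projIcc 0 1 zero_le_one r) := rfl

end Integral

section Flow

universe u

/-- Constant maps, as a continuous linear map. -/
noncomputable def unitConst (V : Type*) [NormedAddCommGroup V] [NormedSpace ℝ V] :
    V →L[ℝ] C(unitInterval, V) :=
  LinearMap.mkContinuous
    { toFun := ContinuousMap.const unitInterval
      map_add' := fun _ _ => rfl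
      map_smul' := fun _ _ => rfl } 1
    (fun v => by
      rw [one_mul, ContinuousMap.norm_le _ (norm_nonneg _)]
      exact fun _ => le_rfl)

@[simp]
theorem unitConst_apply {V : Type*} [NormedAddCommGroup V] [NormedSpace ℝ V] (v : V)
    (s : unitInterval) : unitConst V v s = v := rfl

/-- Evaluation at the right endpoint, as a continuous linear map. -/
noncomputable def unitEval (V : Type*) [NormedAddCommGroup V] [NormedSpace ℝ V] :
    C(unitInterval, V) →L[ℝ] V :=
  LinearMap.mkContinuous
    { toFun := fun g => g 1
      map_add' := fun _ _ => rfl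
      map_smul' := fun _ _ => rfl } 1
    (fun g => by
      rw [one_mul]
      exact g.norm_coe_le_norm 1)

variable {V : Type u} [NormedAddCommGroup V] [NormedSpace ℝ V]

/-- The map whose zeros (in the second component) are the rescaled integral curves of `f`. -/
noncomputable def picardMap (f : V → V) (hf : Continuous f)
    (p : (ℝ × V) × C(unitInterval, V)) : (ℝ × V) × C(unitInterval, V) :=
  (p.1, p.2 - unitConst V p.1.2 - p.1.1 • unitPrimitive (ContinuousMap.superpose f hf p.2))

theorem contDiff_picardMap (f : V → V) (hf : ContDiff ℝ ∞ f) :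
    ContDiff ℝ ∞ (picardMap f hf.continuous) := by
  have h := ContinuousMap.contDiff_superpose (K := unitInterval) f hf
  unfold picardMap
  fun_prop

/-- At time `0` the integral term is multiplied by zero, so its derivative in the curve variable
disappears. The derivative is therefore triangular with identity diagonal blocks, hence invertible.
-/
theorem hasFDerivAt_picardMap (f : V → V) (hf : ContDiff ℝ ∞ f) (v : V) :
    HasFDerivAt (picardMap f hf.continuous)
      ((ContinuousLinearEquiv.skewProd (ContinuousLinearEquiv.refl ℝ (ℝ × V))
        (ContinuousLinearEquiv.refl ℝ C(unitInterval, V))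
        (-(unitConst V ∘L ContinuousLinearMap.snd ℝ ℝ V +
          (ContinuousLinearMap.fst ℝ ℝ V).smulRight
            (unitPrimitive (ContinuousMap.superpose f hf.continuous (unitConst V v)))))) :
        ((ℝ × V) × C(unitInterval, V)) →L[ℝ] ((ℝ × V) × C(unitInterval, V)))
      ((0, v), unitConst V v) := by
  have h := ((ContinuousMap.contDiff_superpose (K := unitInterval) f hf).differentiable
    (by simp) (unitConst V v)).hasFDerivAt
  have hs : HasFDerivAt (fun p : (ℝ × V) × C(unitInterval, V) => p.2)
    (ContinuousLinearMap.snd ℝ (ℝ × V) C(unitInterval, V)) ((0, v), unitConst V v) :=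
    hasFDerivAt_snd
  have h1 := unitPrimitive.hasFDerivAt.comp _ (HasFDerivAt.comp ((0, v), unitConst V v) h hs)
  have hf1 : HasFDerivAt (fun p : (ℝ × V) × C(unitInterval, V) => p.1)
    (ContinuousLinearMap.fst ℝ (ℝ × V) C(unitInterval, V)) ((0, v), unitConst V v) :=
    hasFDerivAt_fst
  have h2 := hf1.prodMk ((hs.sub ((unitConst V).hasFDerivAt.comp _ hf1.snd)).sub
    (hf1.fst.smul h1))
  refine h2.congr_fderiv ?_
  ext p <;> simp [sub_eq_add_neg, add_comm]

/-- With time rescaled to the unit interval, the integral curve from `v` up to time `t` solves `u =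
v + t ∫ f(u)`. The smooth local inverse of the Picard map solves this equation with smooth
dependence on `(t, v)`, and the flow is the value of the solution at the endpoint `1`. -/
theorem exists_smooth_flow [CompleteSpace V] (f : V → V) (hf : ContDiff ℝ ∞ f) (v₀ : V) :
    ∃ δ > 0, ∃ Z : ℝ × V → V, ContDiffOn ℝ ∞ Z (Ioo (-δ) δ ×ˢ Metric.ball v₀ δ) ∧
      ∀ t ∈ Ioo (-δ) δ, ∀ v ∈ Metric.ball v₀ δ,
        Z (0, v) = v ∧ HasDerivAt (fun s => Z (s, v)) (f (Z (t, v))) t := by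
  have hG := contDiff_picardMap f hf
  have hG' := hasFDerivAt_picardMap f hf v₀
  set G := picardMap f hf.continuous with hGdef
  set p₀ : (ℝ × V) × C(unitInterval, V) := ((0, v₀), unitConst V v₀) with hp₀
  let Θ := hG.contDiffAt.toOpenPartialHomeomorph G hG' (by simp)
  have hΘ : ∀ p, Θ p = G p := fun p => rfl
  have hp₀s : p₀ ∈ Θ.source := hG.contDiffAt.mem_toOpenPartialHomeomorph_source hG' (by simp)
  -- The local inverse is smooth at a point only if the derivative of `G` is invertible at the
  -- preimage. This is an open condition, and the ball of radius `ρ` is chosen inside it.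
  have hO : IsOpen {p | fderiv ℝ G p ∈ range ((↑) :
      (((ℝ × V) × C(unitInterval, V)) ≃L[ℝ] ((ℝ × V) × C(unitInterval, V))) →
        (((ℝ × V) × C(unitInterval, V)) →L[ℝ] ((ℝ × V) × C(unitInterval, V))))} :=
    ContinuousLinearEquiv.isOpen.preimage (hG.continuous_fderiv (by simp))
  have hmem : Θ.source ∩ {p | fderiv ℝ G p ∈ range ((↑) :
      (((ℝ × V) × C(unitInterval, V)) ≃L[ℝ] ((ℝ × V) × C(unitInterval, V))) →
        (((ℝ × V) × C(unitInterval, V)) →L[ℝ] ((ℝ × V) × C(unitInterval, V))))} ∈ 𝓝 p₀ :=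
    (Θ.open_source.inter hO).mem_nhds ⟨hp₀s, _, hG'.fderiv.symm⟩
  obtain ⟨ρ, hρ, hball⟩ := Metric.mem_nhds_iff.1 hmem
  have hsymm : ∀ᶠ b in 𝓝 (Θ p₀), b ∈ Θ.target ∧ Θ.symm b ∈ Metric.ball p₀ ρ :=
    (Filter.Eventually.and (Θ.open_target.mem_nhds (Θ.map_source hp₀s))
      ((Θ.continuousAt_symm (Θ.map_source hp₀s)).eventually
        (by rw [Θ.left_inv hp₀s]; exact Metric.ball_mem_nhds _ hρ)))
  have hGp₀ : Θ p₀ = ((0, v₀), 0) := by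
    rw [hΘ]; simp [hGdef, picardMap, hp₀]
  rw [hGp₀] at hsymm
  obtain ⟨δ', hδ', hball'⟩ := Metric.eventually_nhds_iff_ball.1 hsymm
  set δ := min δ' ρ with hδdef
  have hδ : 0 < δ := lt_min hδ' hρ
  have hin : ∀ t ∈ Ioo (-δ) δ, ∀ v ∈ Metric.ball v₀ δ,
      (((t, v), 0) : (ℝ × V) × C(unitInterval, V)) ∈ Metric.ball ((0, v₀), 0) δ := by
    intro t ht v hv
    simp only [Metric.mem_ball, Prod.dist_eq, dist_self] at hv ⊢
    refine max_lt (max_lt ?_ hv) hδ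
    rw [Real.dist_eq, sub_zero]
    exact abs_lt.2 ht
  let g : ℝ × V → C(unitInterval, V) := fun a => (Θ.symm (a, 0)).2
  have hfst : ∀ t ∈ Ioo (-δ) δ, ∀ v ∈ Metric.ball v₀ δ,
      Θ.symm ((t, v), 0) = ((t, v), g (t, v)) ∧
      Θ.symm ((t, v), 0) ∈ Metric.ball p₀ ρ ∧
      ∀ s, g (t, v) s = v + t • unitPrimitive
        (ContinuousMap.superpose f hf.continuous (g (t, v))) s := by
    intro t ht v hv
    obtain ⟨h1, h2⟩ := hball' _ (Metric.ball_subset_ball (min_le_left _ _) (hin t ht v hv))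
    have h3 : G (Θ.symm ((t, v), 0)) = ((t, v), 0) := Θ.right_inv h1
    have h4 : (Θ.symm ((t, v), 0)).1 = (t, v) := congrArg Prod.fst h3
    refine ⟨Prod.ext h4 rfl, h2, fun s => ?_⟩
    have h5 := congrArg Prod.snd h3
    simp only [hGdef, picardMap, h4] at h5
    have h6 := DFunLike.congr_fun h5 s
    simp only [ContinuousMap.sub_apply, ContinuousMap.smul_apply, unitConst_apply,
      ContinuousMap.zero_apply] at h6
    rw [sub_sub, sub_eq_zero] at h6
    exact h6
  -- The initial portion of a solution, rescaled, solves the equation for the time `s * t`. It stays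
  -- in the ball where `Θ` is injective, so it is the solution selected there; this identifies the
  -- solution curve with the trajectory `r ↦ Z (r, v)`.
  have hscale : ∀ t ∈ Ioo (-δ) δ, ∀ v ∈ Metric.ball v₀ δ, ∀ s : unitInterval,
      g (t, v) s = g (s * t, v) 1 := by
    intro t ht v hv s
    obtain ⟨h1, h2, h3⟩ := hfst t ht v hv
    let h : C(unitInterval, V) := ⟨fun r => g (t, v) (s * r), by fun_prop⟩
    have hst : (s : ℝ) * t ∈ Ioo (-δ) δ := by
      refine abs_lt.1 ?_
      rw [abs_mul, abs_of_nonneg s.2.1]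
      exact lt_of_le_of_lt (mul_le_of_le_one_left (abs_nonneg _) s.2.2) (abs_lt.2 ht)
    have hh : (((s : ℝ) * t, v), h) ∈ Metric.ball p₀ ρ := by
      rw [h1] at h2
      simp only [Metric.mem_ball, Prod.dist_eq, hp₀, max_lt_iff] at h2 ⊢
      refine ⟨⟨?_, h2.1.2⟩, lt_of_le_of_lt ?_ h2.2⟩
      · rw [Real.dist_eq, sub_zero]
        exact (abs_lt.2 hst).trans_le (min_le_right _ _)
      · rw [ContinuousMap.dist_le dist_nonneg]
        exact fun r => ContinuousMap.dist_apply_le_dist (f := g (t, v)) (g := unitConst V v₀) _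
    have hGh : G (((s : ℝ) * t, v), h) = (((s : ℝ) * t, v), 0) := by
      refine Prod.ext rfl ?_
      ext r
      simp only [hGdef, picardMap, ContinuousMap.sub_apply, ContinuousMap.smul_apply,
        unitConst_apply, ContinuousMap.zero_apply]
      rw [sub_sub, sub_eq_zero]
      change g (t, v) (s * r) = _
      rw [h3, unitPrimitive_apply, unitPrimitive_apply, mul_comm (s : ℝ) t, mul_smul]
      congr 2
      have := intervalIntegral.smul_integral_comp_mul_left (a := 0) (b := (r : ℝ))
        (fun x => ContinuousMap.superpose f hf.continuous (g (t, v))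
          (projIcc 0 1 zero_le_one x)) (s : ℝ)
      rw [mul_zero] at this
      refine this.symm.trans ?_
      congr 1
      refine intervalIntegral.integral_congr fun x hx => ?_
      rw [uIcc_of_le r.2.1] at hx
      have hx1 : x ∈ Icc (0 : ℝ) 1 := ⟨hx.1, hx.2.trans r.2.2⟩
      have : projIcc (0 : ℝ) 1 zero_le_one ((s : ℝ) * x) = s * projIcc 0 1 zero_le_one x := by
        ext
        rw [projIcc_of_mem zero_le_one hx1, projIcc_of_mem zero_le_one
          ⟨mul_nonneg s.2.1 hx1.1, mul_le_one₀ s.2.2 hx1.1 hx1.2⟩]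
        rfl
      simp only [this]
      rfl
    have := Θ.left_inv (hball hh).1
    rw [hΘ, hGh, (hfst _ hst v hv).1] at this
    have h7 : g ((s : ℝ) * t, v) = h := congrArg Prod.snd this
    rw [h7]
    change _ = g (t, v) (s * 1)
    rw [mul_one]
  let Z : ℝ × V → V := fun a => g a 1
  have hZ : ContDiffOn ℝ ∞ Z (Ioo (-δ) δ ×ˢ Metric.ball v₀ δ) := by
    rintro ⟨t, v⟩ ⟨ht, hv⟩
    obtain ⟨h1, h2, h3⟩ := hfst t ht v hv
    obtain ⟨-, e, he⟩ := hball h2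
    have hs : ContDiffAt ℝ ∞ Θ.symm ((t, v), 0) := by
      refine Θ.contDiffAt_symm (f₀' := e)
        (hball' _ (Metric.ball_subset_ball (min_le_left _ _) (hin t ht v hv))).1 ?_
        hG.contDiffAt
      rw [he]
      exact (hG.differentiable (by simp) _).hasFDerivAt
    have : ContDiffAt ℝ ∞ Z (t, v) := by
      refine (unitEval V).contDiff.contDiffAt.comp (t, v) ?_
      have hc : ContDiffAt ℝ ∞ (fun a : ℝ × V => ((a, 0) : (ℝ × V) × C(unitInterval, V))) (t, v) :=
        contDiffAt_id.prodMk contDiffAt_const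
      exact (hs.comp (t, v) hc).snd
    exact this.contDiffWithinAt
  have hcont : ∀ v ∈ Metric.ball v₀ δ, ContinuousOn (fun t => f (Z (t, v))) (Ioo (-δ) δ) := by
    intro v hv
    exact hf.continuous.comp_continuousOn (hZ.continuousOn.comp (by fun_prop)
      (fun t ht => ⟨ht, hv⟩))
  have hint : ∀ t ∈ Ioo (-δ) δ, ∀ v ∈ Metric.ball v₀ δ,
      Z (t, v) = v + ∫ r in (0 : ℝ)..t, f (Z (r, v)) := by
    intro t ht v hv
    change g (t, v) 1 = _
    rw [(hfst t ht v hv).2.2, unitPrimitive_apply]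
    congr 1
    have := intervalIntegral.smul_integral_comp_mul_left (a := 0) (b := 1)
        (fun x => f (Z (x, v))) t
    rw [mul_zero, mul_one] at this
    rw [← this]
    congr 1
    refine intervalIntegral.integral_congr fun x hx => ?_
    change x ∈ uIcc (0 : ℝ) 1 at hx
    rw [uIcc_of_le zero_le_one] at hx
    change f (g (t, v) (projIcc 0 1 zero_le_one x)) = f (Z (t * x, v))
    rw [hscale t ht v hv, projIcc_of_mem zero_le_one hx, mul_comm t x]
  refine ⟨δ, hδ, Z, hZ, fun t ht v hv => ⟨?_, ?_⟩⟩
  · rw [hint 0 ⟨by linarith, hδ⟩ v hv]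
    simp
  · have hnhds : Ioo (-δ) δ ∈ 𝓝 t := Ioo_mem_nhds ht.1 ht.2
    have h1 : HasDerivAt (fun s : ℝ => ∫ r in (0 : ℝ)..s, f (Z (r, v))) (f (Z (t, v))) t := by
      refine intervalIntegral.integral_hasDerivAt_right
        (ContinuousOn.intervalIntegrable ((hcont v hv).mono ?_))
        ((hcont v hv).stronglyMeasurableAtFilter isOpen_Ioo t ht)
        ((hcont v hv).continuousAt hnhds)
      exact OrdConnected.uIcc_subset ordConnected_Ioo (⟨by linarith, hδ⟩ : (0 : ℝ) ∈ Ioo (-δ) δ) ht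
    refine (h1.const_add v).congr_of_eventuallyEq ?_
    filter_upwards [hnhds] with s hs using hint s hs v hv

end Flow

/-! ### Hadamard division and cutoffs -/

section Hadamard

/-- Hadamard's lemma with a parameter. -/
theorem ContDiff.exists_eq_mul_of_eq_zero (h : ℝ × ℝ → ℝ) (hh : ContDiff ℝ ∞ h)
    (h0 : ∀ y, h (0, y) = 0) :
    ∃ k : ℝ × ℝ → ℝ, ContDiff ℝ ∞ k ∧ (∀ z, h z = z.1 * k z) ∧
      ∀ y, k (0, y) = fderiv ℝ h (0, y) (1, 0) := by
  -- The quotient is `∫₀¹ ∂₁h(t x, y) dt`. Viewing `z ↦ (t ↦ (t x, y))` as a linear map into a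
  -- function space turns its smoothness into that of a superposition operator, avoiding
  -- differentiation under the integral.
  let L : ℝ × ℝ →L[ℝ] C(unitInterval, ℝ × ℝ) :=
    LinearMap.mkContinuous
      { toFun := fun z => ⟨fun t => (t * z.1, z.2), by fun_prop⟩
        map_add' := fun z w => by ext t <;> simp [mul_add]
        map_smul' := fun c z => by ext t <;> simp; ring } 1
      (fun z => by
        rw [one_mul, ContinuousMap.norm_le _ (norm_nonneg _)]
        intro t
        refine max_le ?_ (le_max_right _ _)
        refine le_trans ?_ (le_max_left _ _)
        change ‖(t : ℝ) * z.1‖ ≤ _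
        rw [norm_mul, Real.norm_of_nonneg t.2.1]
        exact mul_le_of_le_one_left (norm_nonneg _) t.2.2)
  have hd : ContDiff ℝ ∞ (fun z => fderiv ℝ h z (1, 0)) :=
    (hh.fderiv_right (by simp)).clm_apply contDiff_const
  let k : ℝ × ℝ → ℝ := fun z => unitPrimitive
    (ContinuousMap.superpose (fun z => fderiv ℝ h z (1, 0)) hd.continuous (L z)) 1
  have hk : ∀ z, k z = ∫ t in (0 : ℝ)..1, fderiv ℝ h (t * z.1, z.2) (1, 0) := by
    intro z
    change unitPrimitive _ _ = _
    rw [unitPrimitive_apply]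
    refine intervalIntegral.integral_congr fun x hx => ?_
    change x ∈ uIcc (0 : ℝ) 1 at hx
    rw [uIcc_of_le zero_le_one] at hx
    change fderiv ℝ h ((projIcc (0 : ℝ) 1 zero_le_one x : ℝ) * z.1, z.2) (1, 0) = _
    rw [projIcc_of_mem zero_le_one hx]
  refine ⟨k, ?_, fun z => ?_, fun y => ?_⟩
  · exact (unitEval ℝ).contDiff.comp
      (unitPrimitive.contDiff.comp ((ContinuousMap.contDiff_superpose _ hd).comp L.contDiff))
  · have hcurve : ∀ t : ℝ, HasDerivAt (fun t : ℝ => h (t * z.1, z.2))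
        (z.1 * fderiv ℝ h (t * z.1, z.2) (1, 0)) t := by
      intro t
      have h1 : HasDerivAt (fun t : ℝ => (t * z.1, z.2)) (z.1, 0) t := by
        simpa using ((hasDerivAt_id t).mul_const z.1).prodMk (hasDerivAt_const t z.2)
      have h2 := ((hh.differentiable (by simp)) (t * z.1, z.2)).hasFDerivAt.comp_hasDerivAt t h1
      have h3 : ((z.1, 0) : ℝ × ℝ) = z.1 • (1, 0) := by simp
      rw [h3, map_smul, smul_eq_mul] at h2
      exact h2
    have := intervalIntegral.integral_eq_sub_of_hasDerivAt (fun t _ => hcurve t)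
      (a := 0) (b := 1) (Continuous.intervalIntegrable
        (continuous_const.mul (hd.continuous.comp (by fun_prop))) _ _)
    rw [intervalIntegral.integral_const_mul, ← hk] at this
    simp only [one_mul, zero_mul, h0, sub_zero] at this
    exact this.symm
  · rw [hk]
    simp

end Hadamard

section Cutoff

variable {E F : Type*} [NormedAddCommGroup E] [NormedSpace ℝ E] [FiniteDimensional ℝ E]
  [NormedAddCommGroup F] [NormedSpace ℝ F]

/-- Multiplying by a bump supported inside `U` makes a local function global without changing its
germ at `x₀`, so that results on globally defined fields and functions apply to fields read in a
chart. -/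
theorem ContDiffOn.exists_contDiff_cutoff {f : E → F} {U : Set E} {x₀ : E}
    (hf : ContDiffOn ℝ ∞ f U) (hU : U ∈ 𝓝 x₀) :
    ∃ χ : E → ℝ, (∀ᶠ x in 𝓝 x₀, χ x = 1) ∧ (∀ x ∉ U, χ x = 0) ∧
      ContDiff ℝ ∞ (fun x => χ x • f x) := by
  obtain ⟨ε, hε, hball⟩ := Metric.mem_nhds_iff.1 hU
  let χ : ContDiffBump x₀ := ⟨ε / 4, ε / 2, by positivity, by linarith⟩
  have hsub : tsupport χ ⊆ Metric.ball x₀ ε := by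
    rw [χ.tsupport_eq]
    exact Metric.closedBall_subset_ball (by change ε / 2 < ε; linarith)
  refine ⟨χ, χ.eventuallyEq_one, fun x hx => ?_, ?_⟩
  · by_contra h
    exact hx (hball (hsub (subset_tsupport _ h)))
  · rw [contDiff_iff_contDiffAt]
    intro x
    by_cases hx : x ∈ tsupport χ
    · exact χ.contDiff.contDiffAt.smul (hf.contDiffAt
        (mem_of_superset (Metric.isOpen_ball.mem_nhds (hsub hx)) hball))
    · have : (fun x => χ x • f x) =ᶠ[𝓝 x] fun _ => 0 := by
        filter_upwards [(isClosed_tsupport _).isOpen_compl.mem_nhds hx] with y hy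
        rw [image_eq_zero_of_notMem_tsupport hy, zero_smul]
      exact contDiffAt_const.congr_of_eventuallyEq this

/-- The local form of Hadamard's lemma. -/
theorem ContDiffOn.exists_eventually_eq_mul {h : ℝ × ℝ → ℝ} {U : Set (ℝ × ℝ)}
    (hh : ContDiffOn ℝ ∞ h U) (hU : U ∈ 𝓝 (0, 0)) (h0 : ∀ y, (0, y) ∈ U → h (0, y) = 0) :
    ∃ k : ℝ × ℝ → ℝ, ContDiff ℝ ∞ k ∧ ∀ᶠ z in 𝓝 (0, 0), h z = z.1 * k z ∧
      (z.1 = 0 → k z = fderiv ℝ h z (1, 0)) := by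
  obtain ⟨χ, h1, h2, h3⟩ := hh.exists_contDiff_cutoff hU
  obtain ⟨k, hk, hk1, hk2⟩ := ContDiff.exists_eq_mul_of_eq_zero _ h3 (fun y => by
    by_cases hy : (0, y) ∈ U
    · rw [h0 y hy, smul_zero]
    · rw [h2 _ hy, zero_smul])
  refine ⟨k, hk, ?_⟩
  filter_upwards [h1.eventually_nhds] with z hz
  refine ⟨?_, fun hz0 => ?_⟩
  · rw [← hk1, hz.self_of_nhds, one_smul]
  · obtain ⟨x, y⟩ := z
    obtain rfl : x = 0 := hz0
    rw [hk2]
    have : (fun x => χ x • h x) =ᶠ[𝓝 (0, y)] h := by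
      filter_upwards [hz] with w hw
      rw [hw, one_smul]
    rw [this.fderiv_eq]

end Cutoff

/-! ### Normal geodesics: conservation of energy and the Gauss lemma -/

section Characteristics

universe u

variable {V : Type u} [NormedAddCommGroup V] [NormedSpace ℝ V]

/-- The Hamiltonian vector field of `(⟨ξ, Y₁⟩² + ⟨ξ, Y₂⟩²) / 2` on the phase space. -/
noncomputable def geodesicField (Y₁ Y₂ : V → V) (z : V × (V →L[ℝ] ℝ)) : V × (V →L[ℝ] ℝ) :=
  (z.2 (Y₁ z.1) • Y₁ z.1 + z.2 (Y₂ z.1) • Y₂ z.1,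
    -(z.2 (Y₁ z.1) • (z.2 ∘L fderiv ℝ Y₁ z.1) + z.2 (Y₂ z.1) • (z.2 ∘L fderiv ℝ Y₂ z.1)))

theorem contDiff_geodesicField {Y₁ Y₂ : V → V} (h₁ : ContDiff ℝ ∞ Y₁) (h₂ : ContDiff ℝ ∞ Y₂) :
    ContDiff ℝ ∞ (geodesicField Y₁ Y₂) := by
  have h1' : ContDiff ℝ ∞ (fderiv ℝ Y₁) := h₁.fderiv_right (by simp)
  have h2' : ContDiff ℝ ∞ (fderiv ℝ Y₂) := h₂.fderiv_right (by simp)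
  unfold geodesicField
  fun_prop

/-- A solution of the geodesic equations issued from a curve, on a square of size `η`. -/
structure IsGeodesicSpray (Y₁ Y₂ : V → V) (η : ℝ) (z : ℝ × ℝ → V × (V →L[ℝ] ℝ)) : Prop where
  pos : 0 < η
  contDiffOn : ContDiffOn ℝ ∞ z (Ioo (-η) η ×ˢ Ioo (-η) η)
  hasDerivAt : ∀ x ∈ Ioo (-η) η, ∀ y ∈ Ioo (-η) η,
    HasDerivAt (fun s => z (s, y)) (geodesicField Y₁ Y₂ (z (x, y))) x
  unit : ∀ y ∈ Ioo (-η) η, (z (0, y)).2 (Y₁ (z (0, y)).1) ^ 2 +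
    (z (0, y)).2 (Y₂ (z (0, y)).1) ^ 2 = 1
  conormal : ∀ y ∈ Ioo (-η) η, (z (0, y)).2 (fderiv ℝ (fun w => (z w).1) (0, y) (0, 1)) = 0

theorem eq_of_forall_hasDerivAt_zero {f : ℝ → ℝ} {η : ℝ} (hη : 0 < η)
    (hf : ∀ x ∈ Ioo (-η) η, HasDerivAt f 0 x) {x : ℝ} (hx : x ∈ Ioo (-η) η) : f x = f 0 :=
  isOpen_Ioo.is_const_of_deriv_eq_zero isPreconnected_Ioo
    (fun x hx => (hf x hx).differentiableAt.differentiableWithinAt)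
    (fun x hx => (hf x hx).deriv) hx ⟨by linarith, hη⟩

namespace IsGeodesicSpray

variable {Y₁ Y₂ : V → V} {η : ℝ} {z : ℝ × ℝ → V × (V →L[ℝ] ℝ)}

theorem mem_nhds {w : ℝ × ℝ} (hw : w ∈ Ioo (-η) η ×ˢ Ioo (-η) η) :
    Ioo (-η) η ×ˢ Ioo (-η) η ∈ 𝓝 w :=
  (isOpen_Ioo.prod isOpen_Ioo).mem_nhds hw

theorem differentiableAt (hz : IsGeodesicSpray Y₁ Y₂ η z) {w : ℝ × ℝ}
    (hw : w ∈ Ioo (-η) η ×ˢ Ioo (-η) η) : DifferentiableAt ℝ z w :=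
  (hz.contDiffOn.contDiffAt (mem_nhds hw)).differentiableAt (by simp)

theorem fderiv_apply (hz : IsGeodesicSpray Y₁ Y₂ η z) {w : ℝ × ℝ}
    (hw : w ∈ Ioo (-η) η ×ˢ Ioo (-η) η) :
    fderiv ℝ z w (1, 0) = geodesicField Y₁ Y₂ (z w) := by
  have h1 : HasDerivAt (fun s : ℝ => (s, w.2)) (1, 0) w.1 :=
    (hasDerivAt_id _).prodMk (hasDerivAt_const _ _)
  exact ((hz.differentiableAt hw).hasFDerivAt.comp_hasDerivAt w.1 h1).unique
    (hz.hasDerivAt _ hw.1 _ hw.2)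

/-- Conservation of the Hamiltonian: with `c = ξ(Y₁)`, `s = ξ(Y₂)` and `b = ξ(DY₁ Y₂ - DY₂ Y₁)`, the
equations give `c' = s b` and `s' = -c b`. -/
theorem unit_of_mem (hz : IsGeodesicSpray Y₁ Y₂ η z) (h₁ : ContDiff ℝ ∞ Y₁)
    (h₂ : ContDiff ℝ ∞ Y₂) {w : ℝ × ℝ} (hw : w ∈ Ioo (-η) η ×ˢ Ioo (-η) η) :
    (z w).2 (Y₁ (z w).1) ^ 2 + (z w).2 (Y₂ (z w).1) ^ 2 = 1 := by
  obtain ⟨x, y⟩ := w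
  rw [← hz.unit y hw.2]
  refine eq_of_forall_hasDerivAt_zero
    (f := fun x => (z (x, y)).2 (Y₁ (z (x, y)).1) ^ 2 + (z (x, y)).2 (Y₂ (z (x, y)).1) ^ 2)
    hz.pos (fun x hx => ?_) hw.1
  have hd := hz.hasDerivAt x hx y hw.2
  have hp : HasDerivAt (fun s => (z (s, y)).1) (geodesicField Y₁ Y₂ (z (x, y))).1 x :=
    (ContinuousLinearMap.fst ℝ V (V →L[ℝ] ℝ)).hasFDerivAt.comp_hasDerivAt x hd
  have hξ : HasDerivAt (fun s => (z (s, y)).2) (geodesicField Y₁ Y₂ (z (x, y))).2 x :=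
    (ContinuousLinearMap.snd ℝ V (V →L[ℝ] ℝ)).hasFDerivAt.comp_hasDerivAt x hd
  have hc := hξ.clm_apply (((h₁.differentiable (by simp)) _).hasFDerivAt.comp_hasDerivAt x hp)
  have hs := hξ.clm_apply (((h₂.differentiable (by simp)) _).hasFDerivAt.comp_hasDerivAt x hp)
  refine ((hc.pow 2).add (hs.pow 2)).congr_deriv ?_
  simp only [geodesicField, Function.comp_apply, map_add, map_smul, neg_apply,
    add_apply, smul_apply, ContinuousLinearMap.comp_apply,
    smul_eq_mul]
  ring

-- The Gauss lemma. Differentiate `ξ(∂p/∂y)` in `x`, exchange the two derivatives of `p`, and insert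
-- `∂p/∂x = c Y₁ + s Y₂`. The terms in `DY₁`, `DY₂` cancel against `ξ'`, leaving half the
-- `y`-derivative of `c² + s²`, which is constant.
set_option maxHeartbeats 1000000 in
theorem conormal_of_mem (hz : IsGeodesicSpray Y₁ Y₂ η z) (h₁ : ContDiff ℝ ∞ Y₁)
    (h₂ : ContDiff ℝ ∞ Y₂) {w : ℝ × ℝ} (hw : w ∈ Ioo (-η) η ×ˢ Ioo (-η) η) :
    (z w).2 (fderiv ℝ (fun w => (z w).1) w (0, 1)) = 0 := by
  obtain ⟨x, y⟩ := w
  refine Eq.trans ?_ (hz.conormal y hw.2)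
  refine eq_of_forall_hasDerivAt_zero
    (f := fun x => (z (x, y)).2 (fderiv ℝ (fun w => (z w).1) (x, y) (0, 1)))
    hz.pos (fun x hx => ?_) hw.1
  have hxy : (x, y) ∈ Ioo (-η) η ×ˢ Ioo (-η) η := ⟨hx, hw.2⟩
  have hzd := hz.differentiableAt hxy
  have hpc : ContDiffOn ℝ ∞ (fun w => (z w).1) (Ioo (-η) η ×ˢ Ioo (-η) η) := hz.contDiffOn.fst
  have hpA : ContDiffAt ℝ ∞ (fun w => (z w).1) (x, y) := hpc.contDiffAt (mem_nhds hxy)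
  have hp2 : DifferentiableAt ℝ (fderiv ℝ (fun w => (z w).1)) (x, y) :=
    (hpA.fderiv_right (m := ∞) (by simp)).differentiableAt (by simp)
  have hline : HasDerivAt (fun s : ℝ => (s, y)) (1, 0) x :=
    (hasDerivAt_id _).prodMk (hasDerivAt_const _ _)
  have hξ : HasDerivAt (fun s => (z (s, y)).2) (geodesicField Y₁ Y₂ (z (x, y))).2 x :=
    (ContinuousLinearMap.snd ℝ V (V →L[ℝ] ℝ)).hasFDerivAt.comp_hasDerivAt x (hz.hasDerivAt x hx y hw.2)
  have hD := (hp2.hasFDerivAt.comp_hasDerivAt x hline).clm_apply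
    (hasDerivAt_const x ((0, 1) : ℝ × ℝ))
  refine (hξ.clm_apply hD).congr_deriv ?_
  simp only [map_zero, add_zero, Function.comp_apply]
  rw [(hpA.isSymmSndFDerivAt (AlmostRiemannian.natCast_le_smooth 2)) (1, 0) (0, 1)]
  have hZ : HasFDerivAt z (fderiv ℝ z (x, y)) (x, y) := hzd.hasFDerivAt
  have hP : HasFDerivAt (fun w => (z w).1) (fderiv ℝ (fun w => (z w).1) (x, y)) (x, y) :=
    (hpA.differentiableAt (by simp)).hasFDerivAt
  have hX : HasFDerivAt (fun w => (z w).2) _ (x, y) := hZ.snd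
  have hc := hX.clm_apply (((h₁.differentiable (by simp)) (z (x, y)).1).hasFDerivAt.comp (x, y) hP)
  have hs := hX.clm_apply (((h₂.differentiable (by simp)) (z (x, y)).1).hasFDerivAt.comp (x, y) hP)
  have hY1 := ((h₁.differentiable (by simp)) (z (x, y)).1).hasFDerivAt.comp (x, y) hP
  have hY2 := ((h₂.differentiable (by simp)) (z (x, y)).1).hasFDerivAt.comp (x, y) hP
  have hV := (hc.smul hY1).add (hs.smul hY2)
  have hP1 : HasFDerivAt (fun w => fderiv ℝ (fun w => (z w).1) w (1, 0))
      ((fderiv ℝ (fderiv ℝ (fun w => (z w).1)) (x, y)).flip (1, 0)) (x, y) := by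
    refine (hp2.hasFDerivAt.clm_apply (hasFDerivAt_const _ _)).congr_fderiv ?_
    ext <;> simp
  have heq : (fun w => fderiv ℝ (fun w => (z w).1) w (1, 0)) =ᶠ[𝓝 (x, y)]
      fun w => (z w).2 (Y₁ (z w).1) • Y₁ (z w).1 + (z w).2 (Y₂ (z w).1) • Y₂ (z w).1 := by
    filter_upwards [mem_nhds hxy] with w hw
    have h3 : fderiv ℝ (fun w => (z w).1) w =
        (ContinuousLinearMap.fst ℝ V (V →L[ℝ] ℝ)) ∘L fderiv ℝ z w :=
      (hz.differentiableAt hw).hasFDerivAt.fst.fderiv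
    rw [h3, ContinuousLinearMap.comp_apply, hz.fderiv_apply hw]
    rfl
  have hkey := hP1.unique (hV.congr_of_eventuallyEq heq)
  have hkey' := congrArg (fun L => L (0, 1)) hkey
  have hone : HasFDerivAt (fun w => (z w).2 (Y₁ (z w).1) ^ 2 + (z w).2 (Y₂ (z w).1) ^ 2)
      (0 : ℝ × ℝ →L[ℝ] ℝ) (x, y) := by
    refine (hasFDerivAt_const (1 : ℝ) _).congr_of_eventuallyEq ?_
    filter_upwards [mem_nhds hxy] with w hw using hz.unit_of_mem h₁ h₂ hw
  have hone' := congrArg (fun L => L (0, 1)) (hone.unique ((hc.pow 2).add (hs.pow 2)))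
  simp only [ContinuousLinearMap.flip_apply] at hkey'
  rw [hkey']
  simp only [geodesicField, neg_apply, add_apply,
    smul_apply, ContinuousLinearMap.comp_apply, smul_eq_mul, map_add, map_smul,
    ContinuousLinearMap.smulRight_apply, Function.comp_apply, ContinuousLinearMap.flip_apply,
    zero_apply] at hone' ⊢
  linear_combination (-1 / 2) * hone'

end IsGeodesicSpray

end Characteristics

/-- The method of characteristics: the Hamiltonian flow is composed with the initial data `(γ y, ν
y)`, and `η` keeps both the time and these data in the domain of the flow. -/
theorem exists_isGeodesicSpray {V : Type*} [NormedAddCommGroup V] [NormedSpace ℝ V]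
    [CompleteSpace V] {Y₁ Y₂ : V → V} (h₁ : ContDiff ℝ ∞ Y₁) (h₂ : ContDiff ℝ ∞ Y₂)
    {δ : ℝ} (hδ : 0 < δ) {γ γ' : ℝ → V} {ν : ℝ → V →L[ℝ] ℝ} (hγ : ContDiffOn ℝ ∞ γ (Ioo (-δ) δ))
    (hν : ContDiffOn ℝ ∞ ν (Ioo (-δ) δ)) (hγ' : ∀ y ∈ Ioo (-δ) δ, HasDerivAt γ (γ' y) y)
    (hunit : ∀ y ∈ Ioo (-δ) δ, ν y (Y₁ (γ y)) ^ 2 + ν y (Y₂ (γ y)) ^ 2 = 1)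
    (hconormal : ∀ y ∈ Ioo (-δ) δ, ν y (γ' y) = 0) :
    ∃ η ≤ δ, ∃ z : ℝ × ℝ → V × (V →L[ℝ] ℝ), IsGeodesicSpray Y₁ Y₂ η z ∧
      ∀ y ∈ Ioo (-η) η, z (0, y) = (γ y, ν y) := by
  obtain ⟨δ', hδ', Z, hZ, hZ'⟩ := exists_smooth_flow _ (contDiff_geodesicField h₁ h₂) (γ 0, ν 0)
  have h0 : (0 : ℝ) ∈ Ioo (-δ) δ := ⟨by linarith, hδ⟩
  have hcont : ContinuousAt (fun y => (γ y, ν y)) 0 :=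
    (hγ.prodMk hν).continuousOn.continuousAt (Ioo_mem_nhds h0.1 h0.2)
  obtain ⟨η', hη', hball⟩ := Metric.continuousAt_iff.1 hcont δ' hδ'
  set η := min δ (min δ' η') with hη
  have hη0 : 0 < η := lt_min hδ (lt_min hδ' hη')
  have hηδ : η ≤ δ := min_le_left _ _
  have hηδ' : η ≤ δ' := (min_le_right _ _).trans (min_le_left _ _)
  have hηη' : η ≤ η' := (min_le_right _ _).trans (min_le_right _ _)
  have hsub : Ioo (-η) η ⊆ Ioo (-δ) δ := Ioo_subset_Ioo (by linarith) hηδ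
  have hsub' : Ioo (-η) η ⊆ Ioo (-δ') δ' := Ioo_subset_Ioo (by linarith) hηδ'
  have hmem : ∀ y ∈ Ioo (-η) η, (γ y, ν y) ∈ Metric.ball (γ 0, ν 0) δ' := by
    intro y hy
    refine hball ?_
    rw [Real.dist_eq, sub_zero]
    exact (abs_lt.2 hy).trans_le hηη'
  have hz0 : ∀ y ∈ Ioo (-η) η, Z (0, (γ y, ν y)) = (γ y, ν y) := fun y hy =>
    (hZ' 0 ⟨by linarith, hδ'⟩ _ (hmem y hy)).1
  have hsmooth : ContDiffOn ℝ ∞ (fun w : ℝ × ℝ => Z (w.1, (γ w.2, ν w.2)))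
      (Ioo (-η) η ×ˢ Ioo (-η) η) := by
    refine hZ.comp (contDiffOn_fst.prodMk ((hγ.prodMk hν).comp contDiffOn_snd ?_)) ?_
    · exact fun w hw => hsub hw.2
    · exact fun w hw => ⟨hsub' hw.1, hmem _ hw.2⟩
  refine ⟨η, hηδ, fun w => Z (w.1, (γ w.2, ν w.2)), ⟨hη0, hsmooth, ?_, ?_, ?_⟩, hz0⟩
  · intro x hx y hy
    exact (hZ' x (hsub' hx) _ (hmem y hy)).2
  · intro y hy
    simp only [hz0 y hy]
    exact hunit y (hsub hy)
  · intro y hy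
    have hy0 : ((0 : ℝ), y) ∈ Ioo (-η) η ×ˢ Ioo (-η) η := ⟨⟨by linarith, hη0⟩, hy⟩
    have hd : DifferentiableAt ℝ (fun w : ℝ × ℝ => (Z (w.1, (γ w.2, ν w.2))).1) (0, y) :=
      (hsmooth.fst.contDiffAt ((isOpen_Ioo.prod isOpen_Ioo).mem_nhds hy0)).differentiableAt
        (by simp)
    have hline : HasDerivAt (fun t : ℝ => ((0 : ℝ), t)) (0, 1) y :=
      (hasDerivAt_const _ _).prodMk (hasDerivAt_id _)
    have h1 := hd.hasFDerivAt.comp_hasDerivAt y hline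
    have h2 : HasDerivAt ((fun w : ℝ × ℝ => (Z (w.1, (γ w.2, ν w.2))).1) ∘
        fun t : ℝ => ((0 : ℝ), t)) (γ' y) y := by
      refine (hγ' y (hsub hy)).congr_of_eventuallyEq ?_
      filter_upwards [Ioo_mem_nhds hy.1 hy.2] with t ht
      simp [hz0 t ht]
    rw [h1.unique h2]
    simp only [hz0 y hy]
    exact hconormal y (hsub hy)

/-! ### The local normal form in the plane -/

namespace AlmostRiemannian

/-- The area form of the plane. -/
noncomputable def planeArea : Plane →L[ℝ] Plane →L[ℝ] ℝ :=
  (EuclideanSpace.proj (0 : Fin 2) : Plane →L[ℝ] ℝ).smulRight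
      (EuclideanSpace.proj (1 : Fin 2) : Plane →L[ℝ] ℝ) -
    (EuclideanSpace.proj (1 : Fin 2) : Plane →L[ℝ] ℝ).smulRight
      (EuclideanSpace.proj (0 : Fin 2) : Plane →L[ℝ] ℝ)

theorem planeArea_apply (v w : Plane) : planeArea v w = v 0 * w 1 - v 1 * w 0 := by
  simp [planeArea]

theorem planeArea_self (v : Plane) : planeArea v v = 0 := by
  rw [planeArea_apply]; ring

theorem planeArea_swap (v w : Plane) : planeArea v w = -planeArea w v := by
  simp only [planeArea_apply]; ring

/-- Cramer's rule without division, valid also for dependent `a`, `b`. -/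
theorem planeArea_smul_eq (a b c : Plane) :
    planeArea a b • c = planeArea c b • a + planeArea a c • b := by
  ext i
  fin_cases i <;> simp [planeArea_apply] <;> ring

/-- The vector dual to a covector with respect to the area form. -/
noncomputable def planeDual (ξ : Plane →L[ℝ] ℝ) : Plane :=
  !₂[-ξ (EuclideanSpace.single 1 1), ξ (EuclideanSpace.single 0 1)]

theorem plane_eq (v : Plane) :
    v = v 0 • EuclideanSpace.single 0 1 + v 1 • EuclideanSpace.single 1 1 := by
  ext i
  fin_cases i <;> simp

theorem planeArea_planeDual (ξ : Plane →L[ℝ] ℝ) (v : Plane) :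
    planeArea v (planeDual ξ) = ξ v := by
  conv_rhs => rw [plane_eq v]
  rw [map_add, map_smul, map_smul, planeArea_apply]
  simp [planeDual]

theorem contDiff_planeDual {X : Type*} [NormedAddCommGroup X] [NormedSpace ℝ X]
    {ξ : X → Plane →L[ℝ] ℝ} (hξ : ContDiff ℝ ∞ ξ) : ContDiff ℝ ∞ fun x => planeDual (ξ x) := by
  rw [contDiff_euclidean]
  intro i
  fin_cases i
  · exact (hξ.clm_apply contDiff_const).neg
  · exact hξ.clm_apply contDiff_const

theorem exists_continuousLinearEquiv_eq (L : ℝ × ℝ →L[ℝ] Plane)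
    (h : planeArea (L (1, 0)) (L (0, 1)) ≠ 0) :
    ∃ e : (ℝ × ℝ) ≃L[ℝ] Plane, (e : ℝ × ℝ →L[ℝ] Plane) = L := by
  have hL : ∀ v : ℝ × ℝ, L v = v.1 • L (1, 0) + v.2 • L (0, 1) := by
    intro v
    rw [← map_smul, ← map_smul, ← map_add]
    simp
  have hinj : Function.Injective L.toLinearMap := by
    rw [← LinearMap.ker_eq_bot, LinearMap.ker_eq_bot']
    intro v hv
    change L v = 0 at hv
    rw [hL] at hv
    have h1 := congrArg (fun u => planeArea u (L (0, 1))) hv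
    have h2 := congrArg (fun u => planeArea (L (1, 0)) u) hv
    simp only [map_add, map_smul, add_apply, smul_apply, smul_eq_mul,
      planeArea_self, mul_zero, add_zero, map_zero, zero_apply, zero_add] at h1 h2
    exact Prod.ext ((mul_eq_zero.1 h1).resolve_right h) ((mul_eq_zero.1 h2).resolve_right h)
  refine ⟨(LinearEquiv.ofInjectiveOfFinrankEq L.toLinearMap hinj
    (by simp)).toContinuousLinearEquiv, ?_⟩
  ext <;> rfl

/-- The inverse function theorem at `a` provides the homeomorphism. As the Jacobian vanishes nowhere
on `N`, restricting the source to `N` makes the inverse smooth on the whole target and not just near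
the image of `a`. -/
theorem exists_openPartialHomeomorph_of_planeArea_ne_zero {p : ℝ × ℝ → Plane} {N : Set (ℝ × ℝ)}
    (hN : IsOpen N) {a : ℝ × ℝ} (ha : a ∈ N) (hp : ContDiffOn ℝ ∞ p N)
    (hJ : ∀ w ∈ N, planeArea (fderiv ℝ p w (1, 0)) (fderiv ℝ p w (0, 1)) ≠ 0) :
    ∃ Ψ : OpenPartialHomeomorph (ℝ × ℝ) Plane, a ∈ Ψ.source ∧ Ψ.source ⊆ N ∧
      (∀ w, Ψ w = p w) ∧ ContDiffOn ℝ ∞ Ψ.symm Ψ.target := by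
  have hpA : ∀ w ∈ N, ContDiffAt ℝ ∞ p w := fun w hw => hp.contDiffAt (hN.mem_nhds hw)
  have hder : ∀ w ∈ N, ∃ e : (ℝ × ℝ) ≃L[ℝ] Plane, HasFDerivAt p (e : ℝ × ℝ →L[ℝ] Plane) w := by
    intro w hw
    obtain ⟨e, he⟩ := exists_continuousLinearEquiv_eq _ (hJ w hw)
    exact ⟨e, he ▸ ((hpA w hw).differentiableAt (by simp)).hasFDerivAt⟩
  obtain ⟨e, he⟩ := hder a ha
  let Θ := (hpA a ha).toOpenPartialHomeomorph p he (by simp)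
  refine ⟨Θ.restrOpen N hN, ⟨(hpA a ha).mem_toOpenPartialHomeomorph_source he (by simp), ha⟩,
    fun w hw => hw.2, fun w => rfl, ?_⟩
  intro q hq
  have hq' : (Θ.restrOpen N hN).symm q ∈ N := ((Θ.restrOpen N hN).map_target hq).2
  obtain ⟨e', he'⟩ := hder _ hq'
  exact ((Θ.restrOpen N hN).contDiffAt_symm hq he' (hpA _ hq')).contDiffWithinAt

/-- The local normal form in the plane. -/
theorem exists_normalForm_plane {Y₁ Y₂ : Plane → Plane} (h₁ : ContDiff ℝ ∞ Y₁)
    (h₂ : ContDiff ℝ ∞ Y₂) {p₀ : Plane} (h0 : Y₂ p₀ = 0)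
    (hne : planeArea (Y₁ p₀) (fderiv ℝ Y₂ p₀ (Y₁ p₀)) ≠ 0) {N : Set Plane} (hN : N ∈ 𝓝 p₀) :
    ∃ (Ψ : OpenPartialHomeomorph (ℝ × ℝ) Plane) (c s φ : ℝ × ℝ → ℝ),
      (0, 0) ∈ Ψ.source ∧ Ψ (0, 0) = p₀ ∧ Ψ.target ⊆ N ∧
      ContDiffOn ℝ ∞ Ψ Ψ.source ∧ ContDiffOn ℝ ∞ Ψ.symm Ψ.target ∧
      ContDiffOn ℝ ∞ c Ψ.source ∧ ContDiffOn ℝ ∞ s Ψ.source ∧ ContDiffOn ℝ ∞ φ Ψ.source ∧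
      ∀ w ∈ Ψ.source, c w ^ 2 + s w ^ 2 = 1 ∧
        c w • Y₁ (Ψ w) + s w • Y₂ (Ψ w) = fderiv ℝ Ψ w (1, 0) ∧
        -s w • Y₁ (Ψ w) + c w • Y₂ (Ψ w) = (w.1 * Real.exp (φ w)) • fderiv ℝ Ψ w (0, 1) ∧
        (w.1 = 0 → φ w = 0) := by
  -- `D` vanishes exactly where the two fields are dependent. Since `Y₂ p₀ = 0`, its derivative at
  -- `p₀` along `Y₁` is the area in `hne`, so this zero is simple.
  set D : Plane → ℝ := fun p => planeArea (Y₁ p) (Y₂ p) with hD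
  have hDs : ContDiff ℝ ∞ D := (planeArea.contDiff.comp h₁).clm_apply h₂
  have hD's : ContDiff ℝ ∞ (fderiv ℝ D) := hDs.fderiv_right (by simp)
  have hDd : ∀ p, HasFDerivAt D (fderiv ℝ D p) p := fun p =>
    (hDs.differentiable (by simp) p).hasFDerivAt
  have hD0 : fderiv ℝ D p₀ (Y₁ p₀) ≠ 0 := by
    have h1 := (planeArea.hasFDerivAt.comp p₀ (h₁.differentiable (by simp) p₀).hasFDerivAt).clm_apply
      (h₂.differentiable (by simp) p₀).hasFDerivAt
    rw [(hDd p₀).unique h1]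
    simpa [h0] using hne
  -- The singular curve is traced as an integral curve of the field dual to `dD`, along which `D` is
  -- constant. This particular speed is what makes `φ` vanish on the axis.
  have hKs : ContDiff ℝ ∞ fun p => planeDual (fderiv ℝ D p) := contDiff_planeDual hD's
  obtain ⟨δ₁, hδ₁, Z, hZ, hZ'⟩ := exists_smooth_flow _ hKs p₀
  set γ : ℝ → Plane := fun y => Z (y, p₀) with hγ
  have hγ0 : γ 0 = p₀ := (hZ' 0 ⟨by linarith, hδ₁⟩ p₀ (Metric.mem_ball_self hδ₁)).1
  have hγ' : ∀ y ∈ Ioo (-δ₁) δ₁, HasDerivAt γ (planeDual (fderiv ℝ D (γ y))) y := fun y hy =>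
    (hZ' y hy p₀ (Metric.mem_ball_self hδ₁)).2
  have hγs : ContDiffOn ℝ ∞ γ (Ioo (-δ₁) δ₁) :=
    hZ.comp (contDiffOn_id.prodMk contDiffOn_const) fun y hy => ⟨hy, Metric.mem_ball_self hδ₁⟩
  have hDγ : ∀ y ∈ Ioo (-δ₁) δ₁, D (γ y) = 0 := by
    intro y hy
    rw [eq_of_forall_hasDerivAt_zero (f := fun y => D (γ y)) hδ₁ (fun t ht => ?_) hy, hγ0]
    · simp [hD, h0]
    · refine ((hDd _).comp_hasDerivAt t (hγ' t ht)).congr_deriv ?_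
      rw [← planeArea_planeDual, planeArea_self]
  -- `ρ` is twice the Hamiltonian at the covector `dD`. Dividing `dD`, which annihilates the curve,
  -- by `√ρ` gives the unit conormal `ν`.
  set ρ : Plane → ℝ := fun p => fderiv ℝ D p (Y₁ p) ^ 2 + fderiv ℝ D p (Y₂ p) ^ 2 with hρ
  have hρs : ContDiff ℝ ∞ ρ := by
    have := hD's.clm_apply h₁
    have := hD's.clm_apply h₂
    fun_prop
  have hρ0 : ρ p₀ ≠ 0 := by
    have : 0 < fderiv ℝ D p₀ (Y₁ p₀) ^ 2 := by positivity
    simp only [hρ]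
    positivity
  obtain ⟨δ, hδ, hδδ₁, hργ⟩ : ∃ δ > 0, δ ≤ δ₁ ∧ ∀ y ∈ Ioo (-δ) δ, ρ (γ y) ≠ 0 := by
    have hc : ContinuousAt (fun y => ρ (γ y)) 0 := hρs.continuous.continuousAt.comp
      (hγ' 0 ⟨by linarith, hδ₁⟩).continuousAt
    have := hc.eventually_ne (by rwa [hγ0])
    obtain ⟨δ₂, hδ₂, hb⟩ := Metric.eventually_nhds_iff.1 this
    refine ⟨min δ₁ δ₂, lt_min hδ₁ hδ₂, min_le_left _ _, fun y hy => hb ?_⟩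
    rw [Real.dist_eq, sub_zero]
    exact (abs_lt.2 hy).trans_le (min_le_right _ _)
  have hsub : Ioo (-δ) δ ⊆ Ioo (-δ₁) δ₁ := Ioo_subset_Ioo (by linarith) hδδ₁
  have hρpos : ∀ y ∈ Ioo (-δ) δ, 0 < ρ (γ y) := fun y hy =>
    lt_of_le_of_ne (by simp only [hρ]; positivity) (hργ y hy).symm
  set ν : ℝ → Plane →L[ℝ] ℝ := fun y => (Real.sqrt (ρ (γ y)))⁻¹ • fderiv ℝ D (γ y) with hν
  have hνs : ContDiffOn ℝ ∞ ν (Ioo (-δ) δ) := by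
    refine ContDiffOn.smul (ContDiffOn.inv (ContDiffOn.sqrt
      (hρs.comp_contDiffOn (hγs.mono hsub)) hργ) ?_) (hD's.comp_contDiffOn (hγs.mono hsub))
    exact fun y hy => (Real.sqrt_pos.2 (hρpos y hy)).ne'
  have hνunit : ∀ y ∈ Ioo (-δ) δ, ν y (Y₁ (γ y)) ^ 2 + ν y (Y₂ (γ y)) ^ 2 = 1 := by
    intro y hy
    simp only [hν, smul_apply, smul_eq_mul, mul_pow, inv_pow, Real.sq_sqrt (hρpos y hy).le]
    rw [← mul_add]
    exact inv_mul_cancel₀ (hργ y hy)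
  have hνconormal : ∀ y ∈ Ioo (-δ) δ, ν y (planeDual (fderiv ℝ D (γ y))) = 0 := by
    intro y hy
    simp only [hν, smul_apply]
    rw [← planeArea_planeDual, planeArea_self, smul_zero]
  obtain ⟨η, hηδ, z, hz, hz0⟩ := exists_isGeodesicSpray h₁ h₂ hδ (hγs.mono hsub) hνs
    (fun y hy => hγ' y (hsub hy)) hνunit hνconormal
  set B := Ioo (-η) η ×ˢ Ioo (-η) η with hB
  have hη := hz.pos
  have hBo : IsOpen B := isOpen_Ioo.prod isOpen_Ioo
  have h0B : ((0 : ℝ), (0 : ℝ)) ∈ B := ⟨⟨by linarith, hη⟩, ⟨by linarith, hη⟩⟩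
  set p : ℝ × ℝ → Plane := fun w => (z w).1 with hpdef
  set c : ℝ × ℝ → ℝ := fun w => (z w).2 (Y₁ (p w)) with hc
  set s : ℝ × ℝ → ℝ := fun w => (z w).2 (Y₂ (p w)) with hs
  have hps : ContDiffOn ℝ ∞ p B := hz.contDiffOn.fst
  have hcs : ContDiffOn ℝ ∞ c B := hz.contDiffOn.snd.clm_apply (h₁.comp_contDiffOn hps)
  have hss : ContDiffOn ℝ ∞ s B := hz.contDiffOn.snd.clm_apply (h₂.comp_contDiffOn hps)
  have hp's : ContDiffOn ℝ ∞ (fderiv ℝ p) B := hps.fderiv_of_isOpen hBo (by simp)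
  have hpx : ∀ w ∈ B, fderiv ℝ p w (1, 0) = c w • Y₁ (p w) + s w • Y₂ (p w) := by
    intro w hw
    have h3 : fderiv ℝ p w =
        (ContinuousLinearMap.fst ℝ Plane (Plane →L[ℝ] ℝ)) ∘L fderiv ℝ z w :=
      (hz.differentiableAt hw).hasFDerivAt.fst.fderiv
    rw [h3, ContinuousLinearMap.comp_apply, hz.fderiv_apply hw]
    rfl
  have hunit : ∀ w ∈ B, c w ^ 2 + s w ^ 2 = 1 := fun w hw => hz.unit_of_mem h₁ h₂ hw
  have hcon : ∀ w ∈ B, (z w).2 (fderiv ℝ p w (0, 1)) = 0 := fun w hw => hz.conormal_of_mem h₁ h₂ hw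
  set J : ℝ × ℝ → ℝ := fun w => planeArea (fderiv ℝ p w (1, 0)) (fderiv ℝ p w (0, 1)) with hJ
  have hJs : ContDiffOn ℝ ∞ J B :=
    ((planeArea.contDiff.comp_contDiffOn (hp's.clm_apply contDiffOn_const))).clm_apply
      (hp's.clm_apply contDiffOn_const)
  -- The covector takes the value `1` on `∂p/∂x` and `0` both on `∂p/∂y` and on the rotated second
  -- field. In Cramer's rule the component of that field along `∂p/∂x` thus drops out; the other
  -- coefficient is `D`, since a rotation of the frame preserves the area.
  have hX2 : ∀ w ∈ B, J w • (-s w • Y₁ (p w) + c w • Y₂ (p w)) =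
      D (p w) • fderiv ℝ p w (0, 1) := by
    intro w hw
    set X₂ := -s w • Y₁ (p w) + c w • Y₂ (p w) with hX₂
    have e1 := planeArea_smul_eq (fderiv ℝ p w (1, 0)) (fderiv ℝ p w (0, 1)) X₂
    have e2 := congrArg (z w).2 e1
    simp only [map_add, map_smul, hcon w hw, smul_eq_mul, mul_zero, add_zero] at e2
    have e3 : (z w).2 X₂ = 0 := by
      simp only [hX₂, map_add, map_smul, smul_eq_mul]
      change -s w * c w + c w * s w = 0
      ring
    have e4 : (z w).2 (fderiv ℝ p w (1, 0)) = 1 := by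
      rw [hpx w hw, ← hunit w hw]
      simp only [map_add, map_smul, smul_eq_mul]
      change c w * c w + s w * s w = _
      ring
    rw [e3, e4, mul_zero, mul_one] at e2
    rw [hJ]
    simp only
    rw [e1, ← e2, zero_smul, zero_add]
    congr 1
    rw [hpx w hw, hX₂]
    simp only [map_add, map_smul, add_apply, smul_apply, smul_eq_mul, planeArea_self]
    rw [planeArea_swap (Y₂ (p w))]
    change _ = planeArea (Y₁ (p w)) (Y₂ (p w))
    linear_combination (planeArea (Y₁ (p w)) (Y₂ (p w))) * hunit w hw
  have hp0y : ∀ y ∈ Ioo (-η) η, p (0, y) = γ y := fun y hy => by simp only [hpdef, hz0 y hy]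
  have hsubη : Ioo (-η) η ⊆ Ioo (-δ) δ := Ioo_subset_Ioo (by linarith) hηδ
  have h0η : (0 : ℝ) ∈ Ioo (-η) η := ⟨by linarith, hη⟩
  have hpy0 : ∀ y ∈ Ioo (-η) η, fderiv ℝ p (0, y) (0, 1) = planeDual (fderiv ℝ D (γ y)) := by
    intro y hy
    have hd : DifferentiableAt ℝ p (0, y) :=
      (hps.contDiffAt (hBo.mem_nhds ⟨h0η, hy⟩)).differentiableAt (by simp)
    have hline : HasDerivAt (fun t : ℝ => ((0 : ℝ), t)) (0, 1) y :=
      (hasDerivAt_const _ _).prodMk (hasDerivAt_id _)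
    refine (hd.hasFDerivAt.comp_hasDerivAt y hline).unique ?_
    refine (hγ' y (hsub (hsubη hy))).congr_of_eventuallyEq ?_
    filter_upwards [Ioo_mem_nhds hy.1 hy.2] with t ht using hp0y t ht
  -- On the axis `∂p/∂y` is the dual of `dD`, so the Jacobian is `dD(∂p/∂x)`. It is nonzero because
  -- `ν`, a multiple of `dD`, equals `1` on `∂p/∂x`.
  have hJ0 : ∀ y ∈ Ioo (-η) η, J (0, y) = fderiv ℝ D (γ y) (fderiv ℝ p (0, y) (1, 0)) := by
    intro y hy
    simp only [hJ]
    rw [hpy0 y hy, planeArea_planeDual]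
  have hJ0ne : ∀ y ∈ Ioo (-η) η, J (0, y) ≠ 0 := by
    intro y hy h
    have hw : ((0 : ℝ), y) ∈ B := ⟨h0η, hy⟩
    have e4 : (z (0, y)).2 (fderiv ℝ p (0, y) (1, 0)) = 1 := by
      rw [hpx _ hw, ← hunit _ hw]
      simp only [map_add, map_smul, smul_eq_mul]
      change c (0, y) * c (0, y) + s (0, y) * s (0, y) = _
      ring
    rw [hJ0 y hy] at h
    rw [hz0 y hy] at e4
    simp only [hν, smul_apply, h, smul_zero] at e4
    exact zero_ne_one e4
  set U := B ∩ {w | J w ≠ 0} with hU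
  have hUo : IsOpen U := hJs.continuousOn.isOpen_inter_preimage hBo isOpen_ne
  have h0U : ((0 : ℝ), (0 : ℝ)) ∈ U := ⟨h0B, hJ0ne 0 h0η⟩
  set h : ℝ × ℝ → ℝ := fun w => D (p w) / J w with hh
  have hhs : ContDiffOn ℝ ∞ h U :=
    (hDs.comp_contDiffOn (hps.mono inter_subset_left)).div (hJs.mono inter_subset_left)
      fun w hw => hw.2
  have hh0 : ∀ y, ((0 : ℝ), y) ∈ U → h (0, y) = 0 := by
    intro y hy
    have hy' : y ∈ Ioo (-η) η := hy.1.2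
    simp only [hh, hp0y y hy', hDγ y (hsub (hsubη hy')), zero_div]
  obtain ⟨k, hks, hk⟩ := hhs.exists_eventually_eq_mul (hUo.mem_nhds h0U) hh0
  -- Differentiating `h J = D ∘ p` in `x` on the axis, where `h = 0`, gives `k J = dD(∂p/∂x) = J`.
  -- Hence `k = 1` there, and `φ = log k` vanishes.
  have hk1 : ∀ᶠ w : ℝ × ℝ in 𝓝 (0, 0), w.1 = 0 → k w = 1 := by
    filter_upwards [hk, hUo.mem_nhds h0U] with w hw hwU hw0
    obtain ⟨x, y⟩ := w
    obtain rfl : x = 0 := hw0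
    have hy' : y ∈ Ioo (-η) η := hwU.1.2
    rw [hw.2 rfl]
    have hdh : HasFDerivAt h (fderiv ℝ h (0, y)) (0, y) :=
      ((hhs.contDiffAt (hUo.mem_nhds hwU)).differentiableAt (by simp)).hasFDerivAt
    have hdJ : HasFDerivAt J (fderiv ℝ J (0, y)) (0, y) :=
      ((hJs.contDiffAt (hBo.mem_nhds hwU.1)).differentiableAt (by simp)).hasFDerivAt
    have hdp : HasFDerivAt p (fderiv ℝ p (0, y)) (0, y) :=
      ((hps.contDiffAt (hBo.mem_nhds hwU.1)).differentiableAt (by simp)).hasFDerivAt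
    have e1 := hdh.mul hdJ
    have e2 : HasFDerivAt (h * J) (fderiv ℝ D (p (0, y)) ∘L fderiv ℝ p (0, y)) (0, y) := by
      refine ((hDd _).comp (0, y) hdp).congr_of_eventuallyEq ?_
      filter_upwards [hUo.mem_nhds hwU] with w hw
      exact div_mul_cancel₀ _ hw.2
    have e3 := congrArg (fun L : ℝ × ℝ →L[ℝ] ℝ => L (1, 0)) (e1.unique e2)
    simp only [add_apply, smul_apply, smul_eq_mul, hh0 y hwU, zero_mul, zero_add,
      ContinuousLinearMap.comp_apply, hp0y y hy'] at e3
    rw [← hJ0 y hy'] at e3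
    exact mul_left_cancel₀ hwU.2 (by rw [e3, mul_one])
  have hkpos : ∀ᶠ w : ℝ × ℝ in 𝓝 (0, 0), 0 < k w := by
    refine hks.continuous.continuousAt.eventually_const_lt ?_
    rw [hk1.self_of_nhds rfl]
    exact one_pos
  have hpN : ∀ᶠ w : ℝ × ℝ in 𝓝 (0, 0), p w ∈ N := by
    refine (hps.continuousOn.continuousAt (hBo.mem_nhds h0B)).eventually ?_
    rw [hp0y 0 h0η, hγ0]
    exact hN
  obtain ⟨N', hN', hN'o, h0N'⟩ := mem_nhds_iff.1
    (((hk.and hk1).and (hkpos.and hpN)).and (hUo.mem_nhds h0U))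
  have hN'B : N' ⊆ B := fun w hw => (hN' hw).2.1
  obtain ⟨Ψ, hΨ0, hΨN, hΨp, hΨs⟩ := exists_openPartialHomeomorph_of_planeArea_ne_zero hN'o h0N'
    (hps.mono hN'B) (fun w hw => (hN' hw).2.2)
  have hΨp' : (Ψ : ℝ × ℝ → Plane) = p := funext hΨp
  refine ⟨Ψ, c, s, fun w => Real.log (k w), hΨ0, ?_, ?_, ?_, hΨs, hcs.mono (hΨN.trans hN'B),
    hss.mono (hΨN.trans hN'B), ?_, ?_⟩
  · rw [hΨp, hp0y 0 h0η, hγ0]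
  · intro q hq
    rw [← Ψ.right_inv hq, hΨp]
    exact (hN' (hΨN (Ψ.map_target hq))).1.2.2
  · rw [hΨp']
    exact hps.mono (hΨN.trans hN'B)
  · exact hks.contDiffOn.log fun w hw => (hN' (hΨN hw)).1.2.1.ne'
  · intro w hw
    obtain ⟨⟨⟨hw1, hw2⟩, hw3, hw4⟩, hw5⟩ := hN' (hΨN hw)
    rw [hΨp']
    refine ⟨hunit w hw5.1, (hpx w hw5.1).symm, ?_, fun h0 => by simp only [hw2 h0, Real.log_one]⟩
    rw [Real.exp_log hw3, ← hw1.1]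
    simp only [hh]
    rw [div_eq_inv_mul, mul_smul, ← hX2 w hw5.1, inv_smul_smul₀ hw5.2]

end AlmostRiemannian

/-! ### Orthonormal frames of the bundle and the flag at a point -/

namespace AlmostRiemannian

theorem contMDiffOn_inv_sqrt {M : Type*} [TopologicalSpace M] [ChartedSpace Plane M]
    {f : M → ℝ} {U : Set M}
    (hf : ContMDiffOn (𝓡 2) 𝓘(ℝ, ℝ) ∞ f U) (hpos : ∀ q ∈ U, 0 < f q) :
    ContMDiffOn (𝓡 2) 𝓘(ℝ, ℝ) ∞ (fun q => (Real.sqrt (f q))⁻¹) U := by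
  have h : ContDiffOn ℝ ∞ (fun x : ℝ => (Real.sqrt x)⁻¹) (Ioi 0) :=
    (contDiffOn_id.sqrt fun x hx => (ne_of_gt hx)).inv fun x hx => (Real.sqrt_pos.2 hx).ne'
  exact h.contMDiffOn.comp hf hpos

theorem finrank_tangentSpace {M : Type*} [TopologicalSpace M] [ChartedSpace Plane M] (q : M) :
    Module.finrank ℝ (TangentSpace (𝓡 2) q) = 2 := by
  change Module.finrank ℝ (EuclideanSpace ℝ (Fin 2)) = 2
  simp

variable {M : Type*} [TopologicalSpace M] [ChartedSpace Plane M] [IsManifold (𝓡 2) ∞ M]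
  {F : Type*} [NormedAddCommGroup F] [NormedSpace ℝ F]
  {E : M → Type*} [TopologicalSpace (TotalSpace F E)]
  [∀ q, TopologicalSpace (E q)] [∀ q, AddCommGroup (E q)] [∀ q, Module ℝ (E q)]
  [∀ q, IsTopologicalAddGroup (E q)] [∀ q, ContinuousConstSMul ℝ (E q)]
  [FiberBundle F E] [VectorBundle ℝ F E] [ContMDiffVectorBundle ∞ F E (𝓡 2)]

/-- Smoothness of a section of `E` on a set. -/
abbrev SmoothSectionOn (F : Type*) [NormedAddCommGroup F] [NormedSpace ℝ F]
    {E : M → Type*} [TopologicalSpace (TotalSpace F E)] [∀ q, TopologicalSpace (E q)]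
    [FiberBundle F E] (σ : ∀ q, E q) (U : Set M) : Prop :=
  ContMDiffOn (𝓡 2) ((𝓡 2).prod 𝓘(ℝ, F)) ∞ (fun q => (⟨q, σ q⟩ : TotalSpace F E)) U

namespace TwoARS

theorem contMDiffOn_inner (S : TwoARS M F E) {σ τ : ∀ q, E q} {U : Set M}
    (hσ : SmoothSectionOn F σ U) (hτ : SmoothSectionOn F τ U) :
    ContMDiffOn (𝓡 2) 𝓘(ℝ, ℝ) ∞ (fun q => S.metric.inner q (σ q) (τ q)) U := by
  let : RiemannianBundle E := ⟨S.metric.toRiemannianMetric⟩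
  exact ContMDiffOn.inner_bundle (IB := 𝓡 2) (F := F) (b := id) hσ hτ

theorem eq_zero_of_inner_self (S : TwoARS M F E) {q : M} {v : E q}
    (h : S.metric.inner q v v = 0) : v = 0 := by
  by_contra hv
  exact (S.metric.pos q v hv).ne' h

theorem finrank_fiber (S : TwoARS M F E) (q : M) : Module.finrank ℝ (E q) = 2 := by
  rw [← S.rank_two]
  exact (VectorBundle.continuousLinearEquivAt ℝ F E q).toLinearEquiv.finrank_eq

/-- A pair of orthonormal vectors of a fiber. -/
structure IsOrthonormalPair (S : TwoARS M F E) (q : M) (v w : E q) : Prop where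
  left : S.metric.inner q v v = 1
  right : S.metric.inner q w w = 1
  cross : S.metric.inner q v w = 0

namespace IsOrthonormalPair

variable {S : TwoARS M F E} {q : M} {v w : E q}

theorem cross' (h : S.IsOrthonormalPair q v w) : S.metric.inner q w v = 0 := by
  rw [S.metric.symm, h.cross]

theorem expand (h : S.IsOrthonormalPair q v w) (u : E q) :
    u = S.metric.inner q u v • v + S.metric.inner q u w • w := by
  have hli : LinearIndependent ℝ ![v, w] := by
    rw [LinearIndependent.pair_iff]
    intro a b hab
    have h1 := congrArg (fun x => S.metric.inner q x v) hab
    have h2 := congrArg (fun x => S.metric.inner q x w) hab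
    simp only [map_add, map_smul, add_apply, smul_apply, map_zero, zero_apply, smul_eq_mul,
      h.left, h.right, h.cross, h.cross', mul_one, mul_zero, add_zero, zero_add] at h1 h2
    exact ⟨h1, h2⟩
  have : FiniteDimensional ℝ (E q) :=
    Module.finite_of_finrank_pos (by rw [S.finrank_fiber]; norm_num)
  have hspan := hli.span_eq_top_of_card_eq_finrank' (by simp [S.finrank_fiber])
  have hu : u ∈ Submodule.span ℝ (range ![v, w]) := by rw [hspan]; trivial
  rw [Matrix.range_cons, Matrix.range_cons, Matrix.range_empty, union_empty,
    singleton_union, Submodule.mem_span_pair] at hu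
  obtain ⟨a, b, rfl⟩ := hu
  simp only [map_add, map_smul, add_apply, smul_apply, smul_eq_mul, h.left, h.right, h.cross,
    h.cross', mul_one, mul_zero, add_zero, zero_add]

theorem rotate (h : S.IsOrthonormalPair q v w) {a b : ℝ} (hab : a ^ 2 + b ^ 2 = 1) :
    S.IsOrthonormalPair q (a • v + b • w) (-b • v + a • w) := by
  constructor <;>
  · simp only [map_add, map_smul, add_apply, smul_apply, smul_eq_mul, h.left, h.right, h.cross,
      h.cross']
    linarith

end IsOrthonormalPair

/-- Gram–Schmidt applied to the local frame of a trivialization; linear independence keeps the two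
normalizing factors positive, hence smooth. -/
theorem exists_orthonormal_frame (S : TwoARS M F E) (q : M) :
    ∃ U : Set M, IsOpen U ∧ q ∈ U ∧ ∃ σ₁ σ₂ : ∀ q, E q, SmoothSectionOn F σ₁ U ∧
      SmoothSectionOn F σ₂ U ∧ ∀ p ∈ U, S.IsOrthonormalPair p (σ₁ p) (σ₂ p) := by
  have hfr := S.rank_two
  have : FiniteDimensional ℝ F := Module.finite_of_finrank_pos (by rw [hfr]; norm_num)
  let b : Module.Basis (Fin 2) ℝ F := Module.finBasisOfFinrankEq ℝ F hfr
  let e := trivializationAt F E q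
  have hloc := e.isLocalFrameOn_localFrame_baseSet (𝓡 2) ∞ b
  set s := e.localFrame b with hs
  have hs0 : SmoothSectionOn F (s 0) e.baseSet := hloc.contMDiffOn 0
  have hs1 : SmoothSectionOn F (s 1) e.baseSet := hloc.contMDiffOn 1
  have hli : ∀ p ∈ e.baseSet, ∀ a b : ℝ, a • s 0 p + b • s 1 p = 0 → a = 0 ∧ b = 0 := by
    intro p hp
    have h := hloc.linearIndependent hp
    have h2 : (fun i => s i p) = ![s 0 p, s 1 p] := by
      ext i
      fin_cases i <;> rfl
    rw [h2] at h
    exact LinearIndependent.pair_iff.1 h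
  have hpos0 : ∀ p ∈ e.baseSet, 0 < S.metric.inner p (s 0 p) (s 0 p) := by
    intro p hp
    refine S.metric.pos p _ fun h0 => one_ne_zero (hli p hp 1 0 ?_).1
    simp [h0]
  let σ₁ : ∀ q, E q := (fun p => (Real.sqrt (S.metric.inner p (s 0 p) (s 0 p)))⁻¹) • s 0
  have hσ₁ : SmoothSectionOn F σ₁ e.baseSet :=
    (contMDiffOn_inv_sqrt (S.contMDiffOn_inner hs0 hs0) hpos0).smul_section hs0
  have hunit₁ : ∀ p ∈ e.baseSet, S.metric.inner p (σ₁ p) (σ₁ p) = 1 := by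
    intro p hp
    simp only [σ₁, Pi.smul_apply', map_smul, smul_apply, smul_eq_mul]
    have h1 := Real.sq_sqrt (hpos0 p hp).le
    have h2 := (Real.sqrt_pos.2 (hpos0 p hp)).ne'
    field_simp
    exact h1.symm
  let τ : ∀ q, E q := s 1 - (fun p => S.metric.inner p (s 1 p) (σ₁ p)) • σ₁
  have hτ : SmoothSectionOn F τ e.baseSet :=
    hs1.sub_section ((S.contMDiffOn_inner hs1 hσ₁).smul_section hσ₁)
  have hposτ : ∀ p ∈ e.baseSet, 0 < S.metric.inner p (τ p) (τ p) := by
    intro p hp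
    refine S.metric.pos p _ fun h0 => one_ne_zero (hli p hp
      (-(S.metric.inner p (s 1 p) (σ₁ p) * (Real.sqrt (S.metric.inner p (s 0 p) (s 0 p)))⁻¹))
      1 ?_).2
    rw [← h0]
    simp only [τ, σ₁, Pi.sub_apply, Pi.smul_apply']
    module
  have horth : ∀ p ∈ e.baseSet, S.metric.inner p (σ₁ p) (τ p) = 0 := by
    intro p hp
    simp only [τ, Pi.sub_apply, Pi.smul_apply', map_sub, map_smul, smul_eq_mul, hunit₁ p hp]
    rw [S.metric.symm p (s 1 p)]
    ring
  let σ₂ : ∀ q, E q := (fun p => (Real.sqrt (S.metric.inner p (τ p) (τ p)))⁻¹) • τ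
  refine ⟨e.baseSet, e.open_baseSet, FiberBundle.mem_baseSet_trivializationAt' q, σ₁, σ₂, hσ₁,
    (contMDiffOn_inv_sqrt (S.contMDiffOn_inner hτ hτ) hposτ).smul_section hτ,
    fun p hp => ⟨hunit₁ p hp, ?_, ?_⟩⟩
  · simp only [σ₂, Pi.smul_apply', map_smul, smul_apply, smul_eq_mul]
    have h1 := Real.sq_sqrt (hposτ p hp).le
    have h2 := (Real.sqrt_pos.2 (hposτ p hp)).ne'
    field_simp
    exact h1.symm
  · simp only [σ₂, Pi.smul_apply', map_smul, smul_eq_mul, horth p hp, mul_zero]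

/-- A constant combination of a local orthonormal frame, cut off by a bump function. It allows the
values at `q` of the distribution to be computed from the fiber map alone. -/
theorem exists_section [T2Space M] (S : TwoARS M F E) {q : M} (v : E q) :
    ∃ σ : ContMDiffSection (𝓡 2) F ∞ E, σ q = v := by
  obtain ⟨U, hU, hqU, σ₁, σ₂, hσ₁, hσ₂, horth⟩ := S.exists_orthonormal_frame q
  let τ : ∀ q, E q := (S.metric.inner q v (σ₁ q)) • σ₁ + (S.metric.inner q v (σ₂ q)) • σ₂
  have hτ : SmoothSectionOn F τ U :=
    hσ₁.const_smul_section.add_section hσ₂.const_smul_section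
  have hτq : τ q = v := ((horth q hqU).expand v).symm
  obtain ⟨f, hf⟩ := ((SmoothBumpFunction.nhds_basis_support (I := 𝓡 2)
    (hU.mem_nhds hqU)).ex_mem)
  refine ⟨⟨_, ContMDiffOn.smul_section_of_tsupport f.contMDiff.contMDiffOn hU hf hτ⟩, ?_⟩
  change f q • τ q = v
  rw [hτq, f.eq_one, one_smul]

theorem contMDiffOn_morphism (S : TwoARS M F E) {σ : ∀ q, E q} {U : Set M}
    (hσ : SmoothSectionOn F σ U) :
    SmoothSectionOn Plane (E := fun q : M => TangentSpace (𝓡 2) q)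
      (fun q => S.morphism q (σ q)) U :=
  S.smooth_morphism.comp_contMDiffOn hσ

theorem flagAt_one [T2Space M] (S : TwoARS M F E) (q : M) :
    S.flagAt 1 q = LinearMap.range (S.morphism q) := by
  ext w
  constructor
  · rintro ⟨V, ⟨σ, rfl⟩, rfl⟩
    exact ⟨σ q, rfl⟩
  · rintro ⟨v, rfl⟩
    obtain ⟨σ, rfl⟩ := S.exists_section v
    exact ⟨_, ⟨σ, rfl⟩, rfl⟩

theorem mem_singularSet_iff [T2Space M] (S : TwoARS M F E) (q : M) :
    q ∈ S.singularSet ↔ ∃ v : E q, v ≠ 0 ∧ S.morphism q v = 0 := by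
  have : FiniteDimensional ℝ (E q) :=
    Module.finite_of_finrank_pos (by rw [S.finrank_fiber]; norm_num)
  change Module.finrank ℝ (S.flagAt 1 q) < 2 ↔ _
  rw [S.flagAt_one]
  have h := LinearMap.finrank_range_add_finrank_ker (S.morphism q)
  rw [S.finrank_fiber] at h
  constructor
  · intro h2
    have : 0 < Module.finrank ℝ (LinearMap.ker (S.morphism q)) := by omega
    obtain ⟨⟨v, hv⟩, hne⟩ := Module.finrank_pos_iff_exists_ne_zero.1 this
    exact ⟨v, fun h => hne (Subtype.ext h), hv⟩
  · rintro ⟨v, hv, hv0⟩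
    have : 0 < Module.finrank ℝ (LinearMap.ker (S.morphism q)) :=
      Module.finrank_pos_iff_exists_ne_zero.2 ⟨⟨v, hv0⟩, fun h => hv (congrArg Subtype.val h)⟩
    omega

/-- By the Leibniz rule every term is a multiple of `X₁`, of `X₂`, or of a bracket of these two; at
`q` the terms in `X₂` vanish. -/
theorem _root_.AlmostRiemannian.mlieBracket_frame_mem_span {X₁ X₂ : ∀ q : M, TangentSpace (𝓡 2) q}
    {a₁ a₂ b₁ b₂ : M → ℝ} {q : M}
    (hX₁ : MDifferentiableAt (𝓡 2) ((𝓡 2).prod 𝓘(ℝ, Plane))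
      (fun p => (⟨p, X₁ p⟩ : TotalSpace Plane (fun p : M => TangentSpace (𝓡 2) p))) q)
    (hX₂ : MDifferentiableAt (𝓡 2) ((𝓡 2).prod 𝓘(ℝ, Plane))
      (fun p => (⟨p, X₂ p⟩ : TotalSpace Plane (fun p : M => TangentSpace (𝓡 2) p))) q)
    (ha₁ : MDifferentiableAt (𝓡 2) 𝓘(ℝ, ℝ) a₁ q) (ha₂ : MDifferentiableAt (𝓡 2) 𝓘(ℝ, ℝ) a₂ q)
    (hb₁ : MDifferentiableAt (𝓡 2) 𝓘(ℝ, ℝ) b₁ q) (hb₂ : MDifferentiableAt (𝓡 2) 𝓘(ℝ, ℝ) b₂ q)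
    (h0 : X₂ q = 0) :
    VectorField.mlieBracket (𝓡 2) (a₁ • X₁ + a₂ • X₂) (b₁ • X₁ + b₂ • X₂) q ∈
      Submodule.span ℝ {X₁ q, VectorField.mlieBracket (𝓡 2) X₁ X₂ q} := by
  have : IsManifold (𝓡 2) (minSmoothness ℝ 2) M := isManifold_minSmoothness 2
  have m1 : X₁ q ∈ Submodule.span ℝ {X₁ q, VectorField.mlieBracket (𝓡 2) X₁ X₂ q} :=
    Submodule.subset_span (by simp)
  have m2 : VectorField.mlieBracket (𝓡 2) X₁ X₂ q ∈
      Submodule.span ℝ {X₁ q, VectorField.mlieBracket (𝓡 2) X₁ X₂ q} :=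
    Submodule.subset_span (by simp)
  have m0 : X₂ q ∈ Submodule.span ℝ {X₁ q, VectorField.mlieBracket (𝓡 2) X₁ X₂ q} := by
    rw [h0]; exact Submodule.zero_mem _
  have m2' : VectorField.mlieBracket (𝓡 2) X₂ X₁ q ∈
      Submodule.span ℝ {X₁ q, VectorField.mlieBracket (𝓡 2) X₁ X₂ q} := by
    have := Submodule.neg_mem _ m2
    rwa [← VectorField.mlieBracket_swap_apply] at this
  have m3 : ∀ X : ∀ q : M, TangentSpace (𝓡 2) q, VectorField.mlieBracket (𝓡 2) X X q ∈
      Submodule.span ℝ {X₁ q, VectorField.mlieBracket (𝓡 2) X₁ X₂ q} := by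
    intro X
    rw [VectorField.mlieBracket_self]
    exact Submodule.zero_mem _
  have d1 := ha₁.smul_section hX₁
  have d2 := ha₂.smul_section hX₂
  have e1 := hb₁.smul_section hX₁
  have e2 := hb₂.smul_section hX₂
  rw [VectorField.mlieBracket_add_left d1 d2,
    VectorField.mlieBracket_add_right e1 e2, VectorField.mlieBracket_add_right e1 e2]
  simp only [VectorField.mlieBracket_smul_left ha₁ hX₁, VectorField.mlieBracket_smul_left ha₂ hX₂,
    VectorField.mlieBracket_smul_right hb₁ hX₁, VectorField.mlieBracket_smul_right hb₂ hX₂]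
  refine Submodule.add_mem _ (Submodule.add_mem _ ?_ ?_) (Submodule.add_mem _ ?_ ?_)
  all_goals
    refine Submodule.add_mem _ (Submodule.smul_mem _ _ ?_) (Submodule.smul_mem _ _
      (Submodule.add_mem _ (Submodule.smul_mem _ _ ?_) (Submodule.smul_mem _ _ ?_)))
  all_goals first | exact m1 | exact m0 | exact m2 | exact m2' | exact m3 _

theorem flagAt_succ_le (S : TwoARS M F E) (k : ℕ) (q : M)
    (N : Submodule ℝ (TangentSpace (𝓡 2) q)) (h : S.flagAt (k + 1) q ≤ N)
    (hbr : ∀ V ∈ S.distribution, ∀ W ∈ S.flag (k + 1),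
      VectorField.mlieBracket (𝓡 2) V W q ∈ N) : S.flagAt (k + 2) q ≤ N := by
  rw [flagAt, flag, Submodule.map_sup, sup_le_iff]
  refine ⟨h, ?_⟩
  rw [Submodule.map_span_le]
  rintro _ ⟨V, hV, W, hW, rfl⟩
  exact hbr V hV W hW

/-- At a singular point which is not a tangency point there is an orthonormal frame whose second
field vanishes at the point, and whose bracket is transversal to the first field. -/
theorem exists_adapted_frame [T2Space M] (S : TwoARS M F E) {q : M} (h3 : S.flagAt 3 q = ⊤)
    (hq : q ∈ S.singularSet) (hT : ¬ S.IsTangencyPoint q) :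
    ∃ U : Set M, IsOpen U ∧ q ∈ U ∧ ∃ σ₁ σ₂ : ∀ q, E q, SmoothSectionOn F σ₁ U ∧
      SmoothSectionOn F σ₂ U ∧ (∀ p ∈ U, S.IsOrthonormalPair p (σ₁ p) (σ₂ p)) ∧
      S.morphism q (σ₂ q) = 0 ∧
      VectorField.mlieBracket (𝓡 2) (fun p => S.morphism p (σ₁ p))
        (fun p => S.morphism p (σ₂ p)) q ∉ Submodule.span ℝ {S.morphism q (σ₁ q)} := by
  obtain ⟨U, hU, hqU, τ₁, τ₂, hτ₁, hτ₂, hτ⟩ := S.exists_orthonormal_frame q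
  obtain ⟨v, hv, hv0⟩ := (S.mem_singularSet_iff q).1 hq
  have hτq := hτ q hqU
  have hvpos := S.metric.pos q v hv
  set r := Real.sqrt (S.metric.inner q v v) with hr
  have hrpos : 0 < r := Real.sqrt_pos.2 hvpos
  have hr2 : r ^ 2 = S.metric.inner q v v := Real.sq_sqrt hvpos.le
  -- `(α, β)` are the coordinates of the unit kernel vector `v / r`. The constant rotation of the
  -- frame by `(β, -α)` turns the second section into this vector at `q`.
  set α := S.metric.inner q v (τ₁ q) / r with hα
  set β := S.metric.inner q v (τ₂ q) / r with hβ
  have hexp := hτq.expand v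
  have hnorm : S.metric.inner q v (τ₁ q) ^ 2 + S.metric.inner q v (τ₂ q) ^ 2 =
      S.metric.inner q v v := by
    conv_rhs => rw [hexp]
    simp only [map_add, map_smul, add_apply, smul_apply, smul_eq_mul, hτq.left, hτq.right,
      hτq.cross, hτq.cross']
    ring
  have hαβ : β ^ 2 + (-α) ^ 2 = 1 := by
    rw [hα, hβ, neg_sq, div_pow, div_pow, ← add_div, add_comm, hnorm, ← hr2]
    exact div_self (by positivity)
  let σ₁ : ∀ q, E q := β • τ₁ + (-α) • τ₂
  let σ₂ : ∀ q, E q := -(-α) • τ₁ + β • τ₂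
  have hσ₁ : SmoothSectionOn F σ₁ U := hτ₁.const_smul_section.add_section hτ₂.const_smul_section
  have hσ₂ : SmoothSectionOn F σ₂ U := hτ₁.const_smul_section.add_section hτ₂.const_smul_section
  have hσ : ∀ p ∈ U, S.IsOrthonormalPair p (σ₁ p) (σ₂ p) := fun p hp => (hτ p hp).rotate hαβ
  have hσ0 : S.morphism q (σ₂ q) = 0 := by
    have : r • σ₂ q = v := by
      rw [hexp]
      simp only [σ₂, Pi.add_apply, Pi.smul_apply, smul_add, smul_smul, neg_neg, hα, hβ]
      rw [mul_div_cancel₀ _ hrpos.ne', mul_div_cancel₀ _ hrpos.ne']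
    have h := congrArg (S.morphism q) this
    rw [map_smul, hv0] at h
    exact (smul_eq_zero.1 h).resolve_left hrpos.ne'
  refine ⟨U, hU, hqU, σ₁, σ₂, hσ₁, hσ₂, hσ, hσ0, fun hbr => ?_⟩
  set X₁ : ∀ p : M, TangentSpace (𝓡 2) p := fun p => S.morphism p (σ₁ p) with hX₁
  set X₂ : ∀ p : M, TangentSpace (𝓡 2) p := fun p => S.morphism p (σ₂ p) with hX₂
  have hUq := hU.mem_nhds hqU
  have hd₁ := ((S.contMDiffOn_morphism hσ₁).contMDiffAt hUq).mdifferentiableAt (by simp)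
  have hd₂ := ((S.contMDiffOn_morphism hσ₂).contMDiffAt hUq).mdifferentiableAt (by simp)
  have hspan : Submodule.span ℝ {X₁ q, VectorField.mlieBracket (𝓡 2) X₁ X₂ q} ≤
      Submodule.span ℝ {X₁ q} := by
    rw [Submodule.span_le]
    rintro w (rfl | rfl)
    · exact Submodule.mem_span_singleton_self _
    · exact hbr
  have hlocal : ∀ V ∈ S.distribution, ∃ a₁ a₂ : M → ℝ,
      MDifferentiableAt (𝓡 2) 𝓘(ℝ, ℝ) a₁ q ∧ MDifferentiableAt (𝓡 2) 𝓘(ℝ, ℝ) a₂ q ∧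
      (V : ∀ p : M, TangentSpace (𝓡 2) p) =ᶠ[𝓝 q] a₁ • X₁ + a₂ • X₂ := by
    rintro V ⟨σ, rfl⟩
    refine ⟨fun p => S.metric.inner p (σ p) (σ₁ p), fun p => S.metric.inner p (σ p) (σ₂ p),
      ((S.contMDiffOn_inner σ.contMDiff.contMDiffOn hσ₁).contMDiffAt hUq).mdifferentiableAt
        (by simp),
      ((S.contMDiffOn_inner σ.contMDiff.contMDiffOn hσ₂).contMDiffAt hUq).mdifferentiableAt
        (by simp), ?_⟩
    filter_upwards [hUq] with p hp
    change S.morphism p (σ p) = _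
    conv_lhs => rw [(hσ p hp).expand (σ p), map_add, map_smul, map_smul]
    rfl
  have h1le : S.flagAt 1 q ≤ Submodule.span ℝ {X₁ q} := by
    rintro _ ⟨V, hV, rfl⟩
    obtain ⟨a₁, a₂, -, -, hVe⟩ := hlocal V hV
    change V q ∈ _
    rw [hVe.self_of_nhds]
    change a₁ q • X₁ q + a₂ q • X₂ q ∈ _
    rw [show X₂ q = 0 from hσ0, smul_zero, add_zero]
    exact Submodule.smul_mem _ _ (Submodule.mem_span_singleton_self _)
  have h2le : S.flagAt 2 q ≤ Submodule.span ℝ {X₁ q} := by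
    refine S.flagAt_succ_le 0 q _ h1le fun V hV W hW => ?_
    obtain ⟨a₁, a₂, ha₁, ha₂, hVe⟩ := hlocal V hV
    obtain ⟨b₁, b₂, hb₁, hb₂, hWe⟩ := hlocal W hW
    rw [hVe.mlieBracket_vectorField_eq hWe]
    exact hspan (mlieBracket_frame_mem_span hd₁ hd₂ ha₁ ha₂ hb₁ hb₂ hσ0)
  -- With the bracket in the line of `X₁ q`, the second step of the flag is no larger than that
  -- line. If `X₁ q = 0`, all fields of the first two steps vanish at `q`, hence so do their
  -- brackets, contradicting step three; otherwise `q` is a tangency point.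
  by_cases hX : X₁ q = 0
  · rw [hX, Submodule.span_zero_singleton] at h1le h2le
    have h3le : S.flagAt 3 q ≤ ⊥ := by
      refine S.flagAt_succ_le 1 q _ h2le fun V hV W hW => ?_
      rw [← VectorField.mlieBracketWithin_univ,
        VectorField.mlieBracketWithin_eq_zero_of_eq_zero]
      · exact Submodule.zero_mem _
      · exact (Submodule.mem_bot ℝ).1 (h1le ⟨V, hV, rfl⟩)
      · exact (Submodule.mem_bot ℝ).1 (h2le ⟨W, hW, rfl⟩)
    rw [h3] at h3le
    have := finrank_tangentSpace q
    rw [← finrank_top, le_bot_iff.1 h3le, finrank_bot] at this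
    omega
  · have h1 : S.flagAt 1 q = Submodule.span ℝ {X₁ q} := by
      refine le_antisymm h1le ?_
      rw [Submodule.span_singleton_le_iff_mem, S.flagAt_one]
      exact ⟨_, rfl⟩
    have h12 : S.flagAt 1 q ≤ S.flagAt 2 q := Submodule.map_mono le_sup_left
    have h2 : S.flagAt 2 q = Submodule.span ℝ {X₁ q} := le_antisymm h2le (h1 ▸ h12)
    exact hT ⟨h1.trans h2.symm, by rw [h2]; exact finrank_span_singleton hX, h3⟩

end TwoARS
end AlmostRiemannian

/-! ### Vector fields and brackets read in a chart -/

namespace AlmostRiemannian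

theorem exists_smul_of_planeArea_eq_zero {v w : Plane} (hv : v ≠ 0) (h : planeArea v w = 0) :
    ∃ k : ℝ, w = k • v := by
  have hpos : planeArea v (planeDual (innerSL ℝ v)) ≠ 0 := by
    rw [planeArea_planeDual]
    simpa using hv
  refine ⟨planeArea w (planeDual (innerSL ℝ v)) / planeArea v (planeDual (innerSL ℝ v)), ?_⟩
  have h1 := planeArea_smul_eq v (planeDual (innerSL ℝ v)) w
  rw [h, zero_smul, add_zero] at h1
  rw [div_eq_inv_mul, mul_smul, ← h1, smul_smul, inv_mul_cancel₀ hpos, one_smul]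

section Chart

variable {M : Type*} [TopologicalSpace M] [ChartedSpace Plane M] [IsManifold (𝓡 2) ∞ M]

/-- A vector field read in the preferred chart at `q`. -/
noncomputable def coordField (q : M) (X : ∀ p : M, TangentSpace (𝓡 2) p) (y : Plane) : Plane :=
  VectorField.mpullback 𝓘(ℝ, Plane) (𝓡 2) (extChartAt (𝓡 2) q).symm X y

theorem isInvertible_mfderiv_chart_symm (q : M) {y : Plane}
    (hy : y ∈ (extChartAt (𝓡 2) q).target) :
    (mfderiv 𝓘(ℝ, Plane) (𝓡 2) (extChartAt (𝓡 2) q).symm y).IsInvertible := by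
  have : IsManifold (𝓡 2) 1 M := IsManifold.of_le (n := ∞) (by exact_mod_cast le_top)
  have h := isInvertible_mfderivWithin_extChartAt_symm (I := 𝓡 2) hy
  rwa [ModelWithCorners.range_eq_univ, mfderivWithin_univ] at h

theorem contMDiffAt_chart_symm (q : M) {y : Plane} (hy : y ∈ (extChartAt (𝓡 2) q).target) :
    ContMDiffAt 𝓘(ℝ, Plane) (𝓡 2) ∞ (extChartAt (𝓡 2) q).symm y :=
  (contMDiffOn_extChartAt_symm q).contMDiffAt ((isOpen_extChartAt_target q).mem_nhds hy)

theorem mfderiv_chart_symm_coordField (q : M) (X : ∀ p : M, TangentSpace (𝓡 2) p) {y : Plane}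
    (hy : y ∈ (extChartAt (𝓡 2) q).target) :
    mfderiv 𝓘(ℝ, Plane) (𝓡 2) (extChartAt (𝓡 2) q).symm y (coordField q X y) =
      X ((extChartAt (𝓡 2) q).symm y) := by
  rw [coordField, VectorField.mpullback_apply]
  exact (isInvertible_mfderiv_chart_symm q hy).self_apply_inverse _

theorem contDiffAt_coordField (q : M) {X : ∀ p : M, TangentSpace (𝓡 2) p} {y : Plane}
    (hy : y ∈ (extChartAt (𝓡 2) q).target)
    (hX : ContMDiffAt (𝓡 2) ((𝓡 2).prod 𝓘(ℝ, Plane)) ∞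
      (fun p => (⟨p, X p⟩ : TotalSpace Plane (fun p : M => TangentSpace (𝓡 2) p)))
      ((extChartAt (𝓡 2) q).symm y)) :
    ContDiffAt ℝ ∞ (coordField q X) y := by
  have : IsManifold (𝓡 2) (∞ + 1) M := inferInstanceAs (IsManifold (𝓡 2) ∞ M)
  exact contMDiffAt_vectorSpace_iff_contDiffAt.1
    (ContMDiffAt.mpullback_vectorField_preimage hX (contMDiffAt_chart_symm q hy)
      (isInvertible_mfderiv_chart_symm q hy) le_rfl)

/-- As `X₂` vanishes at `q`, the bracket in coordinates reduces to the derivative of the second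
field along the first. This turns transversality of the bracket into the determinant condition of
the planar normal form. -/
theorem mlieBracket_mem_span_of_planeArea_eq_zero (q : M) {X₁ X₂ : ∀ p : M, TangentSpace (𝓡 2) p}
    (h0 : X₂ q = 0)
    (h : planeArea (coordField q X₁ (extChartAt (𝓡 2) q q))
      (fderiv ℝ (coordField q X₂) (extChartAt (𝓡 2) q q)
        (coordField q X₁ (extChartAt (𝓡 2) q q))) = 0) :
    VectorField.mlieBracket (𝓡 2) X₁ X₂ q ∈ Submodule.span ℝ {X₁ q} := by
  have : IsManifold (𝓡 2) 1 M := IsManifold.of_le (n := ∞) (by exact_mod_cast le_top)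
  set y₀ := extChartAt (𝓡 2) q q with hy₀
  have hy₀t : y₀ ∈ (extChartAt (𝓡 2) q).target := mem_extChartAt_target q
  have hq : (extChartAt (𝓡 2) q).symm y₀ = q := extChartAt_to_inv q
  have hY₂ : coordField q X₂ y₀ = 0 := by
    rw [coordField, VectorField.mpullback_apply, hq, h0, map_zero]
    rfl
  let L : Plane →L[ℝ] TangentSpace (𝓡 2) q :=
    (mfderiv (𝓡 2) 𝓘(ℝ, Plane) (extChartAt (𝓡 2) q) q).inverse
  have hbr : VectorField.mlieBracket (𝓡 2) X₁ X₂ q =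
      L (fderiv ℝ (coordField q X₂) y₀ (coordField q X₁ y₀)) := by
    rw [← VectorField.mlieBracketWithin_univ, VectorField.mlieBracketWithin_apply]
    simp only [ModelWithCorners.range_eq_univ, VectorField.mpullbackWithin_univ, preimage_univ,
      inter_self]
    refine congrArg L ?_
    change VectorField.lieBracketWithin ℝ (coordField q X₁) (coordField q X₂) univ y₀ = _
    rw [VectorField.lieBracketWithin_univ]
    change fderiv ℝ (coordField q X₂) y₀ (coordField q X₁ y₀) -
      fderiv ℝ (coordField q X₁) y₀ (coordField q X₂ y₀) = _
    rw [hY₂, map_zero, sub_zero]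
  have hY₁ : L (coordField q X₁ y₀) = X₁ q := by
    have h1 := mfderiv_chart_symm_coordField q X₁ hy₀t
    have h2 := mfderiv_extChartAt_comp_mfderivWithin_extChartAt_symm (I := 𝓡 2) hy₀t
    rw [ModelWithCorners.range_eq_univ, mfderivWithin_univ, hq] at h2
    have h3 := congrArg (fun L : Plane →L[ℝ] Plane => L (coordField q X₁ y₀)) h2
    change mfderiv (𝓡 2) 𝓘(ℝ, Plane) (extChartAt (𝓡 2) q) q
      (mfderiv 𝓘(ℝ, Plane) (𝓡 2) (extChartAt (𝓡 2) q).symm y₀ (coordField q X₁ y₀)) =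
      coordField q X₁ y₀ at h3
    rw [h1, hq] at h3
    rw [← h3]
    exact (isInvertible_mfderiv_extChartAt (mem_extChartAt_source q)).inverse_apply_self _
  rw [hbr]
  by_cases hz : coordField q X₁ y₀ = 0
  · rw [hz, map_zero, map_zero]
    exact Submodule.zero_mem _
  · obtain ⟨k, hk⟩ := exists_smul_of_planeArea_eq_zero hz h
    rw [hk, map_smul, hY₁]
    exact Submodule.smul_mem _ _ (Submodule.mem_span_singleton_self _)

end Chart

end AlmostRiemannian

/-! ### Closedness of the singular set and existence of normal charts -/

namespace AlmostRiemannian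

variable {M : Type*} [TopologicalSpace M] [ChartedSpace Plane M] [IsManifold (𝓡 2) ∞ M]
  {F : Type*} [NormedAddCommGroup F] [NormedSpace ℝ F]
  {E : M → Type*} [TopologicalSpace (TotalSpace F E)]
  [∀ q, TopologicalSpace (E q)] [∀ q, AddCommGroup (E q)] [∀ q, Module ℝ (E q)]
  [∀ q, IsTopologicalAddGroup (E q)] [∀ q, ContinuousConstSMul ℝ (E q)]
  [FiberBundle F E] [VectorBundle ℝ F E] [ContMDiffVectorBundle ∞ F E (𝓡 2)]

namespace TwoARS

theorem IsOrthonormalPair.left_ne_zero {S : TwoARS M F E} {q : M} {v w : E q}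
    (h : S.IsOrthonormalPair q v w) : v ≠ 0 := by
  rintro rfl
  simpa using h.left

theorem IsOrthonormalPair.sub_smul_ne_zero {S : TwoARS M F E} {q : M} {v w : E q}
    (h : S.IsOrthonormalPair q v w) (k : ℝ) : w - k • v ≠ 0 := by
  intro h0
  have := congrArg (fun u => S.metric.inner q u w) h0
  simp [h.right, h.cross] at this

theorem IsOrthonormalPair.mem_singularSet_iff [T2Space M] {S : TwoARS M F E} {q : M} {v w : E q}
    (h : S.IsOrthonormalPair q v w) {L : Plane →L[ℝ] TangentSpace (𝓡 2) q}
    (hL : Function.Injective L) {a b : Plane} (ha : L a = S.morphism q v)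
    (hb : L b = S.morphism q w) : q ∈ S.singularSet ↔ planeArea a b = 0 := by
  rw [S.mem_singularSet_iff]
  constructor
  · rintro ⟨u, hu, hu0⟩
    rw [h.expand u, map_add, map_smul, map_smul, ← ha, ← hb, ← map_smul, ← map_smul, ← map_add]
      at hu0
    have h0 := hL (hu0.trans (map_zero L).symm)
    have h1 := congrArg (fun x => planeArea x b) h0
    have h2 := congrArg (fun x => planeArea a x) h0
    simp only [map_add, map_smul, add_apply, smul_apply, planeArea_self, add_zero,
      zero_add, map_zero, zero_apply, smul_eq_mul, mul_zero] at h1 h2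
    by_contra hne
    refine hu ?_
    rw [h.expand u, (mul_eq_zero.1 h1).resolve_right hne, (mul_eq_zero.1 h2).resolve_right hne]
    simp
  · intro h0
    by_cases ha0 : a = 0
    · exact ⟨v, h.left_ne_zero, by rw [← ha, ha0, map_zero]⟩
    · obtain ⟨k, hk⟩ := exists_smul_of_planeArea_eq_zero ha0 h0
      exact ⟨w - k • v, h.sub_smul_ne_zero k, by
        rw [map_sub, map_smul, ← ha, ← hb, hk, map_smul, sub_self]⟩

/-- Locally the singular set is the zero set of a continuous function, the determinant of an
orthonormal frame read in a chart. -/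
theorem isClosed_singularSet [T2Space M] (S : TwoARS M F E) : IsClosed S.singularSet := by
  rw [← isOpen_compl_iff, isOpen_iff_mem_nhds]
  intro q hq
  obtain ⟨U, hU, hqU, σ₁, σ₂, hσ₁, hσ₂, hσ⟩ := S.exists_orthonormal_frame q
  set X₁ : ∀ p : M, TangentSpace (𝓡 2) p := fun p => S.morphism p (σ₁ p) with hX₁
  set X₂ : ∀ p : M, TangentSpace (𝓡 2) p := fun p => S.morphism p (σ₂ p) with hX₂
  have key : ∀ p ∈ (extChartAt (𝓡 2) q).source ∩ U, p ∈ S.singularSet ↔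
      planeArea (coordField q X₁ (extChartAt (𝓡 2) q p))
        (coordField q X₂ (extChartAt (𝓡 2) q p)) = 0 := by
    rintro p ⟨hp, hpU⟩
    have hpt := (extChartAt (𝓡 2) q).map_source hp
    have hl := (extChartAt (𝓡 2) q).left_inv hp
    have h1 := mfderiv_chart_symm_coordField q X₁ hpt
    have h2 := mfderiv_chart_symm_coordField q X₂ hpt
    have hinj := (isInvertible_mfderiv_chart_symm q hpt).injective
    -- The codomain of the derivative depends on the base point. Abstracting the derivative first
    -- makes it possible to rewrite that base point to `p`.
    revert h1 h2 hinj
    generalize mfderiv 𝓘(ℝ, Plane) (𝓡 2) (extChartAt (𝓡 2) q).symm (extChartAt (𝓡 2) q p) = L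
    revert L
    rw [hl]
    intro L h1 h2 hinj
    exact (hσ p hpU).mem_singularSet_iff hinj h1 h2
  have hcont : ContinuousAt (fun p => planeArea (coordField q X₁ (extChartAt (𝓡 2) q p))
      (coordField q X₂ (extChartAt (𝓡 2) q p))) q := by
    have hc : ∀ (X : ∀ p : M, TangentSpace (𝓡 2) p),
        SmoothSectionOn Plane (E := fun q : M => TangentSpace (𝓡 2) q) X U →
        ContinuousAt (fun p => coordField q X (extChartAt (𝓡 2) q p)) q := by
      intro X hX
      have h := contDiffAt_coordField q (X := X) (mem_extChartAt_target q) (by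
        rw [extChartAt_to_inv]
        exact hX.contMDiffAt (hU.mem_nhds hqU))
      exact h.continuousAt.comp (continuousAt_extChartAt q)
    exact (planeArea.continuous.continuousAt.comp (hc X₁ (S.contMDiffOn_morphism hσ₁))).clm_apply
      (hc X₂ (S.contMDiffOn_morphism hσ₂))
  filter_upwards [hcont.eventually_ne (mt (key q ⟨mem_extChartAt_source q, hqU⟩).2 hq),
    extChartAt_source_mem_nhds (I := 𝓡 2) q, hU.mem_nhds hqU] with p h1 h2 h3
  exact mt (key p ⟨h2, h3⟩).1 h1

end TwoARS

/-- The derivative of a parametrization `Φ` of a surface. -/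
noncomputable def paramDeriv {M : Type*} [TopologicalSpace M] [ChartedSpace Plane M]
    (Φ : ℝ × ℝ → M) (w : ℝ × ℝ) : ℝ × ℝ →L[ℝ] TangentSpace (𝓡 2) (Φ w) :=
  mfderiv 𝓘(ℝ, ℝ × ℝ) (𝓡 2) Φ w

namespace TwoARS

/-- A chart of `M` in which the structure has the normal form `∂/∂x`, `x exp φ ∂/∂y`, with
`φ = 0` on the singular line `x = 0`. -/
structure IsNormalChart (S : TwoARS M F E)
    (e : PartialDiffeomorph 𝓘(ℝ, ℝ × ℝ) (𝓡 2) (ℝ × ℝ) M ∞) (σ₁ σ₂ : ∀ q, E q)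
    (φ : ℝ × ℝ → ℝ) : Prop where
  smooth_left : SmoothSectionOn F σ₁ e.target
  smooth_right : SmoothSectionOn F σ₂ e.target
  orthonormal : ∀ p ∈ e.target, S.IsOrthonormalPair p (σ₁ p) (σ₂ p)
  contDiffOn : ContDiffOn ℝ ∞ φ e.source
  left_eq : ∀ w ∈ e.source,
    S.morphism (e w) (σ₁ (e w)) = paramDeriv e w (1, 0)
  right_eq : ∀ w ∈ e.source, S.morphism (e w) (σ₂ (e w)) =
    (w.1 * Real.exp (φ w)) • paramDeriv e w (0, 1)
  eq_zero : ∀ w ∈ e.source, w.1 = 0 → φ w = 0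


end TwoARS

section Chart

variable {M : Type*} [TopologicalSpace M] [ChartedSpace Plane M] [IsManifold (𝓡 2) ∞ M]

/-- Parametrization of `M` obtained from a parametrization of the domain of a chart. -/
noncomputable def chartTrans (q : M) (Ψ : OpenPartialHomeomorph (ℝ × ℝ) Plane)
    (hΨ : ContDiffOn ℝ ∞ Ψ Ψ.source) (hΨ' : ContDiffOn ℝ ∞ Ψ.symm Ψ.target)
    (ht : Ψ.target ⊆ (extChartAt (𝓡 2) q).target) :
    PartialDiffeomorph 𝓘(ℝ, ℝ × ℝ) (𝓡 2) (ℝ × ℝ) M ∞ where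
  toFun w := (extChartAt (𝓡 2) q).symm (Ψ w)
  invFun p := Ψ.symm (extChartAt (𝓡 2) q p)
  source := Ψ.source
  target := (extChartAt (𝓡 2) q).source ∩ extChartAt (𝓡 2) q ⁻¹' Ψ.target
  map_source' w hw := by
    have h := Ψ.map_source hw
    refine ⟨(extChartAt (𝓡 2) q).map_target (ht h), ?_⟩
    rwa [mem_preimage, (extChartAt (𝓡 2) q).right_inv (ht h)]
  map_target' p hp := Ψ.map_target hp.2
  left_inv' w hw := by
    rw [(extChartAt (𝓡 2) q).right_inv (ht (Ψ.map_source hw)), Ψ.left_inv hw]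
  right_inv' p hp := by
    rw [Ψ.right_inv hp.2, (extChartAt (𝓡 2) q).left_inv hp.1]
  open_source := Ψ.open_source
  open_target := (continuousOn_extChartAt q).isOpen_inter_preimage
    (isOpen_extChartAt_source q) Ψ.open_target
  contMDiffOn_toFun := (contMDiffOn_extChartAt_symm q).comp hΨ.contMDiffOn
    fun _ hw => ht (Ψ.map_source hw)
  contMDiffOn_invFun := hΨ'.contMDiffOn.comp
    ((contMDiffOn_extChartAt (I := 𝓡 2) (x := q)).mono fun p hp => by
      rw [← extChartAt_source (𝓡 2)]; exact hp.1) fun p hp => hp.2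

theorem mfderiv_chartTrans {q : M} {Ψ : OpenPartialHomeomorph (ℝ × ℝ) Plane}
    (hΨ : ContDiffOn ℝ ∞ Ψ Ψ.source) (hΨ' : ContDiffOn ℝ ∞ Ψ.symm Ψ.target)
    (ht : Ψ.target ⊆ (extChartAt (𝓡 2) q).target) {w : ℝ × ℝ} (hw : w ∈ Ψ.source) (v : ℝ × ℝ) :
    paramDeriv (chartTrans q Ψ hΨ hΨ' ht) w v =
      mfderiv 𝓘(ℝ, Plane) (𝓡 2) (extChartAt (𝓡 2) q).symm (Ψ w) (fderiv ℝ Ψ w v) := by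
  have h1 := (contMDiffAt_chart_symm q (ht (Ψ.map_source hw))).mdifferentiableAt (by simp)
  have h2 := (hΨ.contMDiffOn.contMDiffAt (Ψ.open_source.mem_nhds hw)).mdifferentiableAt
    (show (∞ : ℕ∞ω) ≠ 0 by simp)
  have h3 := mfderiv_comp w h1 h2
  rw [mfderiv_eq_fderiv] at h3
  exact congrArg (fun L : ℝ × ℝ →L[ℝ] Plane => L v) h3

end Chart

namespace TwoARS

/-- The adapted frame is read in a chart, extended by cutoffs, and put into the planar normal form.
The rotation found there is then applied to the sections of `E` themselves. -/
theorem exists_isNormalChart [T2Space M] (S : TwoARS M F E) {q : M} (h3 : S.flagAt 3 q = ⊤)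
    (hq : q ∈ S.singularSet) (hT : ¬ S.IsTangencyPoint q) :
    ∃ e σ₁ σ₂ φ, S.IsNormalChart e σ₁ σ₂ φ ∧ ((0, 0) : ℝ × ℝ) ∈ e.source ∧ e (0, 0) = q := by
  obtain ⟨U, hU, hqU, σ₁, σ₂, hσ₁, hσ₂, hσ, hσ0, hbr⟩ := S.exists_adapted_frame h3 hq hT
  set X₁ : ∀ p : M, TangentSpace (𝓡 2) p := fun p => S.morphism p (σ₁ p) with hX₁
  set X₂ : ∀ p : M, TangentSpace (𝓡 2) p := fun p => S.morphism p (σ₂ p) with hX₂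
  set χ := extChartAt (𝓡 2) q with hχ
  set O := χ.target ∩ χ.symm ⁻¹' U with hO
  have hOo : IsOpen O := (continuousOn_extChartAt_symm q).isOpen_inter_preimage
    (isOpen_extChartAt_target q) hU
  have hq0 : χ q ∈ O := ⟨mem_extChartAt_target q, by
    change χ.symm (χ q) ∈ U
    rwa [extChartAt_to_inv]⟩
  have hsmooth : ∀ (X : ∀ p : M, TangentSpace (𝓡 2) p),
      SmoothSectionOn Plane (E := fun q : M => TangentSpace (𝓡 2) q) X U →
      ContDiffOn ℝ ∞ (coordField q X) O := fun X hX y hy =>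
    (contDiffAt_coordField q hy.1 (hX.contMDiffAt (hU.mem_nhds hy.2))).contDiffWithinAt
  obtain ⟨χ₁, hχ₁, hχ₁0, h₁⟩ := (hsmooth X₁ (S.contMDiffOn_morphism hσ₁)).exists_contDiff_cutoff
      (hOo.mem_nhds hq0)
  obtain ⟨χ₂, hχ₂, hχ₂0, h₂⟩ := (hsmooth X₂ (S.contMDiffOn_morphism hσ₂)).exists_contDiff_cutoff
      (hOo.mem_nhds hq0)
  set Y₁ : Plane → Plane := fun y => χ₁ y • coordField q X₁ y with hY₁
  set Y₂ : Plane → Plane := fun y => χ₂ y • coordField q X₂ y with hY₂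
  have e₁ : Y₁ =ᶠ[𝓝 (χ q)] coordField q X₁ := by
    filter_upwards [hχ₁] with y hy
    simp [hY₁, hy]
  have e₂ : Y₂ =ᶠ[𝓝 (χ q)] coordField q X₂ := by
    filter_upwards [hχ₂] with y hy
    simp [hY₂, hy]
  have h0 : Y₂ (χ q) = 0 := by
    rw [e₂.self_of_nhds, coordField, VectorField.mpullback_apply, extChartAt_to_inv,
      show X₂ q = 0 from hσ0, map_zero]
    rfl
  have hne : planeArea (Y₁ (χ q)) (fderiv ℝ Y₂ (χ q) (Y₁ (χ q))) ≠ 0 := by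
    intro h
    rw [e₁.self_of_nhds, e₂.fderiv_eq] at h
    have h' := mlieBracket_mem_span_of_planeArea_eq_zero q (X₁ := X₁) (X₂ := X₂) hσ0 h
    exact hbr h'
  -- The target is confined to the region where the cutoffs do not alter the fields, so the normal
  -- form concerns the original structure.
  obtain ⟨Ψ, c, s, φ, h0Ψ, hΨ0, hΨN, hΨ, hΨ', hc, hs, hφ, H⟩ := exists_normalForm_plane h₁ h₂ h0 hne
    (inter_mem (inter_mem e₁ e₂) (hOo.mem_nhds hq0))
  have hΨO : ∀ w ∈ Ψ.source, Ψ w ∈ O := fun w hw => (hΨN (Ψ.map_source hw)).2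
  have hΨt : ∀ w ∈ Ψ.source, Ψ w ∈ χ.target := fun w hw => (hΨO w hw).1
  have hΨt' : Ψ.target ⊆ χ.target := fun y hy => (hΨN hy).2.1
  let e := chartTrans q Ψ hΨ hΨ' hΨt'
  have he : ∀ w, e w = χ.symm (Ψ w) := fun w => rfl
  have het : ∀ p ∈ e.target, p ∈ U := by
    intro p hp
    have := (hΨN hp.2).2.2
    change χ.symm (χ p) ∈ U at this
    rwa [χ.left_inv hp.1] at this
  have hesymm : ContMDiffOn (𝓡 2) 𝓘(ℝ, ℝ × ℝ) ∞ e.symm e.target := e.contMDiffOn_invFun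
  have hct : ContMDiffOn (𝓡 2) 𝓘(ℝ, ℝ) ∞ (fun p => c (e.symm p)) e.target :=
    hc.contMDiffOn.comp hesymm fun p hp => e.map_target hp
  have hst : ContMDiffOn (𝓡 2) 𝓘(ℝ, ℝ) ∞ (fun p => s (e.symm p)) e.target :=
    hs.contMDiffOn.comp hesymm fun p hp => e.map_target hp
  have hD : ∀ w ∈ Ψ.source, ∀ v : ℝ × ℝ, paramDeriv e w v =
      mfderiv 𝓘(ℝ, Plane) (𝓡 2) χ.symm (Ψ w) (fderiv ℝ Ψ w v) :=
    fun w hw v => mfderiv_chartTrans hΨ hΨ' hΨt' hw v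
  have hX : ∀ w ∈ Ψ.source, ∃ L : Plane →L[ℝ] TangentSpace (𝓡 2) (e w),
      (∀ v : ℝ × ℝ, paramDeriv e w v = L (fderiv ℝ Ψ w v)) ∧
      L (Y₁ (Ψ w)) = X₁ (e w) ∧ L (Y₂ (Ψ w)) = X₂ (e w) := by
    intro w hw
    have hN := (hΨN (Ψ.map_source hw)).1
    rw [show Y₁ (Ψ w) = _ from hN.1, show Y₂ (Ψ w) = _ from hN.2]
    exact ⟨mfderiv 𝓘(ℝ, Plane) (𝓡 2) χ.symm (Ψ w), hD w hw,
      mfderiv_chart_symm_coordField q X₁ (hΨt w hw),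
      mfderiv_chart_symm_coordField q X₂ (hΨt w hw)⟩
  have hinv : ∀ w ∈ Ψ.source, e.symm (e w) = w := fun w hw => e.left_inv hw
  refine ⟨e, (fun p => c (e.symm p)) • σ₁ + (fun p => s (e.symm p)) • σ₂,
    (-fun p => s (e.symm p)) • σ₁ + (fun p => c (e.symm p)) • σ₂, φ, ⟨?_, ?_, ?_, hφ, ?_, ?_, ?_⟩,
    h0Ψ, ?_⟩
  · exact (hct.smul_section (hσ₁.mono het)).add_section (hst.smul_section (hσ₂.mono het))
  · exact (hst.neg.smul_section (hσ₁.mono het)).add_section (hct.smul_section (hσ₂.mono het))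
  · intro p hp
    exact (hσ p (het p hp)).rotate (H _ (e.map_target hp)).1
  · intro w hw
    obtain ⟨L, hL, hL₁, hL₂⟩ := hX w hw
    rw [hL, ← (H w hw).2.1, map_add, map_smul L (c w), map_smul L (s w), hL₁, hL₂]
    change S.morphism _ (c (e.symm (e w)) • σ₁ (e w) + s (e.symm (e w)) • σ₂ (e w)) = _
    rw [hinv w hw, map_add, map_smul, map_smul]
  · intro w hw
    obtain ⟨L, hL, hL₁, hL₂⟩ := hX w hw
    rw [hL, ← map_smul, ← (H w hw).2.2.1, map_add, map_smul L (-s w), map_smul L (c w), hL₁, hL₂]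
    change S.morphism _ (-s (e.symm (e w)) • σ₁ (e w) + c (e.symm (e w)) • σ₂ (e w)) = _
    rw [hinv w hw, map_add, map_smul, map_smul]
  · exact fun w hw => (H w hw).2.2.2
  · rw [he, hΨ0]
    exact extChartAt_to_inv q

end TwoARS
end AlmostRiemannian

/-! ### Transition maps between normal charts -/

namespace AlmostRiemannian

variable {M : Type*} [TopologicalSpace M] [ChartedSpace Plane M] [IsManifold (𝓡 2) ∞ M]
  {F : Type*} [NormedAddCommGroup F] [NormedSpace ℝ F]
  {E : M → Type*} [TopologicalSpace (TotalSpace F E)]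
  [∀ q, TopologicalSpace (E q)] [∀ q, AddCommGroup (E q)] [∀ q, Module ℝ (E q)]
  [∀ q, IsTopologicalAddGroup (E q)] [∀ q, ContinuousConstSMul ℝ (E q)]
  [FiberBundle F E] [VectorBundle ℝ F E] [ContMDiffVectorBundle ∞ F E (𝓡 2)]

section Transition

variable {M : Type*} [TopologicalSpace M] [ChartedSpace Plane M]

theorem injective_paramDeriv
    (e : PartialDiffeomorph 𝓘(ℝ, ℝ × ℝ) (𝓡 2) (ℝ × ℝ) M ∞) {w : ℝ × ℝ} (hw : w ∈ e.source) :
    Function.Injective (paramDeriv e w) := by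
  have h := PartialDiffeomorph.isLocalDiffeomorphAt _ _ _ e hw
  exact (h.mfderivToContinuousLinearEquiv (by simp)).injective

theorem contDiffOn_transition (e₁ e₂ : PartialDiffeomorph 𝓘(ℝ, ℝ × ℝ) (𝓡 2) (ℝ × ℝ) M ∞) :
    ContDiffOn ℝ ∞ (fun w => e₂.symm (e₁ w)) (e₁.source ∩ e₁ ⁻¹' e₂.target) :=
  contMDiffOn_iff_contDiffOn.1 (e₁.trans e₂.symm).contMDiffOn_toFun

theorem isOpen_transition_source
    (e₁ e₂ : PartialDiffeomorph 𝓘(ℝ, ℝ × ℝ) (𝓡 2) (ℝ × ℝ) M ∞) :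
    IsOpen (e₁.source ∩ e₁ ⁻¹' e₂.target) := (e₁.trans e₂.symm).open_source

theorem paramDeriv_transition (e₁ e₂ : PartialDiffeomorph 𝓘(ℝ, ℝ × ℝ) (𝓡 2) (ℝ × ℝ) M ∞)
    {w : ℝ × ℝ} (hw : w ∈ e₁.source ∩ e₁ ⁻¹' e₂.target) (v : ℝ × ℝ) :
    (paramDeriv e₁ w v : Plane) =
      paramDeriv e₂ (e₂.symm (e₁ w))
        (fderiv ℝ (fun w => e₂.symm (e₁ w)) w v) := by
  have hO := (isOpen_transition_source e₁ e₂).mem_nhds hw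
  have h1 := e₂.mdifferentiableAt (by simp) (e₂.map_target hw.2)
  have h2 := ((contDiffOn_transition e₁ e₂).contDiffAt hO).differentiableAt
    (show (∞ : ℕ∞ω) ≠ 0 by simp)
  have h3 := mfderiv_comp w h1 h2.mdifferentiableAt
  have h4 : (e₂ ∘ fun w => e₂.symm (e₁ w)) =ᶠ[𝓝 w] e₁ := by
    filter_upwards [hO] with u hu
    exact e₂.right_inv hu.2
  rw [mfderiv_eq_fderiv, h4.mfderiv_eq] at h3
  exact congrArg (fun L : ℝ × ℝ →L[ℝ] Plane => L v) h3

end Transition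

namespace TwoARS.IsNormalChart

variable {S : TwoARS M F E} {e e' : PartialDiffeomorph 𝓘(ℝ, ℝ × ℝ) (𝓡 2) (ℝ × ℝ) M ∞}
  {σ₁ σ₂ σ₁' σ₂' : ∀ q, E q} {φ φ' : ℝ × ℝ → ℝ}

theorem morphism_apply (h : S.IsNormalChart e σ₁ σ₂ φ) {w : ℝ × ℝ} (hw : w ∈ e.source)
    (a b : ℝ) : S.morphism (e w) (a • σ₁ (e w) + b • σ₂ (e w)) =
      paramDeriv e w (a, b * (w.1 * Real.exp (φ w))) := by
  rw [map_add, map_smul, map_smul, h.left_eq w hw, h.right_eq w hw, smul_smul, ← map_smul,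
    ← map_smul, ← map_add]
  congr 1
  ext <;> simp

theorem mem_singularSet_iff [T2Space M] (h : S.IsNormalChart e σ₁ σ₂ φ) {w : ℝ × ℝ}
    (hw : w ∈ e.source) : e w ∈ S.singularSet ↔ w.1 = 0 := by
  rw [S.mem_singularSet_iff]
  have ho := h.orthonormal _ (e.map_source hw)
  constructor
  · rintro ⟨u, hu, hu0⟩
    rw [ho.expand u, h.morphism_apply hw] at hu0
    have h0 := injective_paramDeriv e hw (hu0.trans (map_zero _).symm)
    have h1 := congrArg Prod.fst h0
    have h2 := congrArg Prod.snd h0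
    simp only [Prod.fst_zero, Prod.snd_zero] at h1 h2
    by_contra hne
    refine hu ?_
    rw [ho.expand u, h1, (mul_eq_zero.1 h2).resolve_right
      (mul_ne_zero hne (Real.exp_pos _).ne')]
    simp
  · intro h0
    refine ⟨σ₂ (e w), ?_, by rw [h.right_eq w hw, h0, zero_mul, zero_smul]⟩
    intro hz
    have := ho.right
    rw [hz] at this
    simp at this

/-- `A, B, C, D` are the entries of the orthogonal matrix relating the two frames of the fiber; its
rows and first column have norm one. Applying the bundle morphism and cancelling the injective
derivative of `e'` leaves identities in `ℝ × ℝ`. -/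
theorem transition (h : S.IsNormalChart e σ₁ σ₂ φ) (h' : S.IsNormalChart e' σ₁' σ₂' φ')
    {w : ℝ × ℝ} (hw : w ∈ e.source ∩ e ⁻¹' e'.target) :
    ∃ A B C D : ℝ, A ^ 2 + B ^ 2 = 1 ∧ A ^ 2 + C ^ 2 = 1 ∧ C ^ 2 + D ^ 2 = 1 ∧
      fderiv ℝ (fun w => e'.symm (e w)) w (1, 0) =
        (A, B * ((e'.symm (e w)).1 * Real.exp (φ' (e'.symm (e w))))) ∧
      (w.1 * Real.exp (φ w)) • fderiv ℝ (fun w => e'.symm (e w)) w (0, 1) =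
        (C, D * ((e'.symm (e w)).1 * Real.exp (φ' (e'.symm (e w))))) := by
  set w' := e'.symm (e w) with hw'
  have hws : w' ∈ e'.source := e'.map_target hw.2
  have hee : e' w' = e w := e'.right_inv hw.2
  have ho := h.orthonormal _ (e.map_source hw.1)
  have ho' := h'.orthonormal _ hw.2
  have hinj := injective_paramDeriv e' hws
  have hmor := h'.morphism_apply hws
  rw [hee] at hmor
  have e1 := ho'.expand (σ₁ (e w))
  have e2 := ho'.expand (σ₂ (e w))
  have e3 := ho.expand (σ₁' (e w))
  have n1 := ho.left
  have n2 := ho.right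
  have n3 := ho'.left
  set A := S.metric.inner (e w) (σ₁ (e w)) (σ₁' (e w)) with hA
  set B := S.metric.inner (e w) (σ₁ (e w)) (σ₂' (e w)) with hB
  set C := S.metric.inner (e w) (σ₂ (e w)) (σ₁' (e w)) with hC
  set D := S.metric.inner (e w) (σ₂ (e w)) (σ₂' (e w)) with hD
  rw [S.metric.symm _ (σ₁' (e w)) (σ₁ (e w)), S.metric.symm _ (σ₁' (e w)) (σ₂ (e w))] at e3
  refine ⟨A, B, C, D, ?_, ?_, ?_, ?_, ?_⟩
  · rw [e1] at n1
    simp only [map_add, map_smul, add_apply, smul_apply, smul_eq_mul, ho'.left, ho'.right,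
      ho'.cross, ho'.cross'] at n1
    linarith
  · rw [e3] at n3
    simp only [map_add, map_smul, add_apply, smul_apply, smul_eq_mul, ho.left, ho.right,
      ho.cross, ho.cross'] at n3
    linarith
  · rw [e2] at n2
    simp only [map_add, map_smul, add_apply, smul_apply, smul_eq_mul, ho'.left, ho'.right,
      ho'.cross, ho'.cross'] at n2
    linarith
  · have h1 := h.left_eq w hw.1
    rw [e1, hmor] at h1
    exact hinj ((paramDeriv_transition e e' hw (1, 0)).symm.trans h1.symm)
  · have h1 := h.right_eq w hw.1
    rw [e2, hmor] at h1
    refine hinj (Eq.trans ?_ h1.symm)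
    rw [map_smul]
    exact congrArg _ (paramDeriv_transition e e' hw (0, 1)).symm

end TwoARS.IsNormalChart
end AlmostRiemannian

/-! ### Rigidity of the transition maps -/

namespace AlmostRiemannian

/-- The open square of radius `r` centered at `(0, y)`. -/
def box (y r : ℝ) : Set (ℝ × ℝ) := Ioo (-r) r ×ˢ Ioo (y - r) (y + r)

theorem isOpen_box (y r : ℝ) : IsOpen (box y r) := isOpen_Ioo.prod isOpen_Ioo

theorem mem_box {y r : ℝ} (hr : 0 < r) : ((0 : ℝ), y) ∈ box y r :=
  ⟨⟨by linarith, hr⟩, ⟨by linarith, by linarith⟩⟩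

theorem isPreconnected_box (y r : ℝ) : IsPreconnected (box y r) :=
  isPreconnected_Ioo.prod isPreconnected_Ioo

theorem exists_box_subset {y : ℝ} {N : Set (ℝ × ℝ)} (hN : N ∈ 𝓝 ((0 : ℝ), y)) :
    ∃ r > 0, box y r ⊆ N := by
  obtain ⟨r, hr, h⟩ := Metric.mem_nhds_iff.1 hN
  refine ⟨r, hr, ?_⟩
  rwa [← ball_prod_same, Real.ball_eq_Ioo, Real.ball_eq_Ioo, zero_sub, zero_add] at h

/-- Identities obtained by dividing by `x` are known only off the axis, whose complement is dense.
-/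
theorem eqOn_of_eqOn_fst_ne_zero {X : Type*} [TopologicalSpace X] [T2Space X] {f g : ℝ × ℝ → X}
    {O : Set (ℝ × ℝ)} (hO : IsOpen O) (hf : ContinuousOn f O) (hg : ContinuousOn g O)
    (h : ∀ w ∈ O, w.1 ≠ 0 → f w = g w) : EqOn f g O := by
  have hd : Dense {w : ℝ × ℝ | w.1 ≠ 0} :=
    (dense_compl_singleton (0 : ℝ)).preimage isOpenMap_fst
  exact EqOn.of_subset_closure (s := O ∩ {w | w.1 ≠ 0}) (fun w hw => h w hw.1 hw.2) hf hg
    inter_subset_left (hd.open_subset_closure_inter hO)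

theorem hasDerivAt_fst_line {f : ℝ × ℝ → ℝ} {x y : ℝ} (hf : DifferentiableAt ℝ f (x, y)) :
    HasDerivAt (fun t => f (t, y)) (fderiv ℝ f (x, y) (1, 0)) x :=
  hf.hasFDerivAt.comp_hasDerivAt (f := fun t => (t, y)) x
    ((hasDerivAt_id x).prodMk (hasDerivAt_const x y))

theorem hasDerivAt_snd_line {f : ℝ × ℝ → ℝ} {x y : ℝ} (hf : DifferentiableAt ℝ f (x, y)) :
    HasDerivAt (fun t => f (x, t)) (fderiv ℝ f (x, y) (0, 1)) y :=
  hf.hasFDerivAt.comp_hasDerivAt (f := fun t => (x, t)) y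
    ((hasDerivAt_const y x).prodMk (hasDerivAt_id y))

theorem abs_le_abs_fst {a : ℝ × ℝ → ℝ} {y r : ℝ} (hd : ∀ w ∈ box y r, DifferentiableAt ℝ a w)
    (h1 : ∀ w ∈ box y r, |fderiv ℝ a w (1, 0)| ≤ 1) (h0 : ∀ w ∈ box y r, w.1 = 0 → a w = 0)
    {w : ℝ × ℝ} (hw : w ∈ box y r) : |a w| ≤ |w.1| := by
  obtain ⟨x, t⟩ := w
  have hr : 0 < r := by linarith [hw.1.1, hw.1.2]
  have h00 : (0 : ℝ) ∈ Ioo (-r) r := ⟨by linarith, hr⟩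
  have h := (convex_Ioo (-r) r).norm_image_sub_le_of_norm_hasDerivWithin_le
    (f := fun s => a (s, t)) (C := 1)
    (fun s hs => (hasDerivAt_fst_line (hd (s, t) ⟨hs, hw.2⟩)).hasDerivWithinAt)
    (fun s hs => h1 (s, t) ⟨hs, hw.2⟩) h00 hw.1
  simpa [h0 (0, t) ⟨h00, hw.2⟩ rfl] using h

/-- Since `|∂ψ₁/∂x| = |A| ≤ 1` and `ψ₁ = 0` on the axis, `|ψ₁| ≤ |x|`; with `habs` this is an
equality, so `ψ₁ = ± x` and `A² = 1`. Orthogonality then gives `B = C = 0` and `D² = 1`. So `ψ₂`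
does not depend on `x`, and its speed in `y` may be computed on the axis, where `f = g = 0` makes it
`± 1`. Signs are constant by connectedness. -/
theorem eq_affine_of_transition {ψ : ℝ × ℝ → ℝ × ℝ} {y r : ℝ} (hr : 0 < r)
    (hψ : ContDiffOn ℝ ∞ ψ (box y r)) {f g : ℝ × ℝ → ℝ} (hf : ContinuousOn f (box y r))
    (hg : ContinuousOn g (box y r)) (hf0 : ∀ w ∈ box y r, w.1 = 0 → f w = 0)
    (hg0 : ∀ w ∈ box y r, w.1 = 0 → g w = 0) (h0 : ∀ w ∈ box y r, w.1 = 0 → (ψ w).1 = 0)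
    (habs : ∀ w ∈ box y r, |w.1| ≤ |(ψ w).1|)
    (H : ∀ w ∈ box y r, ∃ A B C D : ℝ, A ^ 2 + B ^ 2 = 1 ∧ A ^ 2 + C ^ 2 = 1 ∧
      C ^ 2 + D ^ 2 = 1 ∧ fderiv ℝ ψ w (1, 0) = (A, B * ((ψ w).1 * Real.exp (g w))) ∧
      (w.1 * Real.exp (f w)) • fderiv ℝ ψ w (0, 1) = (C, D * ((ψ w).1 * Real.exp (g w)))) :
    ∃ s₁ s₂ : ℝ, s₁ ^ 2 = 1 ∧ s₂ ^ 2 = 1 ∧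
      ∀ w ∈ box y r, ψ w = (s₁ * w.1, s₂ * (w.2 - y) + (ψ (0, y)).2) := by
  set O := box y r with hO
  have hOo : IsOpen O := isOpen_box y r
  have h00 : (0 : ℝ) ∈ Ioo (-r) r := ⟨by linarith, hr⟩
  have hd : ∀ w ∈ O, HasFDerivAt ψ (fderiv ℝ ψ w) w := fun w hw =>
    ((hψ.contDiffAt (hOo.mem_nhds hw)).differentiableAt (by simp)).hasFDerivAt
  have hψ' : ContDiffOn ℝ ∞ (fderiv ℝ ψ) O := hψ.fderiv_of_isOpen hOo (by simp)
  have hd₁ : ∀ w ∈ O, HasFDerivAt (fun w => (ψ w).1)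
      ((ContinuousLinearMap.fst ℝ ℝ ℝ).comp (fderiv ℝ ψ w)) w := fun w hw =>
    (ContinuousLinearMap.fst ℝ ℝ ℝ).hasFDerivAt.comp w (hd w hw)
  have hd₂ : ∀ w ∈ O, HasFDerivAt (fun w => (ψ w).2)
      ((ContinuousLinearMap.snd ℝ ℝ ℝ).comp (fderiv ℝ ψ w)) w := fun w hw =>
    (ContinuousLinearMap.snd ℝ ℝ ℝ).hasFDerivAt.comp w (hd w hw)
  have hcx : ContinuousOn (fun w => (fderiv ℝ ψ w (1, 0)).1) O :=
    continuous_fst.comp_continuousOn (hψ'.clm_apply contDiffOn_const).continuousOn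
  have hcy : ContinuousOn (fun w => (fderiv ℝ ψ w (0, 1)).2) O :=
    continuous_snd.comp_continuousOn (hψ'.clm_apply contDiffOn_const).continuousOn
  have hsq : ∀ w ∈ O, (ψ w).1 ^ 2 = w.1 ^ 2 := by
    intro w hw
    refine sq_eq_sq_iff_abs_eq_abs _ _ |>.2 (le_antisymm ?_ (habs w hw))
    refine abs_le_abs_fst (a := fun w => (ψ w).1) (fun w hw => (hd₁ w hw).differentiableAt)
      (fun w hw => ?_) h0 hw
    rw [(hd₁ w hw).fderiv]
    obtain ⟨A, B, C, D, hAB, -, -, hx, -⟩ := H w hw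
    change |(fderiv ℝ ψ w (1, 0)).1| ≤ 1
    rw [hx, ← sq_le_one_iff_abs_le_one]
    nlinarith [sq_nonneg B]
  -- Off the axis this follows by differentiating `ψ₁² = x²` in `x` and squaring.
  have hx2 : ∀ w ∈ O, (fderiv ℝ ψ w (1, 0)).1 ^ 2 = 1 := by
    refine eqOn_of_eqOn_fst_ne_zero hOo (hcx.pow 2) continuousOn_const fun w hw hne => ?_
    have h1 := (hd₁ w hw).pow 2
    have h2 : HasFDerivAt (fun w : ℝ × ℝ => w.1 ^ 2) _ w :=
      (hasFDerivAt_fst (𝕜 := ℝ) (p := w)).pow 2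
    have h3 : (fun w => (ψ w).1 ^ 2) =ᶠ[𝓝 w] fun w => w.1 ^ 2 := by
      filter_upwards [hOo.mem_nhds hw] with u hu using hsq u hu
    have h4 := (h2.congr_of_eventuallyEq h3).unique h1
    have h5 := congrArg (fun L : ℝ × ℝ →L[ℝ] ℝ => L (1, 0)) h4
    simp only [smul_apply, ContinuousLinearMap.coe_fst', ContinuousLinearMap.comp_apply,
      smul_eq_mul, nsmul_eq_mul] at h5
    have h6 := hsq w hw
    norm_num at h5
    have h7 : w.1 ^ 2 = w.1 ^ 2 * (fderiv ℝ ψ w (1, 0)).1 ^ 2 := by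
      have h9 : w.1 = (ψ w).1 * (fderiv ℝ ψ w (1, 0)).1 := by linarith
      rw [← h6, ← mul_pow, ← h9, h6]
    have h8 : w.1 ^ 2 ≠ 0 := pow_ne_zero 2 hne
    exact (mul_left_cancel₀ h8 (by rw [← h7, mul_one]))
  obtain ⟨s₁, hs₁, hax⟩ : ∃ s₁ : ℝ, s₁ ^ 2 = 1 ∧ ∀ w ∈ O, (fderiv ℝ ψ w (1, 0)).1 = s₁ := by
    rcases (isPreconnected_box y r).eq_one_or_eq_neg_one_of_sq_eq hcx hx2 with h | h
    · exact ⟨1, by norm_num, h⟩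
    · exact ⟨-1, by norm_num, h⟩
  have ha : ∀ w ∈ O, (ψ w).1 = s₁ * w.1 := by
    rintro ⟨x, t⟩ hw
    have h := eq_of_forall_hasDerivAt_zero (f := fun s => (ψ (s, t)).1 - s₁ * s) hr
      (fun s hs => ?_) hw.1
    · simp only [h0 (0, t) ⟨h00, hw.2⟩ rfl] at h
      linarith
    · have h1 := hasDerivAt_fst_line (hd₁ (s, t) ⟨hs, hw.2⟩).differentiableAt
      rw [(hd₁ (s, t) ⟨hs, hw.2⟩).fderiv] at h1
      refine (h1.sub ((hasDerivAt_id s).const_mul s₁)).congr_deriv ?_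
      change (fderiv ℝ ψ (s, t) (1, 0)).1 - s₁ * 1 = 0
      rw [hax (s, t) ⟨hs, hw.2⟩]
      ring
  have hb : ∀ w ∈ O, (ψ w).2 = (ψ (0, w.2)).2 := by
    rintro ⟨x, t⟩ hw
    refine eq_of_forall_hasDerivAt_zero (f := fun s => (ψ (s, t)).2) hr (fun s hs => ?_) hw.1
    have h1 := hasDerivAt_fst_line (hd₂ (s, t) ⟨hs, hw.2⟩).differentiableAt
    rw [(hd₂ (s, t) ⟨hs, hw.2⟩).fderiv] at h1
    refine h1.congr_deriv ?_
    obtain ⟨A, B, C, D, hAB, -, -, hx, -⟩ := H (s, t) ⟨hs, hw.2⟩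
    have hA := hx2 (s, t) ⟨hs, hw.2⟩
    change (fderiv ℝ ψ (s, t) (1, 0)).2 = 0
    rw [hx] at hA ⊢
    have hB : B = 0 := by
      have : B ^ 2 = 0 := by simp only at hA; linarith
      exact pow_eq_zero_iff two_ne_zero |>.1 this
    simp [hB]
  -- The second components of the identity for the second field are squared, and `x² = ψ₁²` is
  -- cancelled off the axis.
  have hy2 : ∀ w ∈ O, (fderiv ℝ ψ w (0, 1)).2 ^ 2 = Real.exp (2 * g w - 2 * f w) := by
    refine eqOn_of_eqOn_fst_ne_zero hOo (hcy.pow 2)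
      (Real.continuous_exp.comp_continuousOn ((hg.const_mul 2).sub (hf.const_mul 2)))
      fun w hw hne => ?_
    obtain ⟨A, B, C, D, -, hAC, hCD, hx, hy⟩ := H w hw
    have hA := hx2 w hw
    rw [hx] at hA
    simp only at hA
    have hD : D ^ 2 = 1 := by linarith
    have h1 := congrArg (fun p : ℝ × ℝ => p.2 ^ 2) hy
    simp only [Prod.smul_snd, smul_eq_mul, mul_pow, hD, hsq w hw, one_mul] at h1
    have h2 : w.1 ^ 2 ≠ 0 := pow_ne_zero 2 hne
    rw [mul_assoc] at h1
    have h3 := mul_left_cancel₀ h2 h1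
    rw [Real.exp_sub, eq_div_iff (Real.exp_pos _).ne', two_mul, two_mul, Real.exp_add,
      Real.exp_add, ← pow_two, ← pow_two]
    linarith
  obtain ⟨s₂, hs₂, hby⟩ : ∃ s₂ : ℝ, s₂ ^ 2 = 1 ∧ ∀ t ∈ Ioo (y - r) (y + r),
      (fderiv ℝ ψ (0, t) (0, 1)).2 = s₂ := by
    have hc : ContinuousOn (fun t : ℝ => (fderiv ℝ ψ (0, t) (0, 1)).2) (Ioo (y - r) (y + r)) :=
      hcy.comp (f := fun t : ℝ => ((0 : ℝ), t)) (by fun_prop) fun t ht => ⟨h00, ht⟩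
    have h2 : EqOn ((fun t : ℝ => (fderiv ℝ ψ (0, t) (0, 1)).2) ^ 2) 1 (Ioo (y - r) (y + r)) := by
      intro t ht
      have hm : ((0 : ℝ), t) ∈ O := ⟨h00, ht⟩
      have := hy2 _ hm
      rw [hf0 _ hm rfl, hg0 _ hm rfl] at this
      simpa using this
    rcases isPreconnected_Ioo.eq_one_or_eq_neg_one_of_sq_eq hc h2 with h | h
    · exact ⟨1, by norm_num, h⟩
    · exact ⟨-1, by norm_num, h⟩
  refine ⟨s₁, s₂, hs₁, hs₂, fun w hw => Prod.ext (ha w hw) ?_⟩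
  rw [hb w hw]
  have h := eq_of_forall_hasDerivAt_zero (f := fun s => (ψ (0, y + s)).2 - s₂ * s) hr
    (fun s hs => ?_) (x := w.2 - y) ⟨by linarith [hw.2.1], by linarith [hw.2.2]⟩
  · simp only [add_sub_cancel, add_zero, mul_zero, sub_zero] at h
    linarith
  · have hm : ((0 : ℝ), y + s) ∈ O := ⟨h00, by linarith [hs.1], by linarith [hs.2]⟩
    have h1 := hasDerivAt_snd_line (hd₂ _ hm).differentiableAt
    rw [(hd₂ _ hm).fderiv] at h1
    refine ((h1.scomp s ((hasDerivAt_id s).const_add y)).sub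
      ((hasDerivAt_id s).const_mul s₂)).congr_deriv ?_
    change (1 : ℝ) • (fderiv ℝ ψ (0, y + s) (0, 1)).2 - s₂ * 1 = 0
    rw [hby _ hm.2]
    simp

end AlmostRiemannian

/-! ### Germs of normal parametrizations and their symmetries -/

namespace AlmostRiemannian

variable {M : Type*} [TopologicalSpace M] [ChartedSpace Plane M] [IsManifold (𝓡 2) ∞ M]
  {F : Type*} [NormedAddCommGroup F] [NormedSpace ℝ F]
  {E : M → Type*} [TopologicalSpace (TotalSpace F E)]
  [∀ q, TopologicalSpace (E q)] [∀ q, AddCommGroup (E q)] [∀ q, Module ℝ (E q)]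
  [∀ q, IsTopologicalAddGroup (E q)] [∀ q, ContinuousConstSMul ℝ (E q)]
  [FiberBundle F E] [VectorBundle ℝ F E] [ContMDiffVectorBundle ∞ F E (𝓡 2)]

namespace TwoARS

namespace IsNormalChart

variable {S : TwoARS M F E} {e e' : PartialDiffeomorph 𝓘(ℝ, ℝ × ℝ) (𝓡 2) (ℝ × ℝ) M ∞}
  {σ₁ σ₂ σ₁' σ₂' : ∀ q, E q} {φ φ' : ℝ × ℝ → ℝ}

theorem transition_fst_eq_zero [T2Space M] (h : S.IsNormalChart e σ₁ σ₂ φ)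
    (h' : S.IsNormalChart e' σ₁' σ₂' φ') {w : ℝ × ℝ} (hw : w ∈ e.source ∩ e ⁻¹' e'.target)
    (h0 : w.1 = 0) : (e'.symm (e w)).1 = 0 := by
  refine (h'.mem_singularSet_iff (w := e'.symm (e w)) (e'.map_target hw.2)).1 ?_
  rw [show e' (e'.symm (e w)) = e w from e'.right_inv hw.2, h.mem_singularSet_iff hw.1]
  exact h0

theorem eventually_abs_le [T2Space M] (h : S.IsNormalChart e σ₁ σ₂ φ)
    (h' : S.IsNormalChart e' σ₁' σ₂' φ') {y : ℝ}
    (hy : ((0 : ℝ), y) ∈ e.source ∩ e ⁻¹' e'.target) :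
    ∀ᶠ w in 𝓝 ((0 : ℝ), y), |(e'.symm (e w)).1| ≤ |w.1| := by
  obtain ⟨r, hr, hb⟩ := exists_box_subset ((isOpen_transition_source e e').mem_nhds hy)
  filter_upwards [(isOpen_box y r).mem_nhds (mem_box hr)] with w hw
  have hd : ∀ w ∈ box y r, HasFDerivAt (fun w => (e'.symm (e w)).1)
      ((ContinuousLinearMap.fst ℝ ℝ ℝ).comp (fderiv ℝ (fun w => e'.symm (e w)) w)) w :=
    fun w hw => (ContinuousLinearMap.fst ℝ ℝ ℝ).hasFDerivAt.comp w
      (((contDiffOn_transition e e').contDiffAt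
        ((isOpen_transition_source e e').mem_nhds (hb hw))).differentiableAt
          (show (∞ : ℕ∞ω) ≠ 0 by simp)).hasFDerivAt
  refine abs_le_abs_fst (a := fun w => (e'.symm (e w)).1)
    (fun w hw => (hd w hw).differentiableAt) (fun w hw => ?_)
    (fun w hw h0 => h.transition_fst_eq_zero h' (hb hw) h0) hw
  rw [(hd w hw).fderiv]
  obtain ⟨A, B, C, D, hAB, -, -, hx, -⟩ := h.transition h' (hb hw)
  change |(fderiv ℝ (fun w => e'.symm (e w)) w (1, 0)).1| ≤ 1
  rw [hx, ← sq_le_one_iff_abs_le_one]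
  nlinarith [sq_nonneg B]

/-- The Lipschitz estimate is applied to the transition and to its inverse, which gives both
inequalities between the first coordinates; the affine form follows. -/
theorem rigidity [T2Space M] (h : S.IsNormalChart e σ₁ σ₂ φ)
    (h' : S.IsNormalChart e' σ₁' σ₂' φ') {y y' : ℝ} (hy : ((0 : ℝ), y) ∈ e.source)
    (hy' : ((0 : ℝ), y') ∈ e'.source) (hee : e (0, y) = e' (0, y')) :
    ∃ s₁ s₂ : ℝ, s₁ ^ 2 = 1 ∧ s₂ ^ 2 = 1 ∧
      ∀ᶠ w in 𝓝 ((0 : ℝ), y), e w = e' (s₁ * w.1, s₂ * (w.2 - y) + y') := by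
  have hm : ((0 : ℝ), y) ∈ e.source ∩ e ⁻¹' e'.target := ⟨hy, by
    rw [mem_preimage, hee]; exact e'.map_source hy'⟩
  have hm' : ((0 : ℝ), y') ∈ e'.source ∩ e' ⁻¹' e.target := ⟨hy', by
    rw [mem_preimage, ← hee]; exact e.map_source hy⟩
  have hT := (isOpen_transition_source e e').mem_nhds hm
  have hψ := contDiffOn_transition e e'
  have hψ0 : e'.symm (e (0, y)) = (0, y') := by rw [hee]; exact e'.left_inv hy'
  have hback : ∀ᶠ w in 𝓝 ((0 : ℝ), y), |w.1| ≤ |(e'.symm (e w)).1| := by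
    have h1 := h'.eventually_abs_le h hm'
    rw [← hψ0] at h1
    filter_upwards [(hψ.contDiffAt hT).continuousAt.eventually h1, hT] with w hw hwT
    rw [show e' (e'.symm (e w)) = e w from e'.right_inv hwT.2,
      show e.symm (e w) = w from e.left_inv hwT.1] at hw
    exact hw
  obtain ⟨r, hr, hb⟩ := exists_box_subset (inter_mem hT hback)
  have hbT : box y r ⊆ e.source ∩ e ⁻¹' e'.target := fun w hw => (hb hw).1
  have hψb := hψ.mono hbT
  obtain ⟨s₁, s₂, hs₁, hs₂, H⟩ := eq_affine_of_transition hr hψb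
    (f := φ) (g := fun w => φ' (e'.symm (e w)))
    (h.contDiffOn.continuousOn.mono fun w hw => (hbT hw).1)
    (h'.contDiffOn.continuousOn.comp hψb.continuousOn fun w hw => e'.map_target (hbT hw).2)
    (fun w hw h0 => h.eq_zero w (hbT hw).1 h0)
    (fun w hw h0 => h'.eq_zero _ (e'.map_target (hbT hw).2)
      (h.transition_fst_eq_zero h' (hbT hw) h0))
    (fun w hw h0 => h.transition_fst_eq_zero h' (hbT hw) h0)
    (fun w hw => (hb hw).2) (fun w hw => h.transition h' (hbT hw))
  refine ⟨s₁, s₂, hs₁, hs₂, ?_⟩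
  filter_upwards [(isOpen_box y r).mem_nhds (mem_box hr)] with w hw
  have h1 := H w hw
  rw [hψ0] at h1
  rw [← h1]
  exact (e'.right_inv (hbT hw).2).symm

end IsNormalChart

end TwoARS

/-- The affine maps of `ℝ × ℝ` given by a symmetry in each variable and a translation in the
second one. -/
def affineDiffeo (s₁ s₂ c : ℝ) (h₁ : s₁ ^ 2 = 1) (h₂ : s₂ ^ 2 = 1) :
    PartialDiffeomorph 𝓘(ℝ, ℝ × ℝ) 𝓘(ℝ, ℝ × ℝ) (ℝ × ℝ) (ℝ × ℝ) ∞ where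
  toFun w := (s₁ * w.1, s₂ * w.2 + c)
  invFun w := (s₁ * w.1, s₂ * (w.2 - c))
  source := univ
  target := univ
  map_source' _ _ := trivial
  map_target' _ _ := trivial
  left_inv' w _ := by
    ext
    · linear_combination w.1 * h₁
    · linear_combination w.2 * h₂
  right_inv' w _ := by
    ext
    · linear_combination w.1 * h₁
    · linear_combination (w.2 - c) * h₂
  open_source := isOpen_univ
  open_target := isOpen_univ
  contMDiffOn_toFun := by
    refine (ContDiff.contMDiff ?_).contMDiffOn
    fun_prop
  contMDiffOn_invFun := by
    refine (ContDiff.contMDiff ?_).contMDiffOn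
    fun_prop

theorem paramDeriv_comp_affine {M : Type*} [TopologicalSpace M] [ChartedSpace Plane M]
    {Φ : ℝ × ℝ → M} (s₁ s₂ c : ℝ) {w : ℝ × ℝ}
    (hΦ : MDifferentiableAt 𝓘(ℝ, ℝ × ℝ) (𝓡 2) Φ (s₁ * w.1, s₂ * w.2 + c)) (v : ℝ × ℝ) :
    paramDeriv (fun w => Φ (s₁ * w.1, s₂ * w.2 + c)) w v =
      paramDeriv Φ (s₁ * w.1, s₂ * w.2 + c) (s₁ * v.1, s₂ * v.2) := by
  have h2 : HasFDerivAt (fun w : ℝ × ℝ => (s₁ * w.1, s₂ * w.2 + c))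
      ((s₁ • ContinuousLinearMap.fst ℝ ℝ ℝ).prod (s₂ • ContinuousLinearMap.snd ℝ ℝ ℝ)) w :=
    ((hasFDerivAt_fst (p := w)).const_smul s₁).prodMk
      (((hasFDerivAt_snd (p := w)).const_smul s₂).add_const c)
  have h3 := mfderiv_comp w hΦ h2.differentiableAt.mdifferentiableAt
  rw [mfderiv_eq_fderiv, h2.fderiv] at h3
  exact congrArg (fun L : ℝ × ℝ →L[ℝ] Plane => L v) h3

namespace TwoARS

/-- Near `z`, the map `Φ` is a parametrization in which the structure is in normal form. -/
def IsNormalAt (S : TwoARS M F E) (Φ : ℝ × ℝ → M) (z : ℝ × ℝ) : Prop :=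
  ∃ e σ₁ σ₂ φ, S.IsNormalChart e σ₁ σ₂ φ ∧ z ∈ e.source ∧ Φ =ᶠ[𝓝 z] e

/-- The change of variables multiplies `∂/∂x` by `s₁` and `x ∂/∂y` by `s₁ s₂`. Changing the signs of
the two sections accordingly restores the normal form. -/
theorem IsNormalChart.comp_affine {S : TwoARS M F E}
    {e : PartialDiffeomorph 𝓘(ℝ, ℝ × ℝ) (𝓡 2) (ℝ × ℝ) M ∞} {σ₁ σ₂ : ∀ q, E q} {φ : ℝ × ℝ → ℝ}
    (h : S.IsNormalChart e σ₁ σ₂ φ) {s₁ s₂ : ℝ} (c : ℝ) (h₁ : s₁ ^ 2 = 1) (h₂ : s₂ ^ 2 = 1) :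
    S.IsNormalChart ((affineDiffeo s₁ s₂ c h₁ h₂).trans e) (s₁ • σ₁) ((s₁ * s₂) • σ₂)
      (fun w => φ (s₁ * w.1, s₂ * w.2 + c)) := by
  have ht : ((affineDiffeo s₁ s₂ c h₁ h₂).trans e).target ⊆ e.target := fun p hp => hp.1
  have hs : ∀ w ∈ ((affineDiffeo s₁ s₂ c h₁ h₂).trans e).source,
      (s₁ * w.1, s₂ * w.2 + c) ∈ e.source := fun w hw => hw.2
  have hd : ∀ w ∈ ((affineDiffeo s₁ s₂ c h₁ h₂).trans e).source, ∀ v : ℝ × ℝ,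
      paramDeriv ((affineDiffeo s₁ s₂ c h₁ h₂).trans e) w v =
        paramDeriv e (s₁ * w.1, s₂ * w.2 + c) (s₁ * v.1, s₂ * v.2) := fun w hw v =>
    paramDeriv_comp_affine s₁ s₂ c (e.mdifferentiableAt (by simp) (hs w hw)) v
  refine ⟨(h.smooth_left.mono ht).const_smul_section, (h.smooth_right.mono ht).const_smul_section,
    fun p hp => ?_, ?_, fun w hw => ?_, fun w hw => ?_, fun w hw h0 => ?_⟩
  · have ho := h.orthonormal p (ht hp)
    constructor <;> simp only [Pi.smul_apply, map_smul, smul_apply, smul_eq_mul, ho.left,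
      ho.right, ho.cross]
    · linear_combination h₁
    · linear_combination s₂ ^ 2 * h₁ + h₂
    · ring
  · exact h.contDiffOn.comp (f := fun w : ℝ × ℝ => (s₁ * w.1, s₂ * w.2 + c))
      (by fun_prop) hs
  · rw [hd w hw, mul_one, mul_zero]
    change S.morphism (e _) (s₁ • σ₁ (e (s₁ * w.1, s₂ * w.2 + c))) = _
    rw [map_smul, h.left_eq _ (hs w hw), ← map_smul]
    simp
  · rw [hd w hw, mul_one, mul_zero]
    change S.morphism (e _) ((s₁ * s₂) • σ₂ (e (s₁ * w.1, s₂ * w.2 + c))) = _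
    rw [map_smul, h.right_eq _ (hs w hw), smul_smul, show ((0 : ℝ), s₂) = s₂ • ((0 : ℝ), (1 : ℝ))
      by simp, map_smul]
    refine Eq.trans ?_ (smul_smul _ _ _).symm
    congr 1
    linear_combination s₂ * w.1 * Real.exp (φ (s₁ * w.1, s₂ * w.2 + c)) * h₁
  · exact h.eq_zero _ (hs w hw) (by simp [h0])

namespace IsNormalAt

variable {S : TwoARS M F E} {Φ Ψ : ℝ × ℝ → M} {z : ℝ × ℝ}

theorem congr (h : S.IsNormalAt Φ z) (hΨ : Ψ =ᶠ[𝓝 z] Φ) : S.IsNormalAt Ψ z := by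
  obtain ⟨e, σ₁, σ₂, φ, he, hz, hΦ⟩ := h
  exact ⟨e, σ₁, σ₂, φ, he, hz, hΨ.trans hΦ⟩

theorem eventually (h : S.IsNormalAt Φ z) : ∀ᶠ w in 𝓝 z, S.IsNormalAt Φ w := by
  obtain ⟨e, σ₁, σ₂, φ, he, hz, hΦ⟩ := h
  filter_upwards [e.open_source.mem_nhds hz, hΦ.eventually_nhds] with w hw hΦw
  exact ⟨e, σ₁, σ₂, φ, he, hw, hΦw⟩

theorem comp_affine {s₁ s₂ c : ℝ} (h₁ : s₁ ^ 2 = 1) (h₂ : s₂ ^ 2 = 1)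
    (h : S.IsNormalAt Φ (s₁ * z.1, s₂ * z.2 + c)) :
    S.IsNormalAt (fun w => Φ (s₁ * w.1, s₂ * w.2 + c)) z := by
  obtain ⟨e, σ₁, σ₂, φ, he, hz, hΦ⟩ := h
  refine ⟨_, _, _, _, he.comp_affine c h₁ h₂, ⟨trivial, hz⟩, ?_⟩
  have hc : ContinuousAt (fun w : ℝ × ℝ => (s₁ * w.1, s₂ * w.2 + c)) z := by fun_prop
  exact hc.eventually hΦ

theorem continuousAt (h : S.IsNormalAt Φ z) : ContinuousAt Φ z := by
  obtain ⟨e, σ₁, σ₂, φ, he, hz, hΦ⟩ := h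
  exact (e.contMDiffOn_toFun.continuousOn.continuousAt (e.open_source.mem_nhds hz)).congr
    hΦ.symm

theorem exists_injOn (h : S.IsNormalAt Φ z) : ∃ N ∈ 𝓝 z, InjOn Φ N := by
  obtain ⟨e, σ₁, σ₂, φ, he, hz, hΦ⟩ := h
  refine ⟨_, inter_mem (e.open_source.mem_nhds hz) hΦ, fun u hu v hv huv => ?_⟩
  exact e.injOn hu.1 hv.1 (by rw [← show Φ u = e u from hu.2, ← show Φ v = e v from hv.2, huv])

theorem mem_singularSet_iff [T2Space M] (h : S.IsNormalAt Φ z) :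
    Φ z ∈ S.singularSet ↔ z.1 = 0 := by
  obtain ⟨e, σ₁, σ₂, φ, he, hz, hΦ⟩ := h
  rw [hΦ.self_of_nhds, he.mem_singularSet_iff hz]

theorem rigidity [T2Space M] {y y' : ℝ} (h : S.IsNormalAt Φ (0, y)) (h' : S.IsNormalAt Ψ (0, y'))
    (heq : Φ (0, y) = Ψ (0, y')) : ∃ s₁ s₂ c : ℝ, s₁ ^ 2 = 1 ∧ s₂ ^ 2 = 1 ∧ s₂ * y + c = y' ∧
      ∀ᶠ w in 𝓝 ((0 : ℝ), y), Φ w = Ψ (s₁ * w.1, s₂ * w.2 + c) := by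
  obtain ⟨e, σ₁, σ₂, φ, he, hz, hΦ⟩ := h
  obtain ⟨e', σ₁', σ₂', φ', he', hz', hΨ⟩ := h'
  rw [hΦ.self_of_nhds, hΨ.self_of_nhds] at heq
  obtain ⟨s₁, s₂, h₁, h₂, H⟩ := he.rigidity he' hz hz' heq
  refine ⟨s₁, s₂, y' - s₂ * y, h₁, h₂, by ring, ?_⟩
  have hc : Tendsto (fun w : ℝ × ℝ => (s₁ * w.1, s₂ * w.2 + (y' - s₂ * y))) (𝓝 (0, y))
      (𝓝 (0, y')) := by
    have : ContinuousAt (fun w : ℝ × ℝ => (s₁ * w.1, s₂ * w.2 + (y' - s₂ * y))) (0, y) := by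
      fun_prop
    simpa [ContinuousAt] using this
  filter_upwards [hΦ, hc.eventually hΨ, H] with w h1 h2 h3
  rw [h1, h2, h3]
  congr 2
  ring

/-- The singular set near a point of the axis is contained in the image of the axis. -/
theorem eventually_mem_image [T2Space M] {y : ℝ} (h : S.IsNormalAt Φ (0, y)) {N : Set ℝ}
    (hN : N ∈ 𝓝 y) :
    ∀ᶠ p in 𝓝 (Φ (0, y)), p ∈ S.singularSet → ∃ t ∈ N, S.IsNormalAt Φ (0, t) ∧ Φ (0, t) = p := by
  have hev := h.eventually
  obtain ⟨e, σ₁, σ₂, φ, he, hz, hΦ⟩ := h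
  rw [hΦ.self_of_nhds]
  have hc : Tendsto e.symm (𝓝 (e (0, y))) (𝓝 (0, y)) := by
    have := e.contMDiffOn_invFun.continuousOn.continuousAt
      (e.open_target.mem_nhds (e.map_source hz))
    rw [ContinuousAt, show e.invFun (e (0, y)) = (0, y) from e.left_inv hz] at this
    exact this
  have hN' : ∀ᶠ w : ℝ × ℝ in 𝓝 (0, y), w.2 ∈ N := continuousAt_snd.eventually hN
  filter_upwards [e.open_target.mem_nhds (e.map_source hz), hc.eventually hN', hc.eventually hΦ,
    hc.eventually hev] with p hp h1 h2 h3 hpZ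
  have hr : e (e.symm p) = p := e.right_inv hp
  rw [← hr] at hpZ
  replace hpZ := (he.mem_singularSet_iff (w := e.symm p) (e.map_target hp)).1 hpZ
  have h0 : e.symm p = (0, (e.symm p).2) := Prod.ext hpZ rfl
  refine ⟨(e.symm p).2, h1, ?_, ?_⟩
  · rw [← h0]; exact h3
  · rw [← h0, h2, hr]

end IsNormalAt
end TwoARS
end AlmostRiemannian

/-! ### Continuation of normal parametrizations along the singular set -/

namespace AlmostRiemannian

theorem eq_id_of_eventually_affine {s₁ s₂ c y : ℝ}
    (h : ∀ᶠ w in 𝓝 ((0 : ℝ), y), (s₁ * w.1, s₂ * w.2 + c) = w) : s₁ = 1 ∧ s₂ = 1 ∧ c = 0 := by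
  have h0 := congrArg Prod.snd h.self_of_nhds
  have hx : Tendsto (fun x : ℝ => (x, y)) (𝓝 0) (𝓝 (0, y)) :=
    (Continuous.prodMk_left y).tendsto 0
  have hy : Tendsto (fun t : ℝ => ((0 : ℝ), t)) (𝓝 y) (𝓝 (0, y)) :=
    (Continuous.prodMk_right (0 : ℝ)).tendsto y
  obtain ⟨x, hx1, hx0⟩ := (((hx.eventually h).filter_mono nhdsWithin_le_nhds).and
    (self_mem_nhdsWithin (a := (0 : ℝ)) (s := {0}ᶜ))).exists
  obtain ⟨t, ht1, ht0⟩ := (((hy.eventually h).filter_mono nhdsWithin_le_nhds).and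
    (self_mem_nhdsWithin (a := y) (s := {y}ᶜ))).exists
  have hs₁ : s₁ = 1 := by
    have := congrArg Prod.fst hx1
    simp only at this
    exact mul_right_cancel₀ hx0 (by rw [this, one_mul])
  have hs₂ : s₂ = 1 := by
    have h1 := congrArg Prod.snd ht1
    simp only at h1 h0
    have h2 : t - y ≠ 0 := sub_ne_zero.2 ht0
    exact mul_right_cancel₀ h2 (by linarith)
  refine ⟨hs₁, hs₂, ?_⟩
  rw [hs₂] at h0
  simp only at h0
  linarith

theorem tendsto_axis (y : ℝ) : Tendsto (fun t : ℝ => ((0 : ℝ), t)) (𝓝 y) (𝓝 (0, y)) :=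
  (Continuous.prodMk_right (0 : ℝ)).tendsto y

variable {M : Type*} [TopologicalSpace M] [ChartedSpace Plane M] [IsManifold (𝓡 2) ∞ M]
  {F : Type*} [NormedAddCommGroup F] [NormedSpace ℝ F]
  {E : M → Type*} [TopologicalSpace (TotalSpace F E)]
  [∀ q, TopologicalSpace (E q)] [∀ q, AddCommGroup (E q)] [∀ q, Module ℝ (E q)]
  [∀ q, IsTopologicalAddGroup (E q)] [∀ q, ContinuousConstSMul ℝ (E q)]
  [FiberBundle F E] [VectorBundle ℝ F E] [ContMDiffVectorBundle ∞ F E (𝓡 2)]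
  {S : TwoARS M F E} {Φ Ψ : ℝ × ℝ → M}

namespace TwoARS

theorem IsNormalAt.continuousAt_axis {y : ℝ} (h : S.IsNormalAt Φ (0, y)) :
    ContinuousAt (fun t => Φ (0, t)) y :=
  ContinuousAt.comp (f := fun t : ℝ => ((0 : ℝ), t)) h.continuousAt (tendsto_axis y)

theorem IsNormalAt.translate {x y c : ℝ} (h : S.IsNormalAt Φ (x, y + c)) :
    S.IsNormalAt (fun w => Φ (w.1, w.2 + c)) (x, y) := by
  have := IsNormalAt.comp_affine (S := S) (Φ := Φ) (z := (x, y)) (s₁ := 1) (s₂ := 1) (c := c)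
    (by norm_num) (by norm_num) (by simpa using h)
  simpa using this

/-- An affine map preserving a normal parametrization near a point of the axis is the identity. -/
theorem IsNormalAt.eq_id_of_eventually [T2Space M] {s₁ s₂ c y : ℝ}
    (h : S.IsNormalAt Φ (0, y)) (hy : s₂ * y + c = y)
    (H : ∃ᶠ y' in 𝓝 y, ∀ᶠ w in 𝓝 ((0 : ℝ), y'), Φ (s₁ * w.1, s₂ * w.2 + c) = Φ w) :
    s₁ = 1 ∧ s₂ = 1 ∧ c = 0 := by
  obtain ⟨N, hN, hinj⟩ := h.exists_injOn
  have hc : Tendsto (fun w : ℝ × ℝ => (s₁ * w.1, s₂ * w.2 + c)) (𝓝 (0, y)) (𝓝 (0, y)) := by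
    have : ContinuousAt (fun w : ℝ × ℝ => (s₁ * w.1, s₂ * w.2 + c)) (0, y) := by fun_prop
    simpa [ContinuousAt, hy] using this
  have h1 : ∀ᶠ y' in 𝓝 y, ∀ᶠ w in 𝓝 ((0 : ℝ), y'), w ∈ N ∧ (s₁ * w.1, s₂ * w.2 + c) ∈ N :=
    (tendsto_axis y).eventually ((Filter.Eventually.and hN (hc.eventually hN)).eventually_nhds)
  obtain ⟨y', h2, h3⟩ := (H.and_eventually h1).exists
  refine eq_id_of_eventually_affine (y := y') ?_
  filter_upwards [h2, h3] with w h4 h5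
  exact hinj h5.2 h5.1 h4

/-- Unique continuation. Agreement of germs is an open condition. At a limit point the two germs
differ by an affine symmetry; it preserves the germs at nearby points where they already agree, so
it is the identity. -/
theorem eventuallyEq_of_isPreconnected [T2Space M] {I : Set ℝ} (hI : IsPreconnected I)
    (hΦ : ∀ y ∈ I, S.IsNormalAt Φ (0, y)) (hΨ : ∀ y ∈ I, S.IsNormalAt Ψ (0, y)) {y₀ : ℝ}
    (hy₀ : y₀ ∈ I) (h : Φ =ᶠ[𝓝 (0, y₀)] Ψ) {y : ℝ} (hy : y ∈ I) : Φ =ᶠ[𝓝 (0, y)] Ψ := by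
  set u : Set ℝ := {y | Φ =ᶠ[𝓝 (0, y)] Ψ} with hu
  have huo : IsOpen u := isOpen_iff_eventually.2 fun y hy =>
    (tendsto_axis y).eventually (Eventually.eventually_nhds hy)
  refine hI.subset_of_closure_inter_subset huo ⟨y₀, hy₀, h⟩ ?_ hy
  rintro y ⟨hyc, hyI⟩
  have hfr := mem_closure_iff_frequently.1 hyc
  have heq : Φ (0, y) = Ψ (0, y) :=
    tendsto_nhds_unique_of_frequently_eq (hΦ y hyI).continuousAt_axis
      (hΨ y hyI).continuousAt_axis (hfr.mono fun t ht => Filter.EventuallyEq.eq_of_nhds ht)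
  obtain ⟨s₁, s₂, c, h₁, h₂, hc, H⟩ := (hΦ y hyI).rigidity (hΨ y hyI) heq
  obtain ⟨rfl, rfl, rfl⟩ := (hΨ y hyI).eq_id_of_eventually hc (by
    have h3 := (tendsto_axis y).eventually H.eventually_nhds
    refine (hfr.and_eventually h3).mono fun t ht => ?_
    filter_upwards [ht.1, ht.2] with w h4 h5
    rw [← h5, h4])
  filter_upwards [H] with w hw
  simpa using hw

variable (S) in
/-- There is a normal parametrization along the axis, over `(-r, r)`, centered at `q`. -/
def HasNormalArc (r : ℝ) (q : M) : Prop :=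
  ∃ Ψ : ℝ × ℝ → M, Ψ (0, 0) = q ∧ ∀ t ∈ Ioo (-r) r, S.IsNormalAt Ψ (0, t)

/-- Nearby singular points lie on the axis of a normal chart at `q`, and translating this chart in
`y` centers it at each of them, with a common length of arc. -/
theorem exists_eventually_hasNormalArc [T2Space M] (S : TwoARS M F E) {q : M}
    (h3 : S.flagAt 3 q = ⊤) (hq : q ∈ S.singularSet) (hT : ¬ S.IsTangencyPoint q) :
    ∃ r > 0, ∀ᶠ p in 𝓝 q, p ∈ S.singularSet → S.HasNormalArc r p := by
  obtain ⟨e, σ₁, σ₂, φ, he, h0, rfl⟩ := S.exists_isNormalChart h3 hq hT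
  have hn : S.IsNormalAt e (0, 0) := ⟨e, σ₁, σ₂, φ, he, h0, EventuallyEq.rfl⟩
  obtain ⟨ρ, hρ, hb⟩ := Metric.eventually_nhds_iff.1 ((tendsto_axis 0).eventually hn.eventually)
  refine ⟨ρ / 2, by positivity, ?_⟩
  filter_upwards [hn.eventually_mem_image (Ioo_mem_nhds (a := -(ρ / 2)) (b := ρ / 2)
    (by linarith) (by linarith))] with p hp hpZ
  obtain ⟨t, ht, -, rfl⟩ := hp hpZ
  refine ⟨fun w => e (w.1, w.2 + t), by simp, fun u hu => (hb ?_).translate⟩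
  rw [Real.dist_eq, sub_zero, abs_lt]
  constructor <;> linarith [ht.1, ht.2, hu.1, hu.2]

theorem HasNormalArc.mono {r r' : ℝ} {q : M} (h : S.HasNormalArc r q) (hr : r' ≤ r) :
    S.HasNormalArc r' q := by
  obtain ⟨Ψ, h0, h⟩ := h
  exact ⟨Ψ, h0, fun t ht => h t ⟨by linarith [ht.1], by linarith [ht.2]⟩⟩

theorem exists_hasNormalArc_of_isCompact [T2Space M] {W : Set M} (hW : IsCompact W)
    (hWZ : W ⊆ S.singularSet) (h3 : ∀ q ∈ W, S.flagAt 3 q = ⊤)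
    (hT : ∀ q ∈ W, ¬ S.IsTangencyPoint q) : ∃ r > 0, ∀ q ∈ W, S.HasNormalArc r q := by
  have key : ∃ r > 0, ∀ q ∈ W, q ∈ S.singularSet → S.HasNormalArc r q := by
    refine hW.induction_on (p := fun s => ∃ r > 0, ∀ q ∈ s, q ∈ S.singularSet →
      S.HasNormalArc r q) ⟨1, one_pos, by simp⟩ ?_ ?_ ?_
    · rintro s t hst ⟨r, hr, h⟩
      exact ⟨r, hr, fun q hq => h q (hst hq)⟩
    · rintro s t ⟨r, hr, h⟩ ⟨r', hr', h'⟩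
      refine ⟨min r r', lt_min hr hr', fun q hq hqZ => ?_⟩
      rcases hq with hq | hq
      · exact (h q hq hqZ).mono (min_le_left _ _)
      · exact (h' q hq hqZ).mono (min_le_right _ _)
    · intro q hq
      obtain ⟨r, hr, h⟩ := S.exists_eventually_hasNormalArc (h3 q hq) (hWZ hq) (hT q hq)
      exact ⟨_, mem_nhdsWithin_of_mem_nhds h, r, hr, fun p hp => hp⟩
  obtain ⟨r, hr, h⟩ := key
  exact ⟨r, hr, fun q hq => h q hq (hWZ hq)⟩

theorem axis_mem_connectedComponentIn [T2Space M] {I : Set ℝ} (hI : IsPreconnected I)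
    (hΦ : ∀ y ∈ I, S.IsNormalAt Φ (0, y)) {y₀ : ℝ} (hy₀ : y₀ ∈ I) {q : M}
    (hq : Φ (0, y₀) ∈ connectedComponentIn S.singularSet q) {y : ℝ} (hy : y ∈ I) :
    Φ (0, y) ∈ connectedComponentIn S.singularSet q := by
  rw [connectedComponentIn_eq hq]
  have h1 : IsPreconnected ((fun t => Φ (0, t)) '' I) :=
    hI.image _ fun t ht => (hΦ t ht).continuousAt_axis.continuousWithinAt
  refine h1.subset_connectedComponentIn ⟨y₀, hy₀, rfl⟩ ?_ ⟨y, hy, rfl⟩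
  rintro _ ⟨t, ht, rfl⟩
  exact (hΦ t ht).mem_singularSet_iff.2 rfl

/-- At `y₁`, which is `r / 2` before the end of the interval, a normal arc of radius `r` is
attached. By rigidity it agrees with `Φ` near `(0, y₁)` after an affine change, so cutting at `y₁`
glues the germs and gains a length `r / 2`. -/
theorem exists_extension [T2Space M] {r : ℝ} (hr : 0 < r) {q₀ : M}
    (hq₀ : q₀ ∈ connectedComponentIn S.singularSet q₀)
    (harc : ∀ q ∈ connectedComponentIn S.singularSet q₀, S.HasNormalArc r q) (n : ℕ) :
    ∃ Φ : ℝ × ℝ → M, Φ (0, 0) = q₀ ∧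
      ∀ y ∈ Ioo (-r) (r + n * (r / 2)), S.IsNormalAt Φ (0, y) := by
  induction n with
  | zero => simpa [HasNormalArc] using harc q₀ hq₀
  | succ n ih =>
    obtain ⟨Φ, h0, hΦ⟩ := ih
    have hn : 0 ≤ (n : ℝ) * (r / 2) := by positivity
    set y₁ := r / 2 + n * (r / 2) with hy₁
    have hI : y₁ ∈ Ioo (-r) (r + n * (r / 2)) := ⟨by linarith, by linarith⟩
    obtain ⟨Ψ, hΨ0, hΨ⟩ := harc _ (axis_mem_connectedComponentIn isPreconnected_Ioo hΦ
      (y₀ := 0) ⟨by linarith, by linarith⟩ (by rwa [h0]) hI)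
    obtain ⟨s₁, s₂, c, h₁, h₂, hc, H⟩ := (hΦ y₁ hI).rigidity
      (hΨ 0 ⟨by linarith, hr⟩) hΨ0.symm
    refine ⟨fun w => if w.2 < y₁ then Φ w else Ψ (s₁ * w.1, s₂ * w.2 + c), ?_, fun y hy => ?_⟩
    · have : (0 : ℝ) < y₁ := by linarith
      simp only [if_pos this, h0]
    · rcases lt_trichotomy y y₁ with hlt | rfl | hgt
      · refine (hΦ y ⟨hy.1, by linarith⟩).congr ?_
        have : ∀ᶠ w : ℝ × ℝ in 𝓝 (0, y), w.2 < y₁ :=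
          continuousAt_snd.eventually (eventually_lt_nhds hlt)
        filter_upwards [this] with w hw
        rw [if_pos hw]
      · refine (hΦ y₁ hI).congr ?_
        filter_upwards [H] with w hw
        split_ifs
        · rfl
        · exact hw.symm
      · refine (IsNormalAt.comp_affine (S := S) (Φ := Ψ) (z := (0, y)) (s₁ := s₁) (s₂ := s₂)
          (c := c) h₁ h₂ ?_).congr ?_
        · rw [mul_zero]
          refine hΨ _ (abs_lt.1 ?_)
          have h3 : s₂ * y + c = s₂ * (y - y₁) := by linarith
          have h4 : |s₂| = 1 := by
            rw [← sq_eq_sq₀ (abs_nonneg _) zero_le_one, sq_abs, h₂, one_pow]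
          have h5 : y < r + (n + 1 : ℕ) * (r / 2) := hy.2
          push_cast at h5
          rw [h3, abs_mul, h4, one_mul, abs_of_pos (by linarith)]
          linarith
        · have : ∀ᶠ w : ℝ × ℝ in 𝓝 (0, y), y₁ < w.2 :=
            continuousAt_snd.eventually (eventually_gt_nhds hgt)
          filter_upwards [this] with w hw
          rw [if_neg hw.not_gt]

/-- Pigeonhole: finitely many short arcs cover the component, and the axis is sampled at one more
point than there are arcs, with step `r`. Two samples lie on one arc; following that arc from the
first sample to the second takes less than `r / 2`, so the second sample is also attained at a
strictly earlier parameter. -/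
theorem exists_axis_eq [T2Space M] {r : ℝ} (hr : 0 < r) {q₀ : M}
    (hq₀ : q₀ ∈ connectedComponentIn S.singularSet q₀)
    (hW : IsCompact (connectedComponentIn S.singularSet q₀))
    (harc : ∀ q ∈ connectedComponentIn S.singularSet q₀, S.HasNormalArc r q) :
    ∃ (Φ : ℝ × ℝ → M) (b y₁ y₂ : ℝ), Φ (0, 0) = q₀ ∧ 0 < b ∧
      (∀ y ∈ Ioo (-r) b, S.IsNormalAt Φ (0, y)) ∧ y₁ ∈ Ioo (-r) b ∧ y₂ ∈ Ioo (-r) b ∧ y₁ < y₂ ∧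
      Φ (0, y₁) = Φ (0, y₂) := by
  set W := connectedComponentIn S.singularSet q₀ with hWdef
  have harc' := harc
  have : Nonempty M := ⟨q₀⟩
  choose! Ψ hΨ0 hΨ using harc
  obtain ⟨T, hTW, hT⟩ := hW.elim_nhds_subcover (fun q => {p | p ∈ S.singularSet →
      ∃ t ∈ Ioo (-(r / 4)) (r / 4), S.IsNormalAt (Ψ q) (0, t) ∧ Ψ q (0, t) = p}) (by
    intro q hq
    have h := (hΨ q hq 0 ⟨by linarith, hr⟩).eventually_mem_image
      (Ioo_mem_nhds (a := -(r / 4)) (b := r / 4) (by linarith) (by linarith))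
    rwa [hΨ0 q hq] at h)
  -- Each extension gains `r / 2`, so this number leaves a margin larger than `r` beyond every
  -- sample `k * r` with `k ≤ T.card`.
  obtain ⟨Φ, h0, hΦ⟩ := exists_extension hr hq₀ harc' (2 * (T.card + 1))
  set b := r + ((2 * (T.card + 1) : ℕ) : ℝ) * (r / 2) with hb
  have hb' : b = r + (T.card + 1) * r := by
    rw [hb]; push_cast; ring
  have hcard : 0 ≤ (T.card : ℝ) * r := by positivity
  have hpt : ∀ k ∈ Finset.range (T.card + 1), (k : ℝ) * r ∈ Ioo (-r) b ∧ (k : ℝ) * r + r < b := by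
    intro k hk
    have hk' : (k : ℝ) ≤ T.card := by exact_mod_cast Nat.lt_succ_iff.1 (Finset.mem_range.1 hk)
    have h1 : 0 ≤ (k : ℝ) * r := by positivity
    have h2 : (k : ℝ) * r ≤ T.card * r := by gcongr
    refine ⟨⟨by linarith, by linarith⟩, by linarith⟩
  have hmem : ∀ k ∈ Finset.range (T.card + 1), ∃ q ∈ T, ∃ t ∈ Ioo (-(r / 4)) (r / 4),
      Ψ q (0, t) = Φ (0, k * r) := by
    intro k hk
    have h1 : Φ (0, k * r) ∈ W := axis_mem_connectedComponentIn isPreconnected_Ioo hΦ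
      (y₀ := 0) ⟨by linarith, by linarith⟩ (by rwa [h0]) (hpt k hk).1
    obtain ⟨q, hq, hqk⟩ := mem_iUnion₂.1 (hT h1)
    obtain ⟨t, ht, -, h⟩ := hqk (connectedComponentIn_subset _ _ h1)
    exact ⟨q, hq, t, ht, h⟩
  choose! Q hQT τ hτ hQτ using hmem
  obtain ⟨k, hk, k', hk', hne, hkk⟩ := Finset.exists_ne_map_eq_of_card_lt_of_maps_to
    (s := Finset.range (T.card + 1)) (t := T) (f := Q) (by simp) hQT
  wlog hlt : k < k' generalizing k k'
  · exact this k' hk' k hk hne.symm hkk.symm (lt_of_le_of_ne (not_lt.1 hlt) hne.symm)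
  have hlt' : (k : ℝ) * r + r ≤ k' * r := by
    have : (k : ℝ) + 1 ≤ k' := by exact_mod_cast hlt
    nlinarith
  have hk0 : 0 ≤ (k : ℝ) * r := by positivity
  have ht := hτ k hk
  have ht' := hτ k' hk'
  have e1 := hQτ k hk
  have e2 := hQτ k' hk'
  rw [← hkk] at e2
  have hΨk := hΨ (Q k) (hTW _ (hQT k hk))
  set t := τ k
  set t' := τ k'
  obtain ⟨s₁, s₂, c, h₁, h₂, hc, H⟩ := (hΦ _ (hpt k hk).1).rigidity
    (hΨk t ⟨by linarith [ht.1], by linarith [ht.2]⟩) e1.symm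
  have hs₂ : |s₂| = 1 := by
    rw [← sq_eq_sq₀ (abs_nonneg _) zero_le_one, sq_abs, h₂, one_pow]
  -- The parameter on `Φ` that corresponds to `t'` on the common arc: the affine change sends `k *
  -- r` to `t`, and `s₂ = ± 1` is its own inverse.
  set y := k * r + s₂ * (t' - t) with hy
  have hyabs : |s₂ * (t' - t)| < r / 2 := by
    rw [abs_mul, hs₂, one_mul, abs_lt]
    constructor <;> linarith [ht.1, ht.2, ht'.1, ht'.2]
  have hyabs' := abs_lt.1 hyabs
  have hyI : y ∈ Ioo (k * r - 3 * r / 4) (k * r + 3 * r / 4) :=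
    ⟨by linarith, by linarith⟩
  -- The radius `3 * r / 4` works because it exceeds `r / 2`, so that `y` is reached, while `|t| < r
  -- / 4` keeps the arc parameter within `(-r, r)`.
  have hev := eventuallyEq_of_isPreconnected (S := S) (Φ := Φ)
    (Ψ := fun w => Ψ (Q k) (s₁ * w.1, s₂ * w.2 + c))
    (isPreconnected_Ioo (a := k * r - 3 * r / 4) (b := k * r + 3 * r / 4))
    (fun u hu => hΦ u ⟨by linarith [hu.1], by linarith [hu.2, (hpt k hk).2]⟩)
    (fun u hu => by
      refine IsNormalAt.comp_affine (z := (0, u)) h₁ h₂ ?_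
      rw [mul_zero]
      refine hΨk _ ?_
      have h3 : |s₂ * (u - k * r)| < 3 * r / 4 := by
        rw [abs_mul, hs₂, one_mul, abs_lt]
        constructor <;> linarith [hu.1, hu.2]
      have h4 := abs_lt.1 h3
      simp only
      constructor <;> linarith [ht.1, ht.2])
    (y₀ := k * r) ⟨by linarith, by linarith⟩ H hyI
  refine ⟨Φ, b, y, k' * r, h0, by linarith, hΦ, ⟨by linarith, by linarith [(hpt k hk).2]⟩,
    (hpt k' hk').1, by linarith, ?_⟩
  rw [hev.eq_of_nhds, ← e2]
  simp only [mul_zero]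
  congr 2
  rw [hy]
  linear_combination hc + (t' - t) * h₂

end TwoARS
end AlmostRiemannian

/-! ### Orientation along the axis and exclusion of reflections -/

namespace AlmostRiemannian

theorem planeArea_map (L : Plane →L[ℝ] Plane) (a b : Plane) :
    planeArea (L a) (L b) = L.det * planeArea a b := by
  have hdet : L.det = planeArea (L (EuclideanSpace.single 0 1)) (L (EuclideanSpace.single 1 1)) := by
    rw [ContinuousLinearMap.det, ← LinearMap.det_toMatrix (EuclideanSpace.basisFun (Fin 2) ℝ).toBasis,
      Matrix.det_fin_two, planeArea_apply]
    simp [LinearMap.toMatrix_apply]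
    ring
  rw [hdet]
  conv_lhs => rw [plane_eq a, plane_eq b]
  simp only [map_add, map_smul, add_apply, smul_apply, planeArea_self, smul_eq_mul, mul_zero]
  rw [planeArea_swap (L (EuclideanSpace.single 1 1)) (L (EuclideanSpace.single 0 1)),
    planeArea_apply a b]
  ring

theorem planeArea_ne_zero_of_injective {L : ℝ × ℝ →L[ℝ] Plane} (hL : Function.Injective L) :
    planeArea (L (1, 0)) (L (0, 1)) ≠ 0 := by
  intro h
  have h1 : L (1, 0) ≠ 0 := fun h0 => by
    have := congrArg Prod.fst (hL (h0.trans (map_zero L).symm))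
    simp at this
  obtain ⟨k, hk⟩ := exists_smul_of_planeArea_eq_zero h1 h
  rw [← map_smul] at hk
  have := congrArg Prod.snd (hL hk)
  simp at this

section Orientation

variable {M : Type*}

/-- The Jacobian determinant of the map `Φ` read in the chart `e`. -/
noncomputable def chartArea (e : M → Plane) (Φ : ℝ × ℝ → M) (z : ℝ × ℝ) : ℝ :=
  planeArea (fderiv ℝ (fun w => e (Φ w)) z (1, 0)) (fderiv ℝ (fun w => e (Φ w)) z (0, 1))

theorem chartArea_comp_affine {e : M → Plane} {Φ : ℝ × ℝ → M} {z : ℝ × ℝ} (s₁ s₂ c : ℝ)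
    (h : DifferentiableAt ℝ (fun w => e (Φ w)) (s₁ * z.1, s₂ * z.2 + c)) :
    chartArea e (fun w => Φ (s₁ * w.1, s₂ * w.2 + c)) z =
      s₁ * s₂ * chartArea e Φ (s₁ * z.1, s₂ * z.2 + c) := by
  have h2 : HasFDerivAt (fun w : ℝ × ℝ => (s₁ * w.1, s₂ * w.2 + c))
      ((s₁ • ContinuousLinearMap.fst ℝ ℝ ℝ).prod (s₂ • ContinuousLinearMap.snd ℝ ℝ ℝ)) z :=
    ((hasFDerivAt_fst (p := z)).const_smul s₁).prodMk
      (((hasFDerivAt_snd (p := z)).const_smul s₂).add_const c)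
  have h3 := (h.hasFDerivAt.comp z h2).fderiv
  have h4 : ∀ v : ℝ × ℝ, fderiv ℝ (fun w => e (Φ (s₁ * w.1, s₂ * w.2 + c))) z v =
      fderiv ℝ (fun w => e (Φ w)) (s₁ * z.1, s₂ * z.2 + c) (s₁ * v.1, s₂ * v.2) := fun v =>
    congrArg (fun L : ℝ × ℝ →L[ℝ] Plane => L v) h3
  rw [chartArea, h4, h4, chartArea,
    show (s₁ * ((1 : ℝ), (0 : ℝ)).1, s₂ * ((1 : ℝ), (0 : ℝ)).2) = s₁ • ((1 : ℝ), (0 : ℝ)) by simp,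
    show (s₁ * ((0 : ℝ), (1 : ℝ)).1, s₂ * ((0 : ℝ), (1 : ℝ)).2) = s₂ • ((0 : ℝ), (1 : ℝ)) by simp]
  simp only [map_smul, smul_apply, smul_eq_mul]
  ring

theorem chartArea_congr {e : M → Plane} {Φ Ψ : ℝ × ℝ → M} {z : ℝ × ℝ} (h : Φ =ᶠ[𝓝 z] Ψ) :
    chartArea e Φ z = chartArea e Ψ z := by
  have : (fun w => e (Φ w)) =ᶠ[𝓝 z] fun w => e (Ψ w) := h.fun_comp e
  rw [chartArea, chartArea, this.fderiv_eq]

end Orientation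

variable {M : Type*} [TopologicalSpace M] [ChartedSpace Plane M] [IsManifold (𝓡 2) ∞ M]
  {F : Type*} [NormedAddCommGroup F] [NormedSpace ℝ F]
  {E : M → Type*} [TopologicalSpace (TotalSpace F E)]
  [∀ q, TopologicalSpace (E q)] [∀ q, AddCommGroup (E q)] [∀ q, Module ℝ (E q)]
  [∀ q, IsTopologicalAddGroup (E q)] [∀ q, ContinuousConstSMul ℝ (E q)]
  [FiberBundle F E] [VectorBundle ℝ F E] [ContMDiffVectorBundle ∞ F E (𝓡 2)]
  {S : TwoARS M F E} {Φ Ψ : ℝ × ℝ → M}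

namespace TwoARS.IsNormalAt

theorem contDiffAt_chart {z : ℝ × ℝ} (h : S.IsNormalAt Φ z) {e : OpenPartialHomeomorph M Plane}
    (he : e ∈ IsManifold.maximalAtlas (𝓡 2) ∞ M) (hz : Φ z ∈ e.source) :
    ContDiffAt ℝ ∞ (fun w => e (Φ w)) z := by
  obtain ⟨e₀, σ₁, σ₂, φ, -, hz₀, hΦ⟩ := h
  have h1 : ContMDiffAt 𝓘(ℝ, ℝ × ℝ) (𝓡 2) ∞ Φ z :=
    (e₀.contMDiffOn_toFun.contMDiffAt (e₀.open_source.mem_nhds hz₀)).congr_of_eventuallyEq hΦ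
  exact contMDiffAt_iff_contDiffAt.1 ((contMDiffAt_of_mem_maximalAtlas he hz).comp z h1)

theorem chartArea_ne_zero {z : ℝ × ℝ} (h : S.IsNormalAt Φ z) {e : OpenPartialHomeomorph M Plane}
    (he : e ∈ IsManifold.maximalAtlas (𝓡 2) ∞ M) (hz : Φ z ∈ e.source) :
    chartArea e Φ z ≠ 0 := by
  have hd := (h.contDiffAt_chart he hz).differentiableAt (by simp)
  have hcont := h.continuousAt
  obtain ⟨e₀, σ₁, σ₂, φ, -, hz₀, hΦ⟩ := h
  have hz₀' : e₀ z ∈ e₀.target := e₀.map_source hz₀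
  have hg : DifferentiableAt ℝ (fun y => e₀.symm (e.symm y)) (e (Φ z)) := by
    have h1 : ContMDiffAt (𝓡 2) 𝓘(ℝ, ℝ × ℝ) ∞ e₀.symm (e.symm (e (Φ z))) := by
      rw [e.left_inv hz, hΦ.self_of_nhds]
      exact e₀.contMDiffOn_invFun.contMDiffAt (e₀.open_target.mem_nhds hz₀')
    have h2 : ContMDiffAt 𝓘(ℝ, Plane) 𝓘(ℝ, ℝ × ℝ) ∞ (fun y => e₀.symm (e.symm y)) (e (Φ z)) :=
      h1.comp _ (contMDiffAt_symm_of_mem_maximalAtlas he (e.map_source hz))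
    exact (contMDiffAt_iff_contDiffAt.1 h2).differentiableAt (by simp)
  have hid : (fun w => e₀.symm (e.symm (e (Φ w)))) =ᶠ[𝓝 z] fun w => w := by
    filter_upwards [hΦ, e₀.open_source.mem_nhds hz₀,
      hcont.eventually (e.open_source.mem_nhds hz)] with w h1 h2 h3
    rw [e.left_inv h3, h1]
    exact e₀.left_inv h2
  have hid' : HasFDerivAt (fun w => e₀.symm (e.symm (e (Φ w)))) (ContinuousLinearMap.id ℝ _) z :=
    (hasFDerivAt_id z).congr_of_eventuallyEq hid
  have hd' := hg.hasFDerivAt.comp z hd.hasFDerivAt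
  have hcomp := HasFDerivAt.unique (f := fun w => e₀.symm (e.symm (e (Φ w)))) hd' hid'
  refine planeArea_ne_zero_of_injective fun u v huv => ?_
  have h1 := congrArg (fun L : ℝ × ℝ →L[ℝ] ℝ × ℝ => L u) hcomp
  have h2 := congrArg (fun L : ℝ × ℝ →L[ℝ] ℝ × ℝ => L v) hcomp
  simp only [ContinuousLinearMap.comp_apply, ContinuousLinearMap.id_apply] at h1 h2
  rw [← h1, ← h2, huv]

theorem chartArea_pos {z : ℝ × ℝ} (h : S.IsNormalAt Φ z) {e e' : OpenPartialHomeomorph M Plane}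
    (he : e ∈ IsManifold.maximalAtlas (𝓡 2) ∞ M) (he' : e' ∈ IsManifold.maximalAtlas (𝓡 2) ∞ M)
    (hpos : ∀ x ∈ (e.symm.trans e').source, 0 < (fderiv ℝ (e.symm.trans e') x).det)
    (hz : Φ z ∈ e.source) (hz' : Φ z ∈ e'.source) (ha : 0 < chartArea e Φ z) :
    0 < chartArea e' Φ z := by
  have hd := (h.contDiffAt_chart he hz).differentiableAt (by simp)
  have hg : DifferentiableAt ℝ (e.symm.trans e') (e (Φ z)) := by
    have h1 : ContMDiffAt (𝓡 2) 𝓘(ℝ, Plane) ∞ e' (e.symm (e (Φ z))) := by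
      rw [e.left_inv hz]
      exact contMDiffAt_of_mem_maximalAtlas he' hz'
    have h2 : ContMDiffAt 𝓘(ℝ, Plane) 𝓘(ℝ, Plane) ∞ (e.symm.trans e') (e (Φ z)) :=
      h1.comp _ (contMDiffAt_symm_of_mem_maximalAtlas he (e.map_source hz))
    exact (contMDiffAt_iff_contDiffAt.1 h2).differentiableAt (by simp)
  have heq : (fun w => e' (Φ w)) =ᶠ[𝓝 z] fun w => (e.symm.trans e') (e (Φ w)) := by
    filter_upwards [h.continuousAt.eventually (e.open_source.mem_nhds hz)] with w hw
    simp [e.left_inv hw]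
  have hcomp := ((hg.hasFDerivAt.comp z hd.hasFDerivAt).congr_of_eventuallyEq heq).fderiv
  rw [chartArea, hcomp, ContinuousLinearMap.comp_apply, ContinuousLinearMap.comp_apply,
    planeArea_map]
  refine mul_pos (hpos _ ?_) ha
  rw [OpenPartialHomeomorph.trans_source, OpenPartialHomeomorph.symm_source]
  exact ⟨e.map_source hz, by rwa [mem_preimage, e.left_inv hz]⟩

theorem continuousAt_chartArea {y : ℝ} (h : S.IsNormalAt Φ (0, y))
    {e : OpenPartialHomeomorph M Plane} (he : e ∈ IsManifold.maximalAtlas (𝓡 2) ∞ M)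
    (hz : Φ (0, y) ∈ e.source) : ContinuousAt (fun t => chartArea e Φ (0, t)) y := by
  have h1 : ContDiffAt ℝ ∞ (fderiv ℝ (fun w => e (Φ w))) (0, y) :=
    (h.contDiffAt_chart he hz).fderiv_right (by simp)
  have h2 : ContinuousAt (fun t : ℝ => fderiv ℝ (fun w => e (Φ w)) ((0 : ℝ), t)) y :=
    ContinuousAt.comp (f := fun t : ℝ => ((0 : ℝ), t)) h1.continuousAt (tendsto_axis y)
  exact (planeArea.continuous.continuousAt.comp (h2.clm_apply continuousAt_const)).clm_apply
    (h2.clm_apply continuousAt_const)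

end TwoARS.IsNormalAt

namespace TwoARS

/-- In the charts of an oriented atlas the sign of the Jacobian does not depend on the chart. As it
is continuous and nonzero along the axis, the set where it is positive is open and relatively
closed. -/
theorem chartArea_pos_of_isPreconnected {I : Set ℝ} (hIo : IsOpen I) (hI : IsPreconnected I)
    (hΦ : ∀ y ∈ I, S.IsNormalAt Φ (0, y)) {A : Set (OpenPartialHomeomorph M Plane)}
    (hA : A ⊆ IsManifold.maximalAtlas (𝓡 2) ∞ M) (hcov : ∀ q : M, ∃ e ∈ A, q ∈ e.source)
    (hpos : ∀ e ∈ A, ∀ e' ∈ A, ∀ x ∈ (e.symm.trans e').source,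
      0 < (fderiv ℝ (e.symm.trans e') x).det) {e e' : OpenPartialHomeomorph M Plane} (he : e ∈ A)
    (he' : e' ∈ A) {y y' : ℝ} (hy : y ∈ I) (hy' : y' ∈ I) (hye : Φ (0, y) ∈ e.source)
    (hye' : Φ (0, y') ∈ e'.source) (h : 0 < chartArea e Φ (0, y)) :
    0 < chartArea e' Φ (0, y') := by
  set u : Set ℝ := {t | t ∈ I ∧ ∃ e ∈ A, Φ (0, t) ∈ e.source ∧ 0 < chartArea e Φ (0, t)} with hu
  have huo : IsOpen u := by
    refine isOpen_iff_eventually.2 ?_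
    rintro t ⟨htI, e, he, hte, ht⟩
    filter_upwards [hIo.mem_nhds htI, ((hΦ t htI).continuousAt_chartArea (hA he)
      hte).eventually (lt_mem_nhds ht), (hΦ t htI).continuousAt_axis.eventually
      (e.open_source.mem_nhds hte)] with s h1 h2 h3
    exact ⟨h1, e, he, h3, h2⟩
  obtain ⟨-, e'', he'', hye'', h''⟩ := hI.subset_of_closure_inter_subset huo
    ⟨y, hy, hy, e, he, hye, h⟩ (by
      rintro t ⟨htc, htI⟩
      obtain ⟨e, he, hte⟩ := hcov (Φ (0, t))
      refine ⟨htI, e, he, hte, ?_⟩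
      by_contra hneg
      have hneg' := lt_of_le_of_ne (not_lt.1 hneg) ((hΦ t htI).chartArea_ne_zero (hA he) hte)
      obtain ⟨s, ⟨hsI, e₁, he₁, hse₁, hs⟩, hs2, hs3⟩ := ((mem_closure_iff_frequently.1
        htc).and_eventually ((((hΦ t htI).continuousAt_chartArea (hA he)
        hte).eventually (gt_mem_nhds hneg')).and ((hΦ t htI).continuousAt_axis.eventually
        (e.open_source.mem_nhds hte)))).exists
      exact lt_asymm hs2 ((hΦ s hsI).chartArea_pos (hA he₁) (hA he) (hpos _ he₁ _ he) hse₁ hs3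
        hs)) hy'
  exact (hΦ y' hy').chartArea_pos (hA he'') (hA he') (hpos _ he'' _ he') hye'' hye' h''

/-- If the axis of a normal parametrization of an orientable surface comes back to a point, the
parametrization is locally periodic. -/
theorem eventuallyEq_translate [T2Space M] (hM : IsOrientable M) {a b : ℝ}
    (hΦ : ∀ y ∈ Ioo a b, S.IsNormalAt Φ (0, y)) {y₁ y₂ : ℝ} (hy₁ : y₁ ∈ Ioo a b)
    (hy₂ : y₂ ∈ Ioo a b) (hlt : y₁ < y₂) (heq : Φ (0, y₁) = Φ (0, y₂)) :
    Φ =ᶠ[𝓝 (0, y₁)] fun w => Φ (w.1, w.2 + (y₂ - y₁)) := by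
  obtain ⟨s₁, s₂, c, h₁, h₂, hc, H⟩ := (hΦ y₁ hy₁).rigidity (hΦ y₂ hy₂) heq
  -- If `s₂ = -1`, the symmetry reflects the axis about the midpoint of `y₁` and `y₂`. Continued up
  -- to that midpoint, it would be a nontrivial affine map preserving the germ of `Φ` there.
  have hs₂ : s₂ = 1 := by
    rcases sq_eq_sq_iff_eq_or_eq_neg.1 (h₂.trans (one_pow 2).symm) with rfl | rfl
    · rfl
    · exfalso
      have hcc : c = y₁ + y₂ := by linarith
      -- This interval is the intersection of `(a, b)` with its mirror image, so both germs are
      -- normal along it.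
      have hm : (y₁ + y₂) / 2 ∈ Ioo (max a (y₁ + y₂ - b)) (min b (y₁ + y₂ - a)) := by
        constructor
        · rw [max_lt_iff]
          constructor <;> linarith [hy₁.1, hy₂.2]
        · rw [lt_min_iff]
          constructor <;> linarith [hy₁.1, hy₂.2]
      have hev : ∀ t ∈ Ioo (max a (y₁ + y₂ - b)) (min b (y₁ + y₂ - a)),
          Φ =ᶠ[𝓝 (0, t)] fun w => Φ (s₁ * w.1, -1 * w.2 + c) := by
        intro t ht
        refine eventuallyEq_of_isPreconnected (S := S) isPreconnected_Ioo ?_ ?_ (y₀ := y₁) ?_ H ht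
        · intro u hu
          exact hΦ u ⟨(max_lt_iff.1 hu.1).1, (lt_min_iff.1 hu.2).1⟩
        · intro u hu
          refine IsNormalAt.comp_affine (z := (0, u)) h₁ h₂ ?_
          rw [mul_zero]
          refine hΦ _ ⟨?_, ?_⟩ <;> simp only
          · linarith [(lt_min_iff.1 hu.2).2]
          · linarith [(max_lt_iff.1 hu.1).2]
        · exact ⟨max_lt_iff.2 ⟨hy₁.1, by linarith [hy₂.2]⟩,
            lt_min_iff.2 ⟨hy₁.2, by linarith [hy₂.1]⟩⟩
      have hmI : (y₁ + y₂) / 2 ∈ Ioo a b := ⟨by linarith [hy₁.1], by linarith [hy₂.2]⟩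
      have := ((hΦ _ hmI).eq_id_of_eventually (s₁ := s₁) (s₂ := -1) (c := c) (by rw [hcc]; ring)
        (Eventually.frequently (by
          filter_upwards [isOpen_Ioo.mem_nhds hm] with t ht
          exact (hev t ht).symm))).2.1
      norm_num at this
  subst hs₂
  have hcc : c = y₂ - y₁ := by linarith
  -- Reversing `x` while preserving the direction of `y` would give Jacobians of opposite signs at
  -- `y₁` and `y₂` in the same oriented chart.
  have hs₁ : s₁ = 1 := by
    rcases sq_eq_sq_iff_eq_or_eq_neg.1 (h₁.trans (one_pow 2).symm) with rfl | rfl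
    · rfl
    · exfalso
      obtain ⟨A, hA, hcov, hpos⟩ := hM
      obtain ⟨e, he, hye⟩ := hcov (Φ (0, y₁))
      have hye' : Φ (0, y₂) ∈ e.source := by rwa [← heq]
      have hz : (-1 * ((0 : ℝ), y₁).1, 1 * ((0 : ℝ), y₁).2 + c) = ((0 : ℝ), y₂) := by
        rw [hcc]; ext <;> simp
      have hflip := chartArea_comp_affine (e := e) (Φ := Φ) (z := (0, y₁)) (-1) 1 c (by
        rw [hz]
        exact ((hΦ y₂ hy₂).contDiffAt_chart (hA he) hye').differentiableAt (by simp))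
      rw [← chartArea_congr H, hz] at hflip
      have hsign := fun {y y'} => chartArea_pos_of_isPreconnected (y := y) (y' := y') isOpen_Ioo
        isPreconnected_Ioo hΦ hA hcov hpos he he
      rcases lt_or_gt_of_ne ((hΦ y₁ hy₁).chartArea_ne_zero (hA he) hye) with h | h
      · have := hsign hy₂ hy₁ hye' hye (by linarith)
        linarith
      · have := hsign hy₁ hy₂ hye hye' h
        linarith
  subst hs₁
  rw [← hcc]
  filter_upwards [H] with w hw
  simpa using hw

end TwoARS
end AlmostRiemannian

/-! ### The minimal period and periodization -/

namespace AlmostRiemannian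

variable {M : Type*} [TopologicalSpace M] [ChartedSpace Plane M] [IsManifold (𝓡 2) ∞ M]
  {F : Type*} [NormedAddCommGroup F] [NormedSpace ℝ F]
  {E : M → Type*} [TopologicalSpace (TotalSpace F E)]
  [∀ q, TopologicalSpace (E q)] [∀ q, AddCommGroup (E q)] [∀ q, Module ℝ (E q)]
  [∀ q, IsTopologicalAddGroup (E q)] [∀ q, ContinuousConstSMul ℝ (E q)]
  [FiberBundle F E] [VectorBundle ℝ F E] [ContMDiffVectorBundle ∞ F E (𝓡 2)]
  {S : TwoARS M F E} {Φ Ψ : ℝ × ℝ → M}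

namespace TwoARS

/-- Returns to the base point occur no sooner than some `δ` by local injectivity, and they form a
closed set, so there is a first one. A coincidence inside one period would continue back to `y₁` and
produce an earlier return. -/
theorem exists_minimal_period [T2Space M] (hM : IsOrientable M) {a b : ℝ}
    (hΦ : ∀ y ∈ Ioo a b, S.IsNormalAt Φ (0, y)) {y₁ y₂ : ℝ} (hy₁ : y₁ ∈ Ioo a b)
    (hy₂ : y₂ ∈ Ioo a b) (hlt : y₁ < y₂) (heq : Φ (0, y₁) = Φ (0, y₂)) :
    ∃ T > 0, y₁ + T ∈ Ioo a b ∧ InjOn (fun t => Φ (0, t)) (Ico y₁ (y₁ + T)) ∧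
      Φ =ᶠ[𝓝 (0, y₁)] fun w => Φ (w.1, w.2 + T) := by
  obtain ⟨N, hN, hinj⟩ := (hΦ y₁ hy₁).exists_injOn
  obtain ⟨δ, hδ, hδN⟩ := Metric.eventually_nhds_iff.1 ((tendsto_axis y₁).eventually hN)
  have hne : ∀ t, y₁ < t → t < y₁ + δ → Φ (0, t) ≠ Φ (0, y₁) := by
    intro t h1 h2 h
    have h3 : dist t y₁ < δ := by rw [Real.dist_eq, abs_of_pos (by linarith)]; linarith
    have := congrArg Prod.snd (hinj (hδN h3) (hδN (by simpa using hδ)) h)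
    exact h1.ne' this
  have hge : ∀ t, y₁ < t → Φ (0, t) = Φ (0, y₁) → y₁ + δ ≤ t := fun t h1 h2 => by
    by_contra h
    exact hne t h1 (not_le.1 h) h2
  have hK : IsCompact (Icc (y₁ + δ) y₂ ∩ (fun t => Φ (0, t)) ⁻¹' {Φ (0, y₁)}) := by
    refine isCompact_Icc.of_isClosed_subset ?_ inter_subset_left
    refine ContinuousOn.preimage_isClosed_of_isClosed (fun t ht => ?_) isClosed_Icc
      isClosed_singleton
    exact (hΦ t ⟨by linarith [ht.1, hy₁.1], by linarith [ht.2, hy₂.2]⟩).continuousAt_axis.continuousWithinAt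
  obtain ⟨y₃, ⟨hy₃, hy₃'⟩, hleast⟩ := hK.exists_isLeast
    ⟨y₂, ⟨hge y₂ hlt heq.symm, le_rfl⟩, heq.symm⟩
  have hy₃I : y₃ ∈ Ioo a b := ⟨by linarith [hy₃.1, hy₁.1], by linarith [hy₃.2, hy₂.2]⟩
  have hlt₃ : y₁ < y₃ := by linarith [hy₃.1]
  refine ⟨y₃ - y₁, by linarith, by rwa [add_sub_cancel], ?_,
    eventuallyEq_translate hM hΦ hy₁ hy₃I hlt₃ (Eq.symm hy₃')⟩
  rw [add_sub_cancel]
  intro t ht t' ht' htt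
  by_contra hne'
  wlog hlt' : t < t' generalizing t t'
  · exact this ht' ht htt.symm (Ne.symm hne') (lt_of_le_of_ne (not_lt.1 hlt') (Ne.symm hne'))
  have htI : t ∈ Ioo a b := ⟨by linarith [ht.1, hy₁.1], by linarith [ht.2, hy₃I.2]⟩
  have htI' : t' ∈ Ioo a b := ⟨by linarith [ht'.1, hy₁.1], by linarith [ht'.2, hy₃I.2]⟩
  -- Invariance under the translation by `t' - t` holds near `t`; it is propagated down to `y₁` by
  -- unique continuation.
  have h1 := eventuallyEq_translate hM hΦ htI htI' hlt' htt
  have h2 := eventuallyEq_of_isPreconnected (S := S) (isPreconnected_Ioo (a := a)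
    (b := b - (t' - t))) (fun u hu => hΦ u ⟨hu.1, by linarith [hu.2]⟩)
    (fun u hu => (hΦ (u + (t' - t)) ⟨by linarith [hu.1], by linarith [hu.2]⟩).translate)
    (y₀ := t) ⟨htI.1, by linarith [htI'.2]⟩ h1 (y := y₁) ⟨hy₁.1, by linarith [ht.1, htI'.2]⟩
  have h3 := h2.eq_of_nhds
  simp only at h3
  have h4 : y₁ + (t' - t) < y₃ := by linarith [ht.1, ht'.2]
  have h5 := hleast ⟨⟨hge _ (by linarith) h3.symm, by linarith [hy₃.2]⟩, h3.symm⟩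
  linarith

/-- Periodization of a parametrization which is locally periodic. -/
theorem exists_periodic_of_eventuallyEq {T a b : ℝ} (hT : 0 < T) (ha : a < 0) (hb : T < b)
    (hΦ : ∀ y ∈ Ioo a b, S.IsNormalAt Φ (0, y)) (hinj : InjOn (fun t => Φ (0, t)) (Ico 0 T))
    (hper : Φ =ᶠ[𝓝 (0, 0)] fun w => Φ (w.1, w.2 + T)) :
    ∃ Ψ : ℝ × ℝ → M, Ψ (0, 0) = Φ (0, 0) ∧ (∀ x y, Ψ (x, y + T) = Ψ (x, y)) ∧
      (∀ y, S.IsNormalAt Ψ (0, y)) ∧ ∀ y y', Ψ (0, y) = Ψ (0, y') → ∃ k : ℤ, y' = y + k * T := by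
  refine ⟨fun w => Φ (w.1, toIcoMod hT 0 w.2), ?_, fun x y => ?_, fun y => ?_, fun y y' h => ?_⟩
  · simp only
    rw [(toIcoMod_eq_iff hT).2 ⟨⟨le_rfl, by linarith⟩, 0, by simp⟩]
  · simp only [toIcoMod_add_right]
  · set m := toIcoMod hT 0 y with hm
    have hmI : m ∈ Ico 0 (0 + T) := toIcoMod_mem_Ico hT 0 y
    rw [zero_add] at hmI
    set k := toIcoDiv hT 0 y with hk
    have hy : m + k • T = y := toIcoMod_add_toIcoDiv_zsmul hT 0 y
    have hn : S.IsNormalAt (fun w => Φ (w.1, w.2 + (m - y))) (0, y) := by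
      refine IsNormalAt.translate (hΦ _ ⟨?_, ?_⟩) <;> linarith [hmI.1, hmI.2]
    refine hn.congr ?_
    have hc : Tendsto (fun w : ℝ × ℝ => (w.1, w.2 + (m - y))) (𝓝 (0, y)) (𝓝 (0, m)) := by
      have : ContinuousAt (fun w : ℝ × ℝ => (w.1, w.2 + (m - y))) (0, y) := by fun_prop
      simpa [ContinuousAt] using this
    have hlt : ∀ᶠ w : ℝ × ℝ in 𝓝 (0, m), w.2 < T :=
      continuousAt_snd.eventually (eventually_lt_nhds hmI.2)
    have hval : ∀ w : ℝ × ℝ, 0 ≤ w.2 + (m - y) → w.2 + (m - y) < T →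
        toIcoMod hT 0 w.2 = w.2 + (m - y) := fun w h1 h2 =>
      (toIcoMod_eq_iff hT).2 ⟨⟨h1, by rwa [zero_add]⟩, k, by linarith⟩
    -- At a multiple of the period the periodized map is read near `0` on one side and near `T` on
    -- the other; `hper` says that the two germs agree. Elsewhere it is locally a translate of `Φ`.
    rcases hmI.1.eq_or_lt with h0 | hpos
    · have hgt : ∀ᶠ w : ℝ × ℝ in 𝓝 (0, m), -T < w.2 :=
        continuousAt_snd.eventually (eventually_gt_nhds (by linarith [hmI.1]))
      have hper' : Φ =ᶠ[𝓝 (0, m)] fun w => Φ (w.1, w.2 + T) := by rwa [← h0]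
      filter_upwards [hc.eventually hlt, hc.eventually hgt, hc.eventually hper'] with w h1 h2 h3
      by_cases h4 : 0 ≤ w.2 + (m - y)
      · rw [hval w h4 h1]
      · rw [h3, (toIcoMod_eq_iff hT (c := w.2 + (m - y) + T)).2
          ⟨⟨by linarith, by linarith [not_le.1 h4]⟩, k - 1, ?_⟩]
        rw [sub_smul, one_smul]
        linarith
    · have hgt : ∀ᶠ w : ℝ × ℝ in 𝓝 (0, m), 0 < w.2 :=
        continuousAt_snd.eventually (eventually_gt_nhds hpos)
      filter_upwards [hc.eventually hlt, hc.eventually hgt] with w h1 h2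
      rw [hval w h2.le h1]
  · have h1 := toIcoMod_mem_Ico hT 0 y
    have h2 := toIcoMod_mem_Ico hT 0 y'
    rw [zero_add] at h1 h2
    have h3 := hinj h1 h2 h
    have h4 := toIcoMod_add_toIcoDiv_zsmul hT 0 y
    have h5 := toIcoMod_add_toIcoDiv_zsmul hT 0 y'
    refine ⟨toIcoDiv hT 0 y' - toIcoDiv hT 0 y, ?_⟩
    rw [zsmul_eq_mul] at h4 h5
    push_cast
    linarith

theorem isClosed_connectedComponentIn {X : Type*} [TopologicalSpace X] {A : Set X}
    (hA : IsClosed A) (x : X) : IsClosed (connectedComponentIn A x) := by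
  by_cases hx : x ∈ A
  · refine isClosed_of_closure_subset ?_
    exact isPreconnected_connectedComponentIn.closure.subset_connectedComponentIn
      (subset_closure (mem_connectedComponentIn hx))
      (closure_minimal (connectedComponentIn_subset A x) hA)
  · rw [connectedComponentIn_eq_empty hx]
    exact isClosed_empty

/-- Prolongation, return and first return time are combined; the parameter is shifted by `y₁` so
that the fundamental interval starts at `0`. -/
theorem exists_periodic_normal [T2Space M] [CompactSpace M] (hM : IsOrientable M)
    (h3 : ∀ q, S.flagAt 3 q = ⊤) {q₀ : M} (hq₀ : q₀ ∈ S.singularSet)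
    (hT : ∀ q ∈ connectedComponentIn S.singularSet q₀, ¬ S.IsTangencyPoint q) :
    ∃ T > 0, ∃ Φ : ℝ × ℝ → M, Φ (0, 0) ∈ connectedComponentIn S.singularSet q₀ ∧
      (∀ x y, Φ (x, y + T) = Φ (x, y)) ∧ (∀ y, S.IsNormalAt Φ (0, y)) ∧
      ∀ y y', Φ (0, y) = Φ (0, y') → ∃ k : ℤ, y' = y + k * T := by
  have hW : IsCompact (connectedComponentIn S.singularSet q₀) :=
    (isClosed_connectedComponentIn S.isClosed_singularSet q₀).isCompact
  have hmem := mem_connectedComponentIn hq₀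
  obtain ⟨r, hr, harc⟩ := exists_hasNormalArc_of_isCompact hW
    (connectedComponentIn_subset _ _) (fun q _ => h3 q) hT
  obtain ⟨Φ, b, y₁, y₂, h0, hb, hΦ, hy₁, hy₂, hlt, heq⟩ := exists_axis_eq hr hmem hW harc
  obtain ⟨T, hTpos, hTI, hinj, hper⟩ := exists_minimal_period hM hΦ hy₁ hy₂ hlt heq
  obtain ⟨Ψ, hΨ0, H⟩ := exists_periodic_of_eventuallyEq (S := S)
    (Φ := fun w => Φ (w.1, w.2 + y₁)) (T := T) (a := -r - y₁) (b := b - y₁) hTpos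
    (by linarith [hy₁.1]) (by linarith [hTI.2])
    (fun y hy => (hΦ (y + y₁) ⟨by linarith [hy.1], by linarith [hy.2]⟩).translate)
    (fun t ht t' ht' h => by
      have := hinj (x₁ := t + y₁) (x₂ := t' + y₁) ⟨by linarith [ht.1], by linarith [ht.2]⟩
        ⟨by linarith [ht'.1], by linarith [ht'.2]⟩ h
      linarith)
    (by
      have hc : Tendsto (fun w : ℝ × ℝ => (w.1, w.2 + y₁)) (𝓝 (0, 0)) (𝓝 (0, y₁)) := by
        have : ContinuousAt (fun w : ℝ × ℝ => (w.1, w.2 + y₁)) (0, 0) := by fun_prop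
        simpa [ContinuousAt] using this
      filter_upwards [hc.eventually hper] with w hw
      rw [hw, add_right_comm])
  refine ⟨T, hTpos, Ψ, ?_, H⟩
  rw [hΨ0]
  simp only [zero_add]
  exact axis_mem_connectedComponentIn isPreconnected_Ioo hΦ (y₀ := 0) ⟨by linarith, hb⟩
    (by rwa [h0]) hy₁

end TwoARS
end AlmostRiemannian

/-! ### Angular coordinates and injective local diffeomorphisms -/

namespace AlmostRiemannian

/-- The determination of the angle of a point of the circle which lies within `π` of `θ`. -/
noncomputable def arcAngle (θ : ℝ) (z : Circle) : ℝ :=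
  θ + Complex.arg ((z * Circle.exp (-θ) : Circle) : ℂ)

theorem exp_arcAngle (θ : ℝ) (z : Circle) : Circle.exp (arcAngle θ z) = z := by
  rw [arcAngle, Circle.exp_add, Circle.exp_arg, mul_comm z, ← mul_assoc, ← Circle.exp_add,
    add_neg_cancel, Circle.exp_zero, one_mul]

theorem arcAngle_exp {θ t : ℝ} (h : |t - θ| < Real.pi) : arcAngle θ (Circle.exp t) = t := by
  obtain ⟨h1, h2⟩ := abs_lt.1 h
  rw [arcAngle, ← Circle.exp_add, Circle.arg_exp (by linarith) (by linarith)]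
  ring

theorem exp_mem_slitPlane {t : ℝ} (h : |t| < Real.pi) :
    ((Circle.exp t : Circle) : ℂ) ∈ Complex.slitPlane := by
  obtain ⟨h1, h2⟩ := abs_lt.1 h
  rw [Complex.mem_slitPlane_iff_arg, Circle.arg_exp h1 h2.le]
  exact ⟨h2.ne, Circle.coe_ne_zero _⟩

theorem contMDiffAt_arcAngle {θ : ℝ} {z : Circle}
    (hz : ((z * Circle.exp (-θ) : Circle) : ℂ) ∈ Complex.slitPlane) :
    ContMDiffAt (𝓡 1) 𝓘(ℝ, ℝ) ∞ (arcAngle θ) z := by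
  have : Fact (Module.finrank ℝ ℂ = 1 + 1) := Complex.finrank_real_complex_fact
  have h1 : ContMDiff (𝓡 1) (𝓡 1) ∞ (fun z : Circle => z * Circle.exp (-θ)) :=
    (contMDiff_mul_right (I := 𝓡 1) (n := ω)).of_le le_top
  have h2 : ContMDiff (𝓡 1) 𝓘(ℝ, ℂ) ∞ (fun z : Circle => (z : ℂ)) := contMDiff_coe_sphere
  have h3 : ContDiffAt ℝ ∞ (fun w : ℂ => θ + (Complex.log w).im)
      ((z * Circle.exp (-θ) : Circle) : ℂ) :=
    contDiffAt_const.add (Complex.imCLM.contDiff.contDiffAt.comp _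
      ((Complex.contDiffAt_log hz).restrict_scalars ℝ))
  have h4 := h3.contMDiffAt.comp z ((h2.comp h1).contMDiffAt (x := z))
  refine h4.congr_of_eventuallyEq (Eventually.of_forall fun w => ?_)
  change θ + Complex.arg _ = θ + (Complex.log _).im
  rw [Complex.log_im]
  rfl

/-- The angular coordinate `λ y` on the complement of an angle in `ℝ × S¹`. -/
noncomputable def circleChart (l θ : ℝ) (hl : l ≠ 0) :
    PartialDiffeomorph (𝓘(ℝ, ℝ).prod (𝓡 1)) 𝓘(ℝ, ℝ × ℝ) (ℝ × Circle) (ℝ × ℝ) ∞ where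
  toFun p := (p.1, l * arcAngle θ p.2)
  invFun w := (w.1, Circle.exp (w.2 / l))
  source := {p | ((p.2 * Circle.exp (-θ) : Circle) : ℂ) ∈ Complex.slitPlane}
  target := {w | |w.2 / l - θ| < Real.pi}
  map_source' p hp := by
    have h := Complex.mem_slitPlane_iff_arg.1 hp
    have h1 : l * arcAngle θ p.2 / l - θ = Complex.arg ((p.2 * Circle.exp (-θ) : Circle) : ℂ) := by
      rw [mul_div_cancel_left₀ _ hl, arcAngle, add_sub_cancel_left]
    rw [mem_ofPred_eq, h1, abs_lt]
    exact ⟨Complex.neg_pi_lt_arg _, lt_of_le_of_ne (Complex.arg_le_pi _) h.1⟩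
  map_target' w hw := by
    rw [mem_ofPred_eq, ← Circle.exp_add]
    exact exp_mem_slitPlane hw
  left_inv' p _ := by
    simp only [mul_div_cancel_left₀ _ hl, exp_arcAngle]
  right_inv' w hw := by
    simp only [arcAngle_exp hw, mul_div_cancel₀ _ hl]
  open_source := Complex.isOpen_slitPlane.preimage (by fun_prop)
  open_target := isOpen_lt (by fun_prop) continuous_const
  contMDiffOn_toFun p hp := by
    have h : ContMDiffAt (𝓘(ℝ, ℝ).prod (𝓡 1)) 𝓘(ℝ, ℝ) ∞
        (fun p : ℝ × Circle => l * arcAngle θ p.2) p :=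
      contMDiffAt_const.mul ((contMDiffAt_arcAngle hp).comp p contMDiffAt_snd)
    exact (contMDiffAt_fst.prodMk_space h).contMDiffWithinAt
  contMDiffOn_invFun := by
    have h : ContMDiff 𝓘(ℝ, ℝ × ℝ) 𝓘(ℝ, ℝ) ∞ (fun w : ℝ × ℝ => w.2 / l) :=
      ContDiff.contMDiff (by fun_prop)
    have h' : ContMDiff 𝓘(ℝ, ℝ × ℝ) 𝓘(ℝ, ℝ) ∞ (fun w : ℝ × ℝ => w.1) :=
      ContDiff.contMDiff (by fun_prop)
    exact (h'.prodMk (contMDiff_circleExp.comp h)).contMDiffOn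

theorem circleChart_apply_exp (l θ x : ℝ) (hl : l ≠ 0) :
    circleChart l θ hl (x, Circle.exp θ) = (x, l * θ) := by
  change (x, l * arcAngle θ (Circle.exp θ)) = _
  rw [arcAngle_exp (by simpa using Real.pi_pos)]

theorem mem_circleChart_source (l θ x : ℝ) (hl : l ≠ 0) :
    (x, Circle.exp θ) ∈ (circleChart l θ hl).source := by
  change ((Circle.exp θ * Circle.exp (-θ) : Circle) : ℂ) ∈ Complex.slitPlane
  rw [← Circle.exp_add]
  exact exp_mem_slitPlane (by simpa using Real.pi_pos)

/-- An injective local diffeomorphism is a diffeomorphism onto its image. -/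
theorem exists_partialDiffeomorph_of_injOn {V V' H H' X Y : Type*} [NormedAddCommGroup V]
    [NormedSpace ℝ V] [NormedAddCommGroup V'] [NormedSpace ℝ V'] [TopologicalSpace H]
    [TopologicalSpace H'] {I : ModelWithCorners ℝ V H} {J : ModelWithCorners ℝ V' H'}
    [TopologicalSpace X] [ChartedSpace H X] [TopologicalSpace Y] [ChartedSpace H' Y]
    [Nonempty X] {n : ℕ∞ω} {f : X → Y} {U : Set X} (hU : IsOpen U) (inj : InjOn f U)
    (hf : ∀ x ∈ U, IsLocalDiffeomorphAt I J n f x) :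
    ∃ Θ : PartialDiffeomorph I J X Y n, Θ.source = U ∧ Θ.target = f '' U ∧ ∀ x, Θ x = f x := by
  have hloc : ∀ x ∈ U, ∃ Ψ : PartialDiffeomorph I J X Y n, x ∈ Ψ.source ∧ EqOn f Ψ Ψ.source ∧
      ∀ᶠ y in 𝓝 (f x), y ∈ f '' U ∧ Function.invFunOn f U y = Ψ.symm y := by
    intro x hx
    obtain ⟨Ψ, hxΨ, hΨ⟩ := hf x hx
    refine ⟨Ψ, hxΨ, hΨ, ?_⟩
    have hfx : f x = Ψ x := hΨ hxΨ
    have hxt : Ψ x ∈ Ψ.target := Ψ.map_source hxΨ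
    have hc : Tendsto Ψ.symm (𝓝 (Ψ x)) (𝓝 x) := by
      have := Ψ.contMDiffOn_invFun.continuousOn.continuousAt (Ψ.open_target.mem_nhds hxt)
      rw [ContinuousAt, show Ψ.invFun (Ψ x) = x from Ψ.left_inv hxΨ] at this
      exact this
    rw [hfx]
    filter_upwards [Ψ.open_target.mem_nhds hxt, hc.eventually (hU.mem_nhds hx)] with y hy hyU
    have hfy : f (Ψ.symm y) = y := (hΨ (Ψ.map_target hy)).trans (Ψ.right_inv hy)
    have hm : y ∈ f '' U := ⟨_, hyU, hfy⟩
    exact ⟨hm, inj (Function.invFunOn_mem hm) hyU ((Function.invFunOn_eq hm).trans hfy.symm)⟩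
  refine ⟨{ toFun := f, invFun := Function.invFunOn f U, source := U, target := f '' U,
            map_source' := fun x hx => mem_image_of_mem f hx
            map_target' := fun y hy => Function.invFunOn_mem hy
            left_inv' := fun x hx => inj.leftInvOn_invFunOn hx
            right_inv' := fun y hy => Function.invFunOn_eq hy
            open_source := hU
            open_target := ?_
            contMDiffOn_toFun := fun x hx => (hf x hx).contMDiffAt.contMDiffWithinAt
            contMDiffOn_invFun := ?_ }, rfl, rfl, fun _ => rfl⟩
  · rw [isOpen_iff_eventually]
    rintro _ ⟨x, hx, rfl⟩
    obtain ⟨Ψ, -, -, h⟩ := hloc x hx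
    exact h.mono fun y hy => hy.1
  · rintro _ ⟨x, hx, rfl⟩
    obtain ⟨Ψ, hxΨ, hΨ, h⟩ := hloc x hx
    have h1 : ContMDiffAt J I n Ψ.symm (f x) :=
      Ψ.contMDiffOn_invFun.contMDiffAt (Ψ.open_target.mem_nhds (by
        rw [hΨ hxΨ]; exact Ψ.map_source hxΨ))
    exact (h1.congr_of_eventuallyEq (h.mono fun y hy => hy.2)).contMDiffWithinAt

end AlmostRiemannian

/-! ### Uniqueness of the frame and of `φ` in a normal chart -/

namespace AlmostRiemannian

theorem paramDeriv_congr {M : Type*} [TopologicalSpace M] [ChartedSpace Plane M]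
    {Φ Ψ : ℝ × ℝ → M} {z : ℝ × ℝ} (h : Φ =ᶠ[𝓝 z] Ψ) (v : ℝ × ℝ) :
    (paramDeriv Φ z v : Plane) = paramDeriv Ψ z v := by
  have h1 := h.mfderiv_eq (I := 𝓘(ℝ, ℝ × ℝ)) (I' := 𝓡 2)
  exact congrArg (fun L : ℝ × ℝ →L[ℝ] Plane => L v) h1

variable {M : Type*} [TopologicalSpace M] [ChartedSpace Plane M] [IsManifold (𝓡 2) ∞ M]
  {F : Type*} [NormedAddCommGroup F] [NormedSpace ℝ F]
  {E : M → Type*} [TopologicalSpace (TotalSpace F E)]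
  [∀ q, TopologicalSpace (E q)] [∀ q, AddCommGroup (E q)] [∀ q, Module ℝ (E q)]
  [∀ q, IsTopologicalAddGroup (E q)] [∀ q, ContinuousConstSMul ℝ (E q)]
  [FiberBundle F E] [VectorBundle ℝ F E] [ContMDiffVectorBundle ∞ F E (𝓡 2)]

namespace TwoARS

theorem eq_of_inner_eq_one {S : TwoARS M F E} {q : M} {v w : E q} (hv : S.metric.inner q v v = 1)
    (hw : S.metric.inner q w w = 1) (h : S.metric.inner q v w = 1) : v = w := by
  refine sub_eq_zero.1 (S.eq_zero_of_inner_self ?_)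
  have h' : S.metric.inner q w v = 1 := by rw [S.metric.symm, h]
  simp only [map_sub, sub_apply, hv, hw, h, h']
  norm_num

theorem morphism_injective [T2Space M] {S : TwoARS M F E} {q : M} (hq : q ∉ S.singularSet) :
    Function.Injective (S.morphism q) := by
  rw [← LinearMap.ker_eq_bot, LinearMap.ker_eq_bot']
  intro v hv
  by_contra hne
  exact hq ((S.mem_singularSet_iff q).2 ⟨v, hne, hv⟩)

namespace IsNormalChart

variable {S : TwoARS M F E} {e e' : PartialDiffeomorph 𝓘(ℝ, ℝ × ℝ) (𝓡 2) (ℝ × ℝ) M ∞}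
  {σ₁ σ₂ σ₁' σ₂' : ∀ q, E q} {φ φ' : ℝ × ℝ → ℝ}

/-- Off the axis the bundle morphism is injective, so `∂/∂x` determines the first section. The
second sections are positive multiples of each other; being unit vectors they coincide, and then so
do the exponents. -/
theorem eq_of_fst_ne_zero [T2Space M] (h : S.IsNormalChart e σ₁ σ₂ φ)
    (h' : S.IsNormalChart e' σ₁' σ₂' φ') {w : ℝ × ℝ} (hw : w ∈ e.source) (hw' : w ∈ e'.source)
    (hee : e =ᶠ[𝓝 w] e') (hne : w.1 ≠ 0) :
    σ₁ (e w) = σ₁' (e w) ∧ σ₂ (e w) = σ₂' (e w) ∧ φ w = φ' w := by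
  have hinj := morphism_injective (mt (h.mem_singularSet_iff hw).1 hne)
  have hval : e' w = e w := hee.symm.eq_of_nhds
  have ho := h.orthonormal _ (e.map_source hw)
  have ho' := h'.orthonormal (e w) (by rw [← hval]; exact e'.map_source hw')
  have hl : (S.morphism (e w) (σ₁' (e w)) : Plane) = paramDeriv e' w (1, 0) :=
    (congrArg (fun p => (S.morphism p (σ₁' p) : Plane)) hval).symm.trans (h'.left_eq w hw')
  have hr : (S.morphism (e w) (σ₂' (e w)) : Plane) =
      (w.1 * Real.exp (φ' w)) • (paramDeriv e' w (0, 1) : Plane) :=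
    (congrArg (fun p => (S.morphism p (σ₂' p) : Plane)) hval).symm.trans (h'.right_eq w hw')
  rw [← paramDeriv_congr hee] at hl hr
  have h1 : σ₁ (e w) = σ₁' (e w) := hinj ((h.left_eq w hw).trans hl.symm)
  have h2 : Real.exp (φ' w - φ w) • σ₂ (e w) = σ₂' (e w) := by
    refine hinj (Eq.trans ?_ hr.symm)
    rw [map_smul, h.right_eq w hw]
    refine (smul_smul _ _ _).trans ?_
    change (_ : ℝ) • (paramDeriv e w (0, 1) : Plane) = _
    congr 1
    rw [Real.exp_sub]
    field_simp
  have h3 := ho'.right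
  rw [← h2] at h3
  simp only [map_smul, smul_apply, smul_eq_mul, ho.right, mul_one] at h3
  have h4 : Real.exp (φ' w - φ w) = 1 := by
    have := Real.exp_pos (φ' w - φ w)
    nlinarith
  rw [h4, one_smul] at h2
  exact ⟨h1, h2, by linarith [Real.exp_eq_one_iff _ |>.1 h4]⟩

/-- The frame of a normal chart, and its function `φ`, are determined by the chart. -/
theorem eq_of_eventuallyEq [T2Space M] (h : S.IsNormalChart e σ₁ σ₂ φ)
    (h' : S.IsNormalChart e' σ₁' σ₂' φ') {z : ℝ × ℝ} (hz : z ∈ e.source) (hz' : z ∈ e'.source)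
    (hee : e =ᶠ[𝓝 z] e') :
    σ₁ (e z) = σ₁' (e z) ∧ σ₂ (e z) = σ₂' (e z) ∧ φ z = φ' z := by
  by_cases hne : z.1 ≠ 0
  · exact h.eq_of_fst_ne_zero h' hz hz' hee hne
  rw [not_not] at hne
  have hev : ∀ᶠ w in 𝓝 z, e =ᶠ[𝓝 w] e' ∧ w ∈ e.source ∧ w ∈ e'.source := by
    filter_upwards [hee.eventually_nhds, e.open_source.mem_nhds hz,
      e'.open_source.mem_nhds hz'] with w h1 h2 h3 using ⟨h1, h2, h3⟩
  obtain ⟨O, hO, hOo, hzO⟩ := eventually_nhds_iff.1 hev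
  have hmaps : MapsTo e O (e.target ∩ e'.target) := fun w hw => ⟨e.map_source (hO w hw).2.1, by
    rw [Filter.EventuallyEq.eq_of_nhds (hO w hw).1]; exact e'.map_source (hO w hw).2.2⟩
  have hcont : ContinuousOn e O :=
    e.contMDiffOn_toFun.continuousOn.mono fun w hw => (hO w hw).2.1
  -- On the axis the morphism is not injective. Instead, the inner product of the two unit sections
  -- equals `1` off the axis, hence on it by continuity, which forces equality.
  have key : ∀ {τ τ' : ∀ q, E q}, SmoothSectionOn F τ e.target → SmoothSectionOn F τ' e'.target →
      (∀ p ∈ e.target, S.metric.inner p (τ p) (τ p) = 1) →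
      (∀ p ∈ e'.target, S.metric.inner p (τ' p) (τ' p) = 1) →
      (∀ w ∈ O, w.1 ≠ 0 → τ (e w) = τ' (e w)) → τ (e z) = τ' (e z) := by
    intro τ τ' hτ hτ' hu hu' heq
    have hτ₁ : SmoothSectionOn F τ (e.target ∩ e'.target) := hτ.mono inter_subset_left
    have hτ₂ : SmoothSectionOn F τ' (e.target ∩ e'.target) := hτ'.mono inter_subset_right
    have hc := (S.contMDiffOn_inner hτ₁ hτ₂).continuousOn.comp hcont hmaps
    have h1 := eqOn_of_eqOn_fst_ne_zero hOo hc (continuousOn_const (c := (1 : ℝ)))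
      (fun w hw hw1 => by
        simp only [Function.comp_apply]
        rw [← heq w hw hw1]
        exact hu _ (hmaps hw).1) hzO
    exact eq_of_inner_eq_one (hu _ (hmaps hzO).1) (hu' _ (hmaps hzO).2) h1
  have hO' := fun w (hw : w ∈ O) => h.eq_of_fst_ne_zero h' (hO w hw).2.1 (hO w hw).2.2 (hO w hw).1
  exact ⟨key h.smooth_left h'.smooth_left (fun p hp => (h.orthonormal p hp).left)
      (fun p hp => (h'.orthonormal p hp).left) fun w hw hw1 => (hO' w hw hw1).1,
    key h.smooth_right h'.smooth_right (fun p hp => (h.orthonormal p hp).right)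
      (fun p hp => (h'.orthonormal p hp).right) fun w hw hw1 => (hO' w hw hw1).2.1,
    by rw [h.eq_zero z hz hne, h'.eq_zero z hz' hne]⟩

end IsNormalChart

end TwoARS
end AlmostRiemannian

/-! ### Wrapping the periodic parametrization around the circle -/

namespace AlmostRiemannian

/-- The map on `ℝ × S¹` induced by a map which is periodic in the second variable, of period
`2πl`. -/
noncomputable def wrap {M : Type*} (l : ℝ) (Φ : ℝ × ℝ → M) (p : ℝ × Circle) : M :=
  Φ (p.1, l * Complex.arg (p.2 : ℂ))

section Wrap

variable {M : Type*} {Φ : ℝ × ℝ → M} {T l : ℝ}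

theorem apply_add_intCast_mul (hper : ∀ x y, Φ (x, y + T) = Φ (x, y)) (x y : ℝ) (k : ℤ) :
    Φ (x, y + k * T) = Φ (x, y) := by
  have h : Function.Periodic (fun y => Φ (x, y)) T := hper x
  exact h.int_mul k y

theorem wrap_exp (hper : ∀ x y, Φ (x, y + T) = Φ (x, y)) (hl : l * (2 * Real.pi) = T) (x θ : ℝ) :
    wrap l Φ (x, Circle.exp θ) = Φ (x, l * θ) := by
  obtain ⟨k, hk⟩ := Circle.exp_eq_exp.1 (Circle.exp_arg (Circle.exp θ))
  have hk' : l * Complex.arg ((Circle.exp θ : Circle) : ℂ) = l * θ + k * T := by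
    rw [hk, ← hl]; ring
  rw [wrap, hk', apply_add_intCast_mul hper]

theorem wrap_eq_circleChart (hper : ∀ x y, Φ (x, y + T) = Φ (x, y)) (hl : l * (2 * Real.pi) = T)
    (hl0 : l ≠ 0) (θ : ℝ) (p : ℝ × Circle) : wrap l Φ p = Φ (circleChart l θ hl0 p) := by
  have h : p = (p.1, Circle.exp (arcAngle θ p.2)) := by rw [exp_arcAngle]
  conv_lhs => rw [h]
  exact wrap_exp hper hl _ _

theorem tendsto_circleChart (l θ x : ℝ) (hl : l ≠ 0) :
    Tendsto (circleChart l θ hl) (𝓝 (x, Circle.exp θ)) (𝓝 (x, l * θ)) := by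
  have h := (circleChart l θ hl).contMDiffOn_toFun.continuousOn.continuousAt
    ((circleChart l θ hl).open_source.mem_nhds (mem_circleChart_source l θ x hl))
  rw [ContinuousAt, show (circleChart l θ hl).toFun (x, Circle.exp θ) = _ from
    circleChart_apply_exp l θ x hl] at h
  exact h

end Wrap

variable {M : Type*} [TopologicalSpace M] [ChartedSpace Plane M] [IsManifold (𝓡 2) ∞ M]
  {F : Type*} [NormedAddCommGroup F] [NormedSpace ℝ F]
  {E : M → Type*} [TopologicalSpace (TotalSpace F E)]
  [∀ q, TopologicalSpace (E q)] [∀ q, AddCommGroup (E q)] [∀ q, Module ℝ (E q)]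
  [∀ q, IsTopologicalAddGroup (E q)] [∀ q, ContinuousConstSMul ℝ (E q)]
  [FiberBundle F E] [VectorBundle ℝ F E] [ContMDiffVectorBundle ∞ F E (𝓡 2)]
  {S : TwoARS M F E} {Φ : ℝ × ℝ → M} {T l : ℝ}

namespace TwoARS

theorem IsNormalAt.add_intCast_mul (hper : ∀ x y, Φ (x, y + T) = Φ (x, y)) {x y : ℝ}
    (h : S.IsNormalAt Φ (x, y)) (k : ℤ) : S.IsNormalAt Φ (x, y + k * T) := by
  have h1 : S.IsNormalAt Φ (x, y + k * T + (-k : ℤ) * T) := by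
    convert h using 2
    push_cast
    ring
  have h2 := h1.translate
  simpa only [apply_add_intCast_mul hper] using h2

theorem isLocalDiffeomorphAt_wrap (hper : ∀ x y, Φ (x, y + T) = Φ (x, y))
    (hl : l * (2 * Real.pi) = T) (hl0 : l ≠ 0) {x θ : ℝ} (h : S.IsNormalAt Φ (x, l * θ)) :
    IsLocalDiffeomorphAt (𝓘(ℝ, ℝ).prod (𝓡 1)) (𝓡 2) ∞ (wrap l Φ) (x, Circle.exp θ) := by
  have hΦ : IsLocalDiffeomorphAt 𝓘(ℝ, ℝ × ℝ) (𝓡 2) ∞ Φ (x, l * θ) := by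
    obtain ⟨e, σ₁, σ₂, φ, -, hz, hΦ⟩ := h
    obtain ⟨N, hN, hNo, hzN⟩ := eventually_nhds_iff.1 hΦ
    let e' := (e.toOpenPartialHomeomorph.restrOpen N hNo)
    refine ⟨{ toPartialEquiv := e'.toPartialEquiv, open_source := e'.open_source,
              open_target := e'.open_target
              contMDiffOn_toFun := e.contMDiffOn_toFun.mono fun w hw => hw.1
              contMDiffOn_invFun := e.contMDiffOn_invFun.mono fun w hw => hw.1 },
      ⟨hz, hzN⟩, fun w hw => hN w hw.2⟩
  have hc := PartialDiffeomorph.isLocalDiffeomorphAt _ _ _ (circleChart l θ hl0)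
    (mem_circleChart_source l θ x hl0)
  rw [← circleChart_apply_exp l θ x hl0] at hΦ
  have h1 := hc.comp (𝓡 2) M hΦ
  have h2 : Φ ∘ circleChart l θ hl0 = wrap l Φ :=
    funext fun p => (wrap_eq_circleChart hper hl hl0 θ p).symm
  rwa [h2] at h1

theorem eventually_isNormalAt_wrap (hper : ∀ x y, Φ (x, y + T) = Φ (x, y))
    (hl : l * (2 * Real.pi) = T) (hl0 : l ≠ 0) {x θ : ℝ} (h : S.IsNormalAt Φ (x, l * θ)) :
    ∀ᶠ p : ℝ × Circle in 𝓝 (x, Circle.exp θ), ∀ t : ℝ, Circle.exp t = p.2 →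
      S.IsNormalAt Φ (p.1, l * t) := by
  filter_upwards [(tendsto_circleChart l θ x hl0).eventually h.eventually] with p hp t ht
  rw [← exp_arcAngle θ p.2] at ht
  obtain ⟨k, hk⟩ := Circle.exp_eq_exp.1 ht
  have hk' : l * t = l * arcAngle θ p.2 + k * T := by rw [hk, ← hl]; ring
  rw [hk']
  exact IsNormalAt.add_intCast_mul hper hp k

/-- A locally injective continuous map that is injective on a compact set is injective near it.
Compactness of the circle gives a neighborhood of the core of uniform width. -/
theorem exists_tube [T2Space M] (hper : ∀ x y, Φ (x, y + T) = Φ (x, y))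
    (hl : l * (2 * Real.pi) = T) (hl0 : l ≠ 0) (hΦ : ∀ y, S.IsNormalAt Φ (0, y))
    (hinj : ∀ y y', Φ (0, y) = Φ (0, y') → ∃ k : ℤ, y' = y + k * T) :
    ∃ ε > 0, InjOn (wrap l Φ) (Ioo (-ε) ε ×ˢ univ) ∧
      ∀ x ∈ Ioo (-ε) ε, ∀ θ : ℝ, S.IsNormalAt Φ (x, l * θ) := by
  have hloc : ∀ p ∈ ({0} : Set ℝ) ×ˢ (univ : Set Circle),
      IsLocalDiffeomorphAt (𝓘(ℝ, ℝ).prod (𝓡 1)) (𝓡 2) ∞ (wrap l Φ) p := by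
    rintro ⟨x, z⟩ ⟨rfl, -⟩
    rw [← Circle.exp_arg z]
    exact isLocalDiffeomorphAt_wrap hper hl hl0 (hΦ _)
  have hinj0 : InjOn (wrap l Φ) (({0} : Set ℝ) ×ˢ (univ : Set Circle)) := by
    rintro ⟨x, z⟩ ⟨rfl, -⟩ ⟨x', z'⟩ ⟨rfl, -⟩ h
    rw [← Circle.exp_arg z, ← Circle.exp_arg z', wrap_exp hper hl, wrap_exp hper hl] at h
    obtain ⟨k, hk⟩ := hinj _ _ h
    refine Prod.ext rfl ?_
    rw [← Circle.exp_arg z, ← Circle.exp_arg z']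
    refine (Circle.exp_eq_exp.2 ⟨k, ?_⟩).symm
    refine mul_left_cancel₀ hl0 ?_
    rw [hk, ← hl]
    ring
  obtain ⟨t, ht, htinj⟩ := hinj0.exists_mem_nhdsSet (isCompact_singleton.prod isCompact_univ)
    (fun p hp => (hloc p hp).contMDiffAt.continuousAt) (fun p hp => by
      obtain ⟨Θ, hpΘ, hΘ⟩ := hloc p hp
      exact ⟨Θ.source, Θ.open_source.mem_nhds hpΘ, fun a ha b hb hab =>
        Θ.injOn ha hb (by rw [← hΘ ha, ← hΘ hb, hab])⟩)
  have hnorm : {p : ℝ × Circle | ∀ t : ℝ, Circle.exp t = p.2 → S.IsNormalAt Φ (p.1, l * t)} ∈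
      𝓝ˢ (({0} : Set ℝ) ×ˢ (univ : Set Circle)) := by
    rw [mem_nhdsSet_iff_forall]
    rintro ⟨x, z⟩ ⟨rfl, -⟩
    rw [← Circle.exp_arg z]
    exact eventually_isNormalAt_wrap hper hl hl0 (hΦ _)
  have hboth := inter_mem ht hnorm
  rw [isCompact_singleton.nhdsSet_prod_eq isCompact_univ, nhdsSet_singleton, nhdsSet_univ,
    mem_prod_iff] at hboth
  obtain ⟨u, hu, v, hv, huv⟩ := hboth
  obtain rfl : v = univ := by simpa using hv
  obtain ⟨ε, hε, hεu⟩ := Metric.mem_nhds_iff.1 hu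
  rw [Real.ball_eq_Ioo, zero_sub, zero_add] at hεu
  have hsub : Ioo (-ε) ε ×ˢ (univ : Set Circle) ⊆ u ×ˢ univ := prod_mono hεu le_rfl
  exact ⟨ε, hε, htinj.mono fun p hp => (huv (hsub hp)).1,
    fun x hx θ => (huv (hsub (a := (x, Circle.exp θ)) ⟨hx, trivial⟩)).2 θ rfl⟩

/-- The image of the core is compact, hence closed, and relatively open in the singular set, because
near each of its points the singular set is covered by the axis. Connectedness gives the inclusion
of the component. -/
theorem image_wrap_axis [T2Space M] (hper : ∀ x y, Φ (x, y + T) = Φ (x, y))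
    (hl : l * (2 * Real.pi) = T) (hl0 : l ≠ 0) (hΦ : ∀ y, S.IsNormalAt Φ (0, y)) {q₀ : M}
    (hq₀ : Φ (0, 0) ∈ connectedComponentIn S.singularSet q₀) :
    wrap l Φ '' ({0} ×ˢ univ) = connectedComponentIn S.singularSet q₀ := by
  have hmem : ∀ y, Φ (0, y) ∈ wrap l Φ '' ({0} ×ˢ univ) := fun y =>
    ⟨(0, Circle.exp (y / l)), ⟨rfl, trivial⟩, by
      rw [wrap_exp hper hl, mul_div_cancel₀ _ hl0]⟩
  have hclosed : IsClosed (wrap l Φ '' (({0} : Set ℝ) ×ˢ (univ : Set Circle))) := by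
    refine ((isCompact_singleton.prod isCompact_univ).image_of_continuousOn ?_).isClosed
    rintro ⟨x, z⟩ ⟨rfl, -⟩
    rw [← Circle.exp_arg z]
    exact (isLocalDiffeomorphAt_wrap hper hl hl0
      (hΦ _)).contMDiffAt.continuousAt.continuousWithinAt
  refine Subset.antisymm ?_ ?_
  · rintro _ ⟨⟨x, z⟩, ⟨rfl, -⟩, rfl⟩
    exact axis_mem_connectedComponentIn isPreconnected_univ (fun y _ => hΦ y) (mem_univ 0) hq₀
      (mem_univ _)
  · set A := wrap l Φ '' (({0} : Set ℝ) ×ˢ (univ : Set Circle)) with hA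
    have h := isPreconnected_iff_subset_of_disjoint.1
      (isPreconnected_connectedComponentIn (F := S.singularSet) (x := q₀))
      (interior {p | p ∈ S.singularSet → p ∈ A}) Aᶜ isOpen_interior hclosed.isOpen_compl ?_ ?_
    · rcases h with h | h
      · intro p hp
        exact interior_subset (h hp) (connectedComponentIn_subset _ _ hp)
      · exact absurd (hmem 0) (h hq₀)
    · intro p hp
      by_cases hpA : p ∈ A
      · left
        obtain ⟨⟨x, z⟩, ⟨rfl, -⟩, rfl⟩ := hpA
        rw [mem_interior_iff_mem_nhds]
        filter_upwards [(hΦ (l * Complex.arg (z : ℂ))).eventually_mem_image univ_mem] with p hp hpZ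
        obtain ⟨t, -, -, rfl⟩ := hp hpZ
        exact hmem t
      · exact Or.inr hpA
    · refine eq_empty_of_forall_notMem ?_
      rintro p ⟨hp, hp1, hp2⟩
      exact hp2 (interior_subset hp1 (connectedComponentIn_subset _ _ hp))

end TwoARS
end AlmostRiemannian

/-! ### Coordinate vectors and the frame on the tube -/

namespace AlmostRiemannian

section Coordinates

variable {M : Type*} [TopologicalSpace M] [ChartedSpace Plane M] {Φ : ℝ × ℝ → M} {T l : ℝ}

theorem partialX_wrap (hper : ∀ x y, Φ (x, y + T) = Φ (x, y)) (hl : l * (2 * Real.pi) = T)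
    {x θ : ℝ} (hΦ : MDifferentiableAt 𝓘(ℝ, ℝ × ℝ) (𝓡 2) Φ (x, l * θ)) :
    (partialX (wrap l Φ) x θ : Plane) = paramDeriv Φ (x, l * θ) (1, 0) := by
  have h1 : (fun s : ℝ => wrap l Φ (s, Circle.exp θ)) = Φ ∘ fun s : ℝ => (s, l * θ) :=
    funext fun s => wrap_exp hper hl s θ
  have hg : HasFDerivAt (fun s : ℝ => (s, l * θ))
      ((ContinuousLinearMap.id ℝ ℝ).prod (0 : ℝ →L[ℝ] ℝ)) x :=
    (hasFDerivAt_id x).prodMk (hasFDerivAt_const _ _)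
  have h2 := (HasMFDerivAt.comp x (f := fun s : ℝ => (s, l * θ)) hΦ.hasMFDerivAt
    hg.hasMFDerivAt).mfderiv
  rw [← h1] at h2
  exact congrArg (fun L : ℝ →L[ℝ] Plane => L 1) h2

theorem partialY_wrap (hper : ∀ x y, Φ (x, y + T) = Φ (x, y)) (hl : l * (2 * Real.pi) = T)
    {x θ : ℝ} (hΦ : MDifferentiableAt 𝓘(ℝ, ℝ × ℝ) (𝓡 2) Φ (x, l * θ)) :
    (partialY (wrap l Φ) x θ : Plane) = l • (paramDeriv Φ (x, l * θ) (0, 1) : Plane) := by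
  have h1 : (fun t : ℝ => wrap l Φ (x, Circle.exp t)) = Φ ∘ fun t : ℝ => (x, l * t) :=
    funext fun t => wrap_exp hper hl x t
  have hg : HasFDerivAt (fun t : ℝ => (x, l * t))
      ((0 : ℝ →L[ℝ] ℝ).prod (l • ContinuousLinearMap.id ℝ ℝ)) θ :=
    (hasFDerivAt_const _ _).prodMk ((hasFDerivAt_id θ).const_mul l)
  have h2 := (HasMFDerivAt.comp θ (f := fun t : ℝ => (x, l * t)) hΦ.hasMFDerivAt
    hg.hasMFDerivAt).mfderiv
  rw [← h1] at h2
  have h3 : (partialY (wrap l Φ) x θ : Plane) = paramDeriv Φ (x, l * θ) (0, l * 1) :=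
    congrArg (fun L : ℝ →L[ℝ] Plane => L 1) h2
  rw [h3, show ((0 : ℝ), l * 1) = l • ((0 : ℝ), (1 : ℝ)) by simp]
  exact map_smul (paramDeriv Φ (x, l * θ)) l _

end Coordinates

variable {M : Type*} [TopologicalSpace M] [ChartedSpace Plane M] [IsManifold (𝓡 2) ∞ M]
  {F : Type*} [NormedAddCommGroup F] [NormedSpace ℝ F]
  {E : M → Type*} [TopologicalSpace (TotalSpace F E)]
  [∀ q, TopologicalSpace (E q)] [∀ q, AddCommGroup (E q)] [∀ q, Module ℝ (E q)]
  [∀ q, IsTopologicalAddGroup (E q)] [∀ q, ContinuousConstSMul ℝ (E q)]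
  [FiberBundle F E] [VectorBundle ℝ F E] [ContMDiffVectorBundle ∞ F E (𝓡 2)]
  {S : TwoARS M F E} {Φ : ℝ × ℝ → M} {T l : ℝ}

namespace TwoARS

/-- Translating the second chart by `k * T` gives it the same germ as the first, and the germ
determines frame and function. -/
theorem IsNormalChart.eq_of_periodic [T2Space M] (hper : ∀ x y, Φ (x, y + T) = Φ (x, y))
    {e e' : PartialDiffeomorph 𝓘(ℝ, ℝ × ℝ) (𝓡 2) (ℝ × ℝ) M ∞}
    {σ₁ σ₂ σ₁' σ₂' : ∀ q, E q} {φ φ' : ℝ × ℝ → ℝ}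
    (h : S.IsNormalChart e σ₁ σ₂ φ) (h' : S.IsNormalChart e' σ₁' σ₂' φ') {x y : ℝ} {k : ℤ}
    (hz : (x, y) ∈ e.source) (hz' : (x, y + k * T) ∈ e'.source)
    (he : Φ =ᶠ[𝓝 (x, y)] e) (he' : Φ =ᶠ[𝓝 (x, y + k * T)] e') :
    σ₁ (Φ (x, y)) = σ₁' (Φ (x, y)) ∧ σ₂ (Φ (x, y)) = σ₂' (Φ (x, y)) ∧
      φ (x, y) = φ' (x, y + k * T) := by
  have h1 : (1 : ℝ) ^ 2 = 1 := by norm_num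
  have h2 := h'.comp_affine (s₁ := 1) (s₂ := 1) (k * T) h1 h1
  have hsrc : (x, y) ∈ ((affineDiffeo 1 1 (k * T) h1 h1).trans e').source :=
    ⟨trivial, show ((1 : ℝ) * x, (1 : ℝ) * y + k * T) ∈ e'.source by simpa using hz'⟩
  have ht : Tendsto (fun w : ℝ × ℝ => (w.1, w.2 + k * T)) (𝓝 (x, y)) (𝓝 (x, y + k * T)) := by
    have : ContinuousAt (fun w : ℝ × ℝ => (w.1, w.2 + k * T)) (x, y) := by fun_prop
    exact this
  have hee : e =ᶠ[𝓝 (x, y)] ((affineDiffeo 1 1 (k * T) h1 h1).trans e') := by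
    filter_upwards [he, ht.eventually he'] with w hw hw'
    rw [← hw]
    change Φ w = e' (1 * w.1, 1 * w.2 + k * T)
    rw [one_mul, one_mul, ← hw', apply_add_intCast_mul hper]
  have := h.eq_of_eventuallyEq h2 hz hsrc hee
  rw [he.eq_of_nhds]
  simpa using this

/-- A tube covered by a periodic normal parametrization carries a global frame. -/
theorem exists_tube_frame [T2Space M] (hper : ∀ x y, Φ (x, y + T) = Φ (x, y))
    (hl : l * (2 * Real.pi) = T) (hl0 : l ≠ 0) {ε : ℝ}
    (hinj : InjOn (wrap l Φ) (Ioo (-ε) ε ×ˢ univ))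
    (hΦ : ∀ x ∈ Ioo (-ε) ε, ∀ θ : ℝ, S.IsNormalAt Φ (x, l * θ)) :
    ∃ (σ₁ σ₂ : ∀ q, E q) (c : M → ℝ), ∀ x ∈ Ioo (-ε) ε, ∀ θ : ℝ, ∃ e s₁ s₂ φ,
      S.IsNormalChart e s₁ s₂ φ ∧ (x, l * θ) ∈ e.source ∧ Φ =ᶠ[𝓝 (x, l * θ)] e ∧
      ∀ᶠ w in 𝓝 (x, l * θ), σ₁ (e w) = s₁ (e w) ∧ σ₂ (e w) = s₂ (e w) ∧ c (e w) = φ w := by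
  -- At each point of the tube the values are taken from an arbitrary normal chart above it, with
  -- zero as default elsewhere. Two parameters of the same point differ by a multiple of `T`, so the
  -- choice does not matter.
  have hex : ∀ p : M, ∃ (v₁ v₂ : E p) (c : ℝ), (∃ x ∈ Ioo (-ε) ε, ∃ θ, Φ (x, l * θ) = p) →
      ∃ x ∈ Ioo (-ε) ε, ∃ θ, Φ (x, l * θ) = p ∧ ∃ e s₁ s₂ φ, S.IsNormalChart e s₁ s₂ φ ∧
        (x, l * θ) ∈ e.source ∧ Φ =ᶠ[𝓝 (x, l * θ)] e ∧ v₁ = s₁ p ∧ v₂ = s₂ p ∧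
        c = φ (x, l * θ) := by
    intro p
    by_cases hp : ∃ x ∈ Ioo (-ε) ε, ∃ θ, Φ (x, l * θ) = p
    · obtain ⟨x, hx, θ, hθ⟩ := hp
      obtain ⟨e, s₁, s₂, φ, h, hz, he⟩ := hΦ x hx θ
      exact ⟨s₁ p, s₂ p, φ (x, l * θ), fun _ =>
        ⟨x, hx, θ, hθ, e, s₁, s₂, φ, h, hz, he, rfl, rfl, rfl⟩⟩
    · exact ⟨0, 0, 0, fun h => absurd h hp⟩
  choose σ₁ σ₂ c H using hex
  refine ⟨σ₁, σ₂, c, fun x hx θ => ?_⟩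
  obtain ⟨e, s₁, s₂, φ, h, hz, he⟩ := hΦ x hx θ
  refine ⟨e, s₁, s₂, φ, h, hz, he, ?_⟩
  have hx' : ∀ᶠ w : ℝ × ℝ in 𝓝 (x, l * θ), w.1 ∈ Ioo (-ε) ε :=
    continuousAt_fst.eventually (isOpen_Ioo.mem_nhds hx)
  filter_upwards [hx', e.open_source.mem_nhds hz, he.eventually_nhds] with ⟨a, b⟩ ha hb hab
  rw [← Filter.EventuallyEq.eq_of_nhds hab]
  obtain ⟨t, rfl⟩ : ∃ t, b = l * t := ⟨b / l, by field_simp⟩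
  obtain ⟨a', ha', t', hΦt, e', s₁', s₂', φ', h', hz', he', hv₁, hv₂, hc⟩ :=
    H (Φ (a, l * t)) ⟨a, ha, t, rfl⟩
  rw [← wrap_exp hper hl, ← wrap_exp hper hl] at hΦt
  have hq := hinj ⟨ha', trivial⟩ ⟨ha, trivial⟩ hΦt
  rw [Prod.mk.injEq] at hq
  obtain ⟨rfl, hexp⟩ := hq
  obtain ⟨k, hk⟩ := Circle.exp_eq_exp.1 hexp
  have hk' : l * t' = l * t + k * T := by rw [hk, ← hl]; ring
  rw [hk'] at hz' he' hc
  obtain ⟨r₁, r₂, r₃⟩ := h.eq_of_periodic hper h' hb hz' hab he'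
  exact ⟨hv₁.trans r₁.symm, hv₂.trans r₂.symm, hc.trans r₃.symm⟩

end TwoARS

end AlmostRiemannian

/-! ### Assembly of the tubular normal form -/

open AlmostRiemannian in
theorem mainTheorem6
    {M : Type*} [TopologicalSpace M] [T2Space M] [CompactSpace M]
    [ChartedSpace Plane M] [IsManifold (𝓡 2) ∞ M]
    {F : Type*} [NormedAddCommGroup F] [NormedSpace ℝ F]
    {E : M → Type*} [TopologicalSpace (TotalSpace F E)]
    [∀ q, TopologicalSpace (E q)] [∀ q, AddCommGroup (E q)] [∀ q, Module ℝ (E q)]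
    [∀ q, IsTopologicalAddGroup (E q)] [∀ q, ContinuousConstSMul ℝ (E q)]
    [FiberBundle F E] [VectorBundle ℝ F E] [ContMDiffVectorBundle ∞ F E (𝓡 2)]
    (hM : IsOrientable M)
    (S : TwoARS M F E) (hS : S.H0)
    (W : Set M) (hW : ∃ q ∈ S.singularSet, W = connectedComponentIn S.singularSet q)
    (hT : ∀ q ∈ W, ¬ S.IsTangencyPoint q) :
    ∃ ε : ℝ, 0 < ε ∧
      ∃ Φ : PartialDiffeomorph (𝓘(ℝ, ℝ).prod (𝓡 1)) (𝓡 2) (ℝ × Circle) M ∞,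
        Φ.source = Ioo (-ε) ε ×ˢ univ ∧
        W = Φ '' ({0} ×ˢ univ) ∧
        ∃ X₁ X₂ : ∀ q : M, TangentSpace (𝓡 2) q,
          S.IsOrthonormalFrameOn Φ.target X₁ X₂ ∧
          ∃ φ : ℝ × Circle → ℝ,
            ContMDiffOn (𝓘(ℝ, ℝ).prod (𝓡 1)) 𝓘(ℝ, ℝ) ∞ φ (Ioo (-ε) ε ×ˢ univ) ∧
            ∀ x ∈ Ioo (-ε) ε, ∀ θ : ℝ,
              X₁ (Φ (x, Circle.exp θ)) = partialX Φ x θ ∧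
              X₂ (Φ (x, Circle.exp θ)) =
                (x * Real.exp (φ (x, Circle.exp θ))) • partialY Φ x θ := by
  obtain ⟨q₀, hq₀, rfl⟩ := hW
  obtain ⟨T, hT0, Φ, hbase, hper, hnorm, hfund⟩ :=
    S.exists_periodic_normal hM hS.step_three hq₀ hT
  obtain ⟨l, hl0, hl⟩ : ∃ l : ℝ, 0 < l ∧ l * (2 * Real.pi) = T :=
    ⟨T / (2 * Real.pi), by positivity, by field_simp⟩
  obtain ⟨ε, hε, hinj, htube⟩ := TwoARS.exists_tube hper hl hl0.ne' hnorm hfund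
  obtain ⟨Θ, hΘs, hΘt, hΘ⟩ := exists_partialDiffeomorph_of_injOn (I := 𝓘(ℝ, ℝ).prod (𝓡 1))
    (J := 𝓡 2) (n := ∞) (f := wrap l Φ) (isOpen_Ioo.prod isOpen_univ) hinj (by
      rintro ⟨x, z⟩ ⟨hx, -⟩
      rw [← Circle.exp_arg z]
      exact TwoARS.isLocalDiffeomorphAt_wrap hper hl hl0.ne' (htube x hx _))
  have hΘw : (Θ : ℝ × Circle → M) = wrap l Φ := funext hΘ
  obtain ⟨σ₁, σ₂, c, H⟩ := TwoARS.exists_tube_frame hper hl hl0.ne' hinj htube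
  have hval : ∀ x θ, Θ (x, Circle.exp θ) = Φ (x, l * θ) := fun x θ => by
    rw [hΘ, wrap_exp hper hl]
  have hH : ∀ x ∈ Ioo (-ε) ε, ∀ θ : ℝ, ∃ e s₁ s₂ φ,
      S.IsNormalChart e s₁ s₂ φ ∧ (x, l * θ) ∈ e.source ∧ Φ =ᶠ[𝓝 (x, l * θ)] e ∧
      (∀ᶠ p in 𝓝 (Θ (x, Circle.exp θ)), σ₁ p = s₁ p ∧ σ₂ p = s₂ p) ∧
      Θ (x, Circle.exp θ) ∈ e.target ∧ ∀ᶠ w in 𝓝 (x, l * θ), c (Φ w) = φ w := by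
    intro x hx θ
    obtain ⟨e, s₁, s₂, φ, h, hz, he, hev⟩ := H x hx θ
    have hΘe : Θ (x, Circle.exp θ) = e (x, l * θ) := by rw [hval, he.eq_of_nhds]
    have hmem : Θ (x, Circle.exp θ) ∈ e.target := hΘe ▸ e.map_source hz
    refine ⟨e, s₁, s₂, φ, h, hz, he, ?_, hmem, ?_⟩
    · have hcont : Tendsto e.symm (𝓝 (Θ (x, Circle.exp θ))) (𝓝 (x, l * θ)) := by
        have h1 := e.contMDiffOn_invFun.continuousOn.continuousAt (e.open_target.mem_nhds hmem)
        rw [ContinuousAt, show e.invFun (Θ (x, Circle.exp θ)) = (x, l * θ) by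
          rw [hΘe]; exact e.left_inv hz] at h1
        exact h1
      filter_upwards [hcont.eventually hev, e.open_target.mem_nhds hmem] with p hp hpt
      rw [show e (e.symm p) = p from e.right_inv hpt] at hp
      exact ⟨hp.1, hp.2.1⟩
    · filter_upwards [hev, he] with w hw hw'
      rw [hw']
      exact hw.2.2
  have hpt : ∀ p ∈ Θ.target, ∃ x ∈ Ioo (-ε) ε, ∃ θ : ℝ, Θ (x, Circle.exp θ) = p := by
    intro p hp
    rw [hΘt] at hp
    obtain ⟨⟨x, z⟩, ⟨hx, -⟩, rfl⟩ := hp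
    exact ⟨x, hx, Complex.arg (z : ℂ), by rw [Circle.exp_arg, hΘ]⟩
  -- Since `y = l * θ`, the angular vector is `l` times `∂/∂y`. Subtracting `Real.log l` from the
  -- function `c` compensates for this factor.
  refine ⟨ε, hε, Θ, hΘs, ?_, fun q => S.morphism q (σ₁ q), fun q => S.morphism q (σ₂ q),
    ⟨σ₁, σ₂, fun p hp => ?_, fun p hp => ?_, fun p hp => ?_⟩,
    fun p => c (wrap l Φ p) - Real.log l, ?_, fun x hx θ => ?_⟩
  · rw [hΘw, TwoARS.image_wrap_axis hper hl hl0.ne' hnorm hbase]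
  · obtain ⟨x, hx, θ, rfl⟩ := hpt p hp
    obtain ⟨e, s₁, s₂, φ, h, -, -, hev, hmem, -⟩ := hH x hx θ
    refine ((h.smooth_left.contMDiffAt (e.open_target.mem_nhds hmem)).congr_of_eventuallyEq
      ?_).contMDiffWithinAt
    filter_upwards [hev] with q hq
    rw [hq.1]
  · obtain ⟨x, hx, θ, rfl⟩ := hpt p hp
    obtain ⟨e, s₁, s₂, φ, h, -, -, hev, hmem, -⟩ := hH x hx θ
    refine ((h.smooth_right.contMDiffAt (e.open_target.mem_nhds hmem)).congr_of_eventuallyEq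
      ?_).contMDiffWithinAt
    filter_upwards [hev] with q hq
    rw [hq.2]
  · obtain ⟨x, hx, θ, rfl⟩ := hpt p hp
    obtain ⟨e, s₁, s₂, φ, h, -, -, hev, hmem, -⟩ := hH x hx θ
    have ho := h.orthonormal _ hmem
    rw [← hev.self_of_nhds.1, ← hev.self_of_nhds.2] at ho
    exact ⟨ho.left, ho.right, ho.cross, rfl, rfl⟩
  · rintro ⟨x, z⟩ ⟨hx, -⟩
    obtain ⟨θ, rfl⟩ : ∃ θ, z = Circle.exp θ := ⟨_, (Circle.exp_arg z).symm⟩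
    obtain ⟨e, s₁, s₂, φ, h, hz, -, -, -, hc⟩ := hH x hx θ
    have h1 : ContMDiffAt 𝓘(ℝ, ℝ × ℝ) 𝓘(ℝ, ℝ) ∞ (fun w => φ w - Real.log l)
        (circleChart l θ hl0.ne' (x, Circle.exp θ)) := by
      rw [circleChart_apply_exp]
      exact ((h.contDiffOn.contDiffAt (e.open_source.mem_nhds hz)).sub
        contDiffAt_const).contMDiffAt
    have h2 := h1.comp (x, Circle.exp θ)
      ((circleChart l θ hl0.ne').contMDiffOn_toFun.contMDiffAt
        ((circleChart l θ hl0.ne').open_source.mem_nhds (mem_circleChart_source l θ x hl0.ne')))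
    refine (h2.congr_of_eventuallyEq ?_).contMDiffWithinAt
    filter_upwards [(tendsto_circleChart l θ x hl0.ne').eventually hc] with p hp
    rw [wrap_eq_circleChart hper hl hl0.ne' θ p, hp]
    rfl
  · obtain ⟨e, s₁, s₂, φ, h, hz, he, hev, hmem, hc⟩ := hH x hx θ
    have hd : MDifferentiableAt 𝓘(ℝ, ℝ × ℝ) (𝓡 2) Φ (x, l * θ) :=
      (e.mdifferentiableAt (by simp) hz).congr_of_eventuallyEq he
    have hΘe : Θ (x, Circle.exp θ) = e (x, l * θ) := by rw [hval, he.eq_of_nhds]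
    have hX : (partialX Θ x θ : Plane) = paramDeriv Φ (x, l * θ) (1, 0) := by
      rw [hΘw]; exact partialX_wrap hper hl hd
    have hY : (partialY Θ x θ : Plane) = l • (paramDeriv Φ (x, l * θ) (0, 1) : Plane) := by
      rw [hΘw]; exact partialY_wrap hper hl hd
    constructor
    · change (S.morphism _ (σ₁ _) : Plane) = partialX Θ x θ
      rw [hev.self_of_nhds.1, hX, paramDeriv_congr he]
      exact (congrArg (fun p => (S.morphism p (s₁ p) : Plane)) hΘe).trans (h.left_eq _ hz)
    · have hr : (x * Real.exp (φ (x, l * θ))) = (x * Real.exp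
          (c (wrap l Φ (x, Circle.exp θ)) - Real.log l)) * l := by
        rw [wrap_exp hper hl, hc.self_of_nhds, Real.exp_sub, Real.exp_log hl0]
        field_simp
      change (S.morphism _ (σ₂ _) : Plane) = (_ : ℝ) • (partialY Θ x θ : Plane)
      rw [hev.self_of_nhds.2, hY, paramDeriv_congr he]
      refine ((congrArg (fun p => (S.morphism p (s₂ p) : Plane)) hΘe).trans
        (h.right_eq _ hz)).trans ?_
      rw [hr]
      exact mul_smul (_ : ℝ) l (paramDeriv e (x, l * θ) (0, 1) : Plane)
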